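/- **Setting.** Let $A_1=\begin{pmatrix}1&0\\0&-1\end{pmatrix}$, $A_2=\begin{pmatrix}0&1\\1&0\end{pmatrix}$, $A_3=\begin{pmatrix}0&i\\-i&0\end{pmatrix}$ and $A(\xi)=\sum_j\xi_jA_j$ for $\xi\in\mathbb C^3$. For a matrix $T$ without purely imaginary eigenvalues let $\mathcal E^{\pm}(T)$ be the spectral subspace of the eigenvalues with strictly positive (resp. negative) real part, and $\pi^\pm(T)$ the corresponding spectral projections; for $\xi\in\mathbb C^3$ write $\mathcal E^\pm(\xi)=\mathcal E^\pm(A(\xi))$, $\pi^\pm(\xi)=\pi^\pm(A(\xi))$. Let $L_1,L_2,L_3>0$, $\mathcal Q=\{x\in\mathbb R^3:|x_j|<L_j/2,\ j=1,2,3\}$, and let $\sigma_1,\sigma_2,\sigma_3\in C_0^\infty(\mathbb R)$ be non-negative. For $0<\delta<1$ let $\mathcal Q_\delta$ denote any bounded convex open set with $C^\infty$ boundary that coincides with $\mathcal Q$ outside the $\delta/2$-neighbourhood of the edges and corners of $\mathcal Q$, and let $\nu$ be its outward unit normal. Put $$\widetilde\partial_j=\frac{\tau}{\tau+\sigma_j(x_j)}\,\partial_j,\qquad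 \widetilde\nu(\tau,x)=\Big(\frac{\nu_j(x)\,\tau}{\tau+\sigma_j(x_j)}\Big)_{j=1,2,3},\qquad V(\tau,x,\partial)=\Big(\sum_j\frac{\nu_j^2\tau^2}{(\tau+\sigma_j)^2}\Big)^{-1/2}\sum_j\frac{\nu_j\tau^2}{(\tau+\sigma_j)^2}\,\partial_j .$$ For real $\tau>0$ let $X(\tau,x)=(X_1,X_2,X_3)$ be the stretching $X_j(\tau,x_j)=\int_0^{x_j}\frac{\tau+\sigma_j(s)}{\tau}\,ds$, let $\underline{\mathcal Q_\delta}=X(\tau,\mathcal Q_\delta)$, let $\nu_{\underline{\mathcal Q_\delta}}$ be its outward unit normal and $H_{\underline{\mathcal Q_\delta}}$ its mean curvature, i.e. the average of the two principal curvatures, which are the eigenvalues of the Weingarten map $v\mapsto v\cdot\nabla\nu_{\underline{\mathcal Q_\delta}}$ (so that the unit ball has $H=1$). **Statement.** There are $m>0$ and $R_3\ge R_2\ge R_1>1$, independent of $\delta$ and of the choice of $\mathcal Q_\delta$, such that the following holds for every $\mathcal Q_\delta$, $0<\delta<1$. (0) (Transverse identity, real $\tau$.) If $\tau\in\,]m,\infty[$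 and $u\in H^2(\mathcal Q_\delta;\mathbb C^2)$ satisfies $u\in\mathcal E^+(\widetilde\nu(\tau,x))$ on $\partial\mathcal Q_\delta$, then $$\pi^+(\widetilde\nu)\sum_{j=1}^3A_j\widetilde\partial_ju=\pi^+(\widetilde\nu)\Big(V(\tau,x,\partial)+H_{\underline{\mathcal Q_\delta}}(X(\tau,x))\Big)u\quad\text{on }\partial\mathcal Q_\delta,\tag{$*$}$$ in the sense of traces. (i) For $|\tau|>R_1$ and $x\in\partial\mathcal Q_\delta$ the spectrum of $A(\widetilde\nu(\tau,x))$ consists of one simple eigenvalue in $|z-1|<1$ and one simple eigenvalue in $|z+1|<1$, and the maps $\tau\mapsto\pi^\pm(A(\widetilde\nu(\tau,x)))$ are analytic in $|\tau|>R_1$, for each $x\in\partial\mathcal Q_\delta$ and also as maps with values in $C^\infty(\partial\mathcal Q_\delta;\mathrm{Hom}(\mathbb C^2))$. (ii) The function $\tau\mapsto\nu_{\underline{\mathcal Q_\delta}}(X(\tau,\cdot))$ of real $\tau>m$ with values in $C^\infty(\partial\mathcal Q_\delta)$ has a holomorphic extension to $\{|\tau|>R_2\}$: there is a holomorphic function on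 this set with values in $C^\infty(\partial\mathcal Q_\delta;\mathbb C^3)$ that agrees with it for all real $\tau>\max(m,R_2)$. (iii) In the same sense $\tau\mapsto H_{\underline{\mathcal Q_\delta}}(X(\tau,\cdot))$ has a holomorphic extension to $\{|\tau|>R_3\}$ with values in $C^\infty(\partial\mathcal Q_\delta)$; for complex $\tau$ the same symbol denotes this extension. (iv) (Transverse identity, complex $\tau$.) If $\mathcal O\subset\{|\tau|>R_3\}$ is open and connected and meets the real axis, and if $\mathcal O\ni\tau\mapsto u(\tau)\in H^2(\mathcal Q_\delta;\mathbb C^2)$ is holomorphic and satisfies $u(\tau)\in\mathcal E^+(\widetilde\nu(\tau,x))$ on $\partial\mathcal Q_\delta$ for all $\tau\in\mathcal O$, then $(*)$ holds for all $\tau\in\mathcal O$. -/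

import Mathlib

open Set Filter Topology MeasureTheory
open scoped ContDiff

noncomputable section

namespace StretchedPauli

/-- Physical space `ℝ³` with the Euclidean norm. -/
abbrev E3 := EuclideanSpace ℝ (Fin 3)

/-- The parameter plane `ℝ²` of local parametrizations of surfaces. -/
abbrev E2 := EuclideanSpace ℝ (Fin 2)

/-- The spinor space `ℂ²` (only its topology and its linear structure matter below). -/
abbrev Spinor := Fin 2 → ℂ

/-! ### The Pauli matrices and spectral projections -/

/-- The matrices `A₁, A₂, A₃` of the Pauli system. -/
def pauliMatrix : Fin 3 → Matrix (Fin 2) (Fin 2) ℂ :=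
  ![!![1, 0; 0, -1], !![0, 1; 1, 0], !![0, Complex.I; -Complex.I, 0]]

/-- The symbol `A(ξ) = ∑ ξⱼ Aⱼ`, for `ξ ∈ ℂ³`, as a matrix. -/
def pauliSymbol (ξ : Fin 3 → ℂ) : Matrix (Fin 2) (Fin 2) ℂ :=
  ∑ j, ξ j • pauliMatrix j

section Spectral

variable {V : Type*} [AddCommGroup V] [Module ℂ V]

/-- `ℰ⁺(T)`: the spectral subspace of the eigenvalues with strictly positive real part. -/
def posSpace (T : Module.End ℂ V) : Submodule ℂ V :=
  ⨆ z ∈ {z : ℂ | 0 < z.re}, T.maxGenEigenspace z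

/-- `ℰ⁻(T)`: the spectral subspace of the eigenvalues with strictly negative real part. -/
def negSpace (T : Module.End ℂ V) : Submodule ℂ V :=
  ⨆ z ∈ {z : ℂ | z.re < 0}, T.maxGenEigenspace z

open Classical in
/-- `π⁺(T)`: the spectral projection onto `ℰ⁺(T)`, i.e. the projection along `ℰ⁻(T)`.
The two spaces are complementary when `T` has no purely imaginary eigenvalue
and `V` has finite dimension. -/
def posProj (T : Module.End ℂ V) : Module.End ℂ V :=
  if h : IsCompl (posSpace T) (negSpace T) then (posSpace T).projection (negSpace T) h else 0

open Classical in
/-- `π⁻(T)`: the spectral projection onto `ℰ⁻(T)`, along `ℰ⁺(T)`. -/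
def negProj (T : Module.End ℂ V) : Module.End ℂ V :=
  if h : IsCompl (negSpace T) (posSpace T) then (negSpace T).projection (posSpace T) h else 0

end Spectral

/-! ### Smooth domains, the unit normal, the mean curvature -/

/-- `ρ` is a smooth defining function of `Ω` near `p`: near `p`, the set `Ω` is `{ρ < 0}`,
and `∇ρ(p) ≠ 0`. -/
structure IsLocalDefiningFunction (Ω : Set E3) (p : E3) (ρ : E3 → ℝ) : Prop where
  smooth : ContDiff ℝ ∞ ρ
  gradient_ne : gradient ρ p ≠ 0
  locally_eq : ∀ᶠ q in 𝓝 p, (q ∈ Ω ↔ ρ q < 0)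

/-- `Ω` is a bounded open set with `C^∞` boundary. -/
structure IsSmoothDomain (Ω : Set E3) : Prop where
  isOpen : IsOpen Ω
  bounded : Bornology.IsBounded Ω
  boundary : ∀ p ∈ frontier Ω, ∃ ρ, IsLocalDefiningFunction Ω p ρ

open Classical in
/-- The outward unit normal `∇ρ/|∇ρ|` of `Ω` at the boundary point `p`
(it does not depend on the local defining function `ρ`). -/
def outwardNormal (Ω : Set E3) (p : E3) : E3 :=
  if h : ∃ ρ, IsLocalDefiningFunction Ω p ρ then
    ‖gradient h.choose p‖⁻¹ • gradient h.choose p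
  else 0

/-- The tangent plane of `∂Ω` at `p`. -/
def tangentPlane (Ω : Set E3) (p : E3) : Submodule ℝ E3 :=
  (Submodule.span ℝ {outwardNormal Ω p})ᗮ

/-- The Weingarten map `v ↦ v · ∇ν` of the tangent plane of `∂Ω` at `p`: the differential of the
outward unit normal along `∂Ω`. (A derivative within `∂Ω` is determined on tangent vectors, and
there it takes tangent values; the projection only adjusts the codomain.) -/
def weingarten (Ω : Set E3) (p : E3) : tangentPlane Ω p →ₗ[ℝ] tangentPlane Ω p :=
  ((tangentPlane Ω p).orthogonalProjectionOnto ∘L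
    fderivWithin ℝ (outwardNormal Ω) (frontier Ω) p ∘L (tangentPlane Ω p).subtypeL).toLinearMap

/-- The mean curvature of `∂Ω` at `p`: the average of the two principal curvatures, that is half of
the trace of the Weingarten map. The unit ball has mean curvature `1`. -/
def meanCurvature (Ω : Set E3) (p : E3) : ℝ :=
  (1 / 2) * LinearMap.trace ℝ (tangentPlane Ω p) (weingarten Ω p)

/-! ### Holomorphic functions with values in `C^∞(S)`, `S` a surface -/

/-- `φ : W → S` is a regular smooth local parametrization of the surface `S`. -/
structure IsLocalParam (S : Set E3) (W : Set E2) (φ : E2 → E3) : Prop where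
  isOpen : IsOpen W
  smooth : ContDiffOn ℝ ∞ φ W
  mapsTo : MapsTo φ W S
  immersion : ∀ α ∈ W, Function.Injective (fderiv ℝ φ α)

section Holomorphic

variable {F : Type*} [NormedAddCommGroup F] [NormedSpace ℂ F]

/-- `g` restricted to the surface `S` belongs to `C^∞(S; F)`. -/
def SmoothOnSurface (S : Set E3) (g : E3 → F) : Prop :=
  ∀ W φ, IsLocalParam S W φ → ContDiffOn ℝ ∞ (fun α => g (φ α)) W

/-- Convergence in `C^∞(S; F)`: in every local parametrization, the derivatives of every order
converge uniformly on compact sets. -/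
def TendstoSmooth {ι : Type*} (S : Set E3) (g : ι → E3 → F) (g₀ : E3 → F) (l : Filter ι) : Prop :=
  ∀ W φ, IsLocalParam S W φ → ∀ K ⊆ W, IsCompact K → ∀ k : ℕ,
    TendstoUniformlyOn (fun i => iteratedFDeriv ℝ k (fun α => g i (φ α)))
      (iteratedFDeriv ℝ k (fun α => g₀ (φ α))) l K

/-- `τ ↦ f τ` is a holomorphic function on the open set `D ⊆ ℂ` with values in the Fréchet space
`C^∞(S; F)`: the complex difference quotients converge in `C^∞(S; F)`. -/
def HolomorphicIntoSmooth (D : Set ℂ) (S : Set E3) (f : ℂ → E3 → F) : Prop :=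
  ∀ τ ∈ D, SmoothOnSurface S (f τ) ∧ ∃ f' : E3 → F, SmoothOnSurface S f' ∧
    TendstoSmooth S (fun (τ' : ℂ) x => (τ' - τ)⁻¹ • (f τ' x - f τ x)) f' (𝓝[≠] τ)

end Holomorphic

/-! ### The box `𝒬` and its smoothings `𝒬_δ` -/

/-- The box `𝒬 = {|xⱼ| < Lⱼ/2}`. -/
def box (L : Fin 3 → ℝ) : Set E3 := {x | ∀ j, |x j| < L j / 2}

/-- The six open faces of the box, indexed by a coordinate and a sign. -/
def face (L : Fin 3 → ℝ) (k : Fin 3 × ℤˣ) : Set E3 :=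
  {x | x k.1 = ((k.2 : ℤ) : ℝ) * (L k.1 / 2) ∧ ∀ i, i ≠ k.1 → |x i| < L i / 2}

/-- The edges and corners of the box. -/
def singularSet (L : Fin 3 → ℝ) : Set E3 :=
  {x | x ∈ frontier (box L) ∧ ∃ k l, k ≠ l ∧ x ∈ closure (face L k) ∩ closure (face L l)}

/-- `Ω` is a smoothing `𝒬_δ` of the box: a bounded smooth convex open set that differs from the
box only in the `δ/2`-neighbourhood of its edges and corners. -/
structure IsSmoothedBox (L : Fin 3 → ℝ) (δ : ℝ) (Ω : Set E3) : Prop where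
  smoothDomain : IsSmoothDomain Ω
  convex : Convex ℝ Ω
  agree : Ω \ Metric.thickening (δ / 2) (singularSet L) =
    box L \ Metric.thickening (δ / 2) (singularSet L)

/-! ### Stretching -/

/-- The coordinate stretching `x ↦ X(τ, x)` for real `τ`:
`∂Xⱼ/∂xⱼ = (τ + σⱼ(xⱼ))/τ` and `Xⱼ = 0` at `xⱼ = 0`. -/
def stretch (σ : Fin 3 → ℝ → ℝ) (τ : ℝ) (x : E3) : E3 :=
  WithLp.toLp 2 fun j => ∫ s in (0 : ℝ)..x j, (τ + σ j s) / τ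

/-- The image of `Ω` under the stretching. -/
def stretchedDomain (σ : Fin 3 → ℝ → ℝ) (τ : ℝ) (Ω : Set E3) : Set E3 := stretch σ τ '' Ω

/-- The factor `τ/(τ + σⱼ(xⱼ))`; thus `∂̃ⱼ = stretchFactor σ τ x j • ∂ⱼ`. -/
def stretchFactor (σ : Fin 3 → ℝ → ℝ) (τ : ℂ) (x : E3) (j : Fin 3) : ℂ :=
  τ / (τ + (σ j (x j) : ℂ))

/-- `ν̃(τ, x)`, where `ν` is the outward unit normal to `∂Ω` at `x`. -/
def nuTilde (σ : Fin 3 → ℝ → ℝ) (Ω : Set E3) (τ : ℂ) (x : E3) (j : Fin 3) : ℂ :=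
  (outwardNormal Ω x j : ℂ) * stretchFactor σ τ x j

/-- `A(ν̃(τ, x))` as a matrix. -/
def normalMatrix (σ : Fin 3 → ℝ → ℝ) (Ω : Set E3) (τ : ℂ) (x : E3) : Matrix (Fin 2) (Fin 2) ℂ :=
  pauliSymbol (nuTilde σ Ω τ x)

/-- `A(ν̃(τ, x))` as an endomorphism of `ℂ²`. -/
def normalEnd (σ : Fin 3 → ℝ → ℝ) (Ω : Set E3) (τ : ℂ) (x : E3) : Module.End ℂ Spinor :=
  Matrix.toLin' (normalMatrix σ Ω τ x)

/-- `V(τ, x, ∂) u = (∑ νⱼ²τ²/(τ+σⱼ)²)^{-1/2} ∑ νⱼτ²/(τ+σⱼ)² ∂ⱼu` at a boundary point `x`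
where `∂ⱼu` has the value `du j`. -/
def transverseDeriv (σ : Fin 3 → ℝ → ℝ) (Ω : Set E3) (τ : ℂ) (x : E3)
    (du : Fin 3 → Spinor) : Spinor :=
  (∑ j, (outwardNormal Ω x j : ℂ) ^ 2 * stretchFactor σ τ x j ^ 2) ^ (-(1 / 2) : ℂ) •
    ∑ j, ((outwardNormal Ω x j : ℂ) * stretchFactor σ τ x j ^ 2) • du j

/-! ### The Sobolev space `H²(Ω; ℂ²)` and boundary traces -/

/-- `L²(Ω; ℂ²)`. -/
abbrev L2 (Ω : Set E3) := Lp Spinor 2 ((volume : Measure E3).restrict Ω)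

/-- The partial derivative `∂ⱼφ` of a smooth function. -/
def partialDeriv (j : Fin 3) (φ : E3 → ℝ) (x : E3) : ℝ :=
  fderiv ℝ φ x (EuclideanSpace.single j 1)

/-- `v` is the weak derivative `∂ⱼu` in `Ω`. -/
def HasWeakDeriv (Ω : Set E3) (j : Fin 3) (u v : L2 Ω) : Prop :=
  ∀ φ : E3 → ℝ, ContDiff ℝ ∞ φ → HasCompactSupport φ → tsupport φ ⊆ Ω →
    ∫ x in Ω, partialDeriv j φ x • u x = - ∫ x in Ω, φ x • v x

theorem continuous_partialDeriv {φ : E3 → ℝ} (hφ : ContDiff ℝ ∞ φ) (j : Fin 3) :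
    Continuous (partialDeriv j φ) :=
  (hφ.continuous_fderiv (by simp)).clm_apply continuous_const

theorem hasCompactSupport_partialDeriv {φ : E3 → ℝ} (hφ : HasCompactSupport φ) (j : Fin 3) :
    HasCompactSupport (partialDeriv j φ) :=
  hφ.fderiv_apply ℝ _

theorem integrable_smul_L2 {Ω : Set E3} (u : L2 Ω) {φ : E3 → ℝ} (hφ : Continuous φ)
    (hc : HasCompactSupport φ) : Integrable (fun x => φ x • u x) (volume.restrict Ω) :=
  ((Lp.memLp u).locallyIntegrable (by norm_num)).integrable_smul_left_of_hasCompactSupport hφ hc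

theorem integral_smul_add {Ω : Set E3} (u v : L2 Ω) {φ : E3 → ℝ} (hφ : Continuous φ)
    (hc : HasCompactSupport φ) :
    ∫ x in Ω, φ x • (u + v : L2 Ω) x = (∫ x in Ω, φ x • u x) + ∫ x in Ω, φ x • v x := by
  rw [← integral_add (integrable_smul_L2 u hφ hc) (integrable_smul_L2 v hφ hc)]
  refine integral_congr_ae ?_
  filter_upwards [Lp.coeFn_add u v] with x hx
  rw [hx, Pi.add_apply, smul_add]

theorem integral_smul_smul {Ω : Set E3} (c : ℂ) (u : L2 Ω) (φ : E3 → ℝ) :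
    ∫ x in Ω, φ x • (c • u : L2 Ω) x = c • ∫ x in Ω, φ x • u x := by
  rw [← integral_smul]
  refine integral_congr_ae ?_
  filter_upwards [Lp.coeFn_smul c u] with x hx
  rw [hx, Pi.smul_apply, smul_comm]

theorem integral_smul_zero {Ω : Set E3} (φ : E3 → ℝ) :
    ∫ x in Ω, φ x • (0 : L2 Ω) x = 0 := by
  simpa using integral_smul_smul (0 : ℂ) (0 : L2 Ω) φ

theorem HasWeakDeriv.zero (Ω : Set E3) (j : Fin 3) : HasWeakDeriv Ω j 0 0 := by
  intro φ _ _ _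
  rw [integral_smul_zero, integral_smul_zero, neg_zero]

theorem HasWeakDeriv.add {Ω : Set E3} {j : Fin 3} {u v u' v' : L2 Ω}
    (h : HasWeakDeriv Ω j u v) (h' : HasWeakDeriv Ω j u' v') :
    HasWeakDeriv Ω j (u + u') (v + v') := by
  intro φ hφ hc hs
  rw [integral_smul_add _ _ (continuous_partialDeriv hφ j) (hasCompactSupport_partialDeriv hc j),
    integral_smul_add _ _ hφ.continuous hc, h φ hφ hc hs, h' φ hφ hc hs, neg_add]

theorem HasWeakDeriv.smul {Ω : Set E3} {j : Fin 3} {u v : L2 Ω} (c : ℂ)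
    (h : HasWeakDeriv Ω j u v) : HasWeakDeriv Ω j (c • u) (c • v) := by
  intro φ hφ hc hs
  rw [integral_smul_smul, integral_smul_smul, h φ hφ hc hs, smul_neg]

/-- `H²(Ω; ℂ²)`, realized as the space of the triples `(u, (∂ⱼu)ⱼ, (∂ₖ∂ⱼu)ⱼₖ)` of `L²` functions
and weak derivatives. The norm inherited from the product of the `L²` spaces is equivalent to the
usual norm of `H²(Ω)`. -/
def H2 (Ω : Set E3) : Submodule ℂ (L2 Ω × (Fin 3 → L2 Ω) × (Fin 3 → Fin 3 → L2 Ω)) where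
  carrier := {p | (∀ j, HasWeakDeriv Ω j p.1 (p.2.1 j)) ∧
    ∀ j k, HasWeakDeriv Ω k (p.2.1 j) (p.2.2 j k)}
  zero_mem' := ⟨fun j => HasWeakDeriv.zero Ω j, fun _ k => HasWeakDeriv.zero Ω k⟩
  add_mem' := fun h h' =>
    ⟨fun j => (h.1 j).add (h'.1 j), fun j k => (h.2 j k).add (h'.2 j k)⟩
  smul_mem' := fun c _ h => ⟨fun j => (h.1 j).smul c, fun j k => (h.2 j k).smul c⟩

/-- The function underlying an element of `H²(Ω; ℂ²)`. -/
def sobVal {Ω : Set E3} (u : H2 Ω) : L2 Ω := u.1.1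

/-- The weak derivative `∂ⱼu`. -/
def sobD {Ω : Set E3} (u : H2 Ω) (j : Fin 3) : L2 Ω := u.1.2.1 j

/-- The weak derivative `∂ₖ∂ⱼu`. -/
def sobDD {Ω : Set E3} (u : H2 Ω) (j k : Fin 3) : L2 Ω := u.1.2.2 j k

/-- The surface measure of `∂Ω`: two-dimensional Hausdorff measure (normalized so as to be the area
of planar sets). -/
def surfaceMeasure (Ω : Set E3) : Measure E3 :=
  (Measure.euclideanHausdorffMeasure 2 : Measure E3).restrict (frontier Ω)

/-- `g ∈ L²(∂Ω; ℂ²)` is the boundary trace of the function `w ∈ H¹(Ω; ℂ²)` with weak gradient `dw`.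
The trace is the function on `∂Ω` (unique up to null sets) for which Gauss' formula
`∫_Ω (∂ₖφ w + φ ∂ₖw) dx = ∫_{∂Ω} φ νₖ g dΣ` holds for all `k` and all smooth `φ`. -/
def HasTrace (Ω : Set E3) (w : L2 Ω) (dw : Fin 3 → L2 Ω) (g : E3 → Spinor) : Prop :=
  MemLp g 2 (surfaceMeasure Ω) ∧
  ∀ φ : E3 → ℝ, ContDiff ℝ ∞ φ → HasCompactSupport φ → ∀ k : Fin 3,
    ∫ x in Ω, (partialDeriv k φ x • w x + φ x • dw k x) =
      ∫ x, (φ x * outwardNormal Ω x k) • g x ∂(surfaceMeasure Ω)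

/-- The boundary condition `u ∈ ℰ⁺(ν̃(τ, x))` on `∂Ω`, for `u ∈ H²(Ω; ℂ²)`. -/
def BoundaryCondition (σ : Fin 3 → ℝ → ℝ) (Ω : Set E3) (τ : ℂ) (u : H2 Ω) : Prop :=
  ∃ g, HasTrace Ω (sobVal u) (sobD u) g ∧ ∀ᵐ x ∂(surfaceMeasure Ω), g x ∈ posSpace (normalEnd σ Ω τ x)

/-- The transverse identity `π⁺(ν̃) ∑ Aⱼ ∂̃ⱼ u = π⁺(ν̃) (V(τ, x, ∂) + h) u` on `∂Ω`, for
`u ∈ H²(Ω; ℂ²)` and a function `h` on `∂Ω`; here `g` and `dg j` are the traces of `u` and `∂ⱼu`. -/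
def TransverseIdentity (σ : Fin 3 → ℝ → ℝ) (Ω : Set E3) (τ : ℂ) (h : E3 → ℂ) (u : H2 Ω) : Prop :=
  ∀ (g : E3 → Spinor) (dg : Fin 3 → E3 → Spinor),
    HasTrace Ω (sobVal u) (sobD u) g → (∀ j, HasTrace Ω (sobD u j) (sobDD u j) (dg j)) →
    ∀ᵐ x ∂(surfaceMeasure Ω),
      posProj (normalEnd σ Ω τ x)
          (∑ j, (pauliMatrix j).mulVec (stretchFactor σ τ x j • dg j x)) =
        posProj (normalEnd σ Ω τ x)
          (transverseDeriv σ Ω τ x (fun j => dg j x) + h x • g x)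

end StretchedPauli

end

noncomputable section

namespace StretchedPauli

/-! ### Spectral projections of an endomorphism whose square is scalar -/

section Spectral

variable {V : Type*} [AddCommGroup V] [Module ℂ V]

/-! Write s_j = τ/(τ + σ_j), w = Σ ν_j² s_j² and n = w^(-1/2) ν̃ with the principal branch, so that
n · n = 1. The Pauli relation A(ξ)A(η) + A(η)A(ξ) = 2 (ξ · η) gives A(ν̃)² = w, and N² = 1 for N =
A(n). Hence A(ν̃) has the eigenvalues ±√w, its spectral projections are (1 ± N)/2, and the boundary
condition reads N u = u. In terms of a local defining function ρ, the vector n is `extNormal`,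
jointly smooth in (τ, x) and holomorphic in τ. For large |τ| every s_j is close to 1 and |w - 1| <
1/2, which gives (i). The radius depends on bounds for the σ_j alone, whence the uniformity in δ and
in the domain.

For real τ > 0 the stretching is a diffeomorphism and ρ ∘ X⁻¹ defines the stretched domain; its
gradient has the components s_j ∂_jρ. So n is the unit normal of the stretched domain, and ½ Σ s_j
∂_j n_j (`extCurvature`), half of the divergence in stretched coordinates, is its mean curvature.
Both expressions make sense for complex τ and are the extensions in (ii) and (iii). Holomorphy with
values in C^∞ follows from joint smoothness and holomorphy in τ, since the x-derivatives inherit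
both properties.

The transverse identity is algebra (`transverse_algebra`). From (1 + N)A_j = A_j(1 - N) + 2 n_j one
gets (1 + N) Σ A_j s_j ∂_j u = Σ s_j A_j (1 - N) ∂_j u + 2 V u. Under another factor 1 + N only
tangential derivatives survive in the first sum, and differentiating (1 - N)u = 0 along the boundary
replaces (1 - N)∂_j u by A(∂_j n)u. Now Σ A_j A(s_j ∂_j n) is a stretched divergence plus a curl
term. As n is a multiple of the stretched gradient of ρ, its curl is a wedge f ∧ n, represented by
the commutator of A(f) and N, and this vanishes between 1 + N and u = N u. The divergence is twice
the curvature. The argument works at each admissible τ, real or complex, so that (iv) requires no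
continuation in τ. For u in H² the tangential differentiation is justified by Gauss' formula
(`integral_tangential`, `tangential_product_rule`). -/

theorem mem_maxGenEigenspace_of_apply_eq {T : Module.End ℂ V} {z : ℂ} {v : V}
    (h : T v = z • v) : v ∈ T.maxGenEigenspace z :=
  Module.End.mem_maxGenEigenspace _ _ _ |>.2 ⟨1, by simp [h]⟩

/-- If `T² = c²`, a generalized eigenvector for an eigenvalue other than `-c` is an eigenvector
for `c`. -/
theorem apply_eq_of_mem_maxGenEigenspace {T : Module.End ℂ V} {c z : ℂ}
    (hT : ∀ v, T (T v) = c ^ 2 • v) (hz : z ≠ -c) {v : V} (hv : v ∈ T.maxGenEigenspace z) :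
    T v = c • v := by
  obtain ⟨k, hk⟩ := (Module.End.mem_maxGenEigenspace _ _ _).1 hv
  -- As T² = c², the vector T v - c v is an eigenvector for -c or zero, so (T - z)^n acts on it as
  -- the scalar (-c - z)^n. On the other hand (T - z)^k commutes with T - c and kills v.
  have hq : ∀ n : ℕ, ((T - z • (1 : Module.End ℂ V)) ^ n) (T v - c • v) =
      (-c - z) ^ n • (T v - c • v) := by
    intro n
    induction n with
    | zero => simp
    | succ n ih =>
      rw [pow_succ', Module.End.mul_apply, ih, map_smul]
      have : (T - z • (1 : Module.End ℂ V)) (T v - c • v) = (-c - z) • (T v - c • v) := by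
        simp only [LinearMap.sub_apply, map_sub, map_smul, hT, LinearMap.smul_apply,
          Module.End.one_apply]
        module
      rw [this, smul_smul, ← pow_succ]
  have hcomm : Commute ((T - z • (1 : Module.End ℂ V)) ^ k) (T - c • (1 : Module.End ℂ V)) := by
    refine Commute.pow_left ?_ k
    refine (Commute.sub_right ?_ ?_)
    · exact (Commute.refl T).sub_left ((Commute.one_left T).smul_left z)
    · exact (Commute.one_right _).smul_right c
  have h1 : ((T - z • (1 : Module.End ℂ V)) ^ k) (T v - c • v) = 0 := by
    have := congrArg (fun S : Module.End ℂ V => S v) hcomm.eq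
    simp only [Module.End.mul_apply] at this
    rw [hk, map_zero] at this
    simpa using this
  rw [hq k] at h1
  have h2 : (-c - z) ^ k ≠ 0 := pow_ne_zero _ fun h => hz (by linear_combination -h)
  exact sub_eq_zero.1 ((smul_eq_zero.1 h1).resolve_left h2)

/-- Every z with positive real part differs from -c, so all the generalized eigenspaces in question
lie in the kernel of T - c. -/
theorem mem_posSpace_iff {T : Module.End ℂ V} {c : ℂ} (hT : ∀ v, T (T v) = c ^ 2 • v)
    (hc : 0 < c.re) {v : V} : v ∈ posSpace T ↔ T v = c • v := by
  constructor
  · intro h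
    have : posSpace T ≤ LinearMap.ker (T - c • (1 : Module.End ℂ V)) := by
      refine iSup₂_le fun z hz w hw => ?_
      have hne : z ≠ -c := by
        rintro rfl
        rw [Set.mem_ofPred_eq, Complex.neg_re] at hz
        linarith
      simp [apply_eq_of_mem_maxGenEigenspace hT hne hw]
    simpa [sub_eq_zero] using this h
  · intro h
    exact (le_iSup₂_of_le c hc le_rfl : T.maxGenEigenspace c ≤ posSpace T)
      (mem_maxGenEigenspace_of_apply_eq h)

theorem mem_negSpace_iff {T : Module.End ℂ V} {c : ℂ} (hT : ∀ v, T (T v) = c ^ 2 • v)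
    (hc : 0 < c.re) {v : V} : v ∈ negSpace T ↔ T v = -c • v := by
  constructor
  · intro h
    have : negSpace T ≤ LinearMap.ker (T - (-c) • (1 : Module.End ℂ V)) := by
      refine iSup₂_le fun z hz w hw => ?_
      have hne : z ≠ - -c := by
        rintro rfl
        rw [Set.mem_ofPred_eq, neg_neg] at hz
        linarith
      have hT' : ∀ v, T (T v) = (-c) ^ 2 • v := fun v => by rw [hT, neg_sq]
      simp [apply_eq_of_mem_maxGenEigenspace hT' hne hw]
    simpa [add_eq_zero_iff_eq_neg] using this h
  · intro h
    refine (le_iSup₂_of_le (-c) ?_ le_rfl : T.maxGenEigenspace (-c) ≤ negSpace T)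
      (mem_maxGenEigenspace_of_apply_eq h)
    simpa using hc

theorem isCompl_posSpace_negSpace {T : Module.End ℂ V} {c : ℂ} (hT : ∀ v, T (T v) = c ^ 2 • v)
    (hc : 0 < c.re) : IsCompl (posSpace T) (negSpace T) := by
  have hc0 : c ≠ 0 := by rintro rfl; simp at hc
  constructor
  · rw [Submodule.disjoint_def]
    intro v hp hn
    rw [mem_posSpace_iff hT hc] at hp
    rw [mem_negSpace_iff hT hc, hp] at hn
    have : (2 * c) • v = 0 := by
      rw [two_mul, add_smul]
      nth_rewrite 1 [hn]
      rw [neg_smul, neg_add_cancel]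
    exact (smul_eq_zero.1 this).resolve_left (by simpa using hc0)
  · rw [codisjoint_iff, Submodule.eq_top_iff']
    intro v
    have hv : v = (2⁻¹ : ℂ) • (v + c⁻¹ • T v) + (2⁻¹ : ℂ) • (v - c⁻¹ • T v) := by module
    rw [hv]
    refine Submodule.add_mem_sup ?_ ?_
    · rw [mem_posSpace_iff hT hc]
      simp only [map_smul, map_add, hT, smul_add, smul_smul]
      rw [add_comm]
      congr 2 <;> field_simp
    · rw [mem_negSpace_iff hT hc]
      simp only [map_smul, map_sub, hT, smul_sub, smul_smul]
      rw [← neg_sub, ← sub_eq_zero]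
      match_scalars <;> field_simp <;> ring

/-- The halves (v ± T v / c)/2 lie in the eigenspaces of ±c and add up to v. This explicit formula
is the source of all regularity of the projections in τ and x. -/
theorem posProj_apply {T : Module.End ℂ V} {c : ℂ} (hT : ∀ v, T (T v) = c ^ 2 • v)
    (hc : 0 < c.re) (v : V) : posProj T v = (2⁻¹ : ℂ) • (v + c⁻¹ • T v) := by
  have hc0 : c ≠ 0 := by rintro rfl; simp at hc
  have h := isCompl_posSpace_negSpace hT hc
  rw [posProj, dif_pos h]
  have hv : v = (2⁻¹ : ℂ) • (v + c⁻¹ • T v) + (2⁻¹ : ℂ) • (v - c⁻¹ • T v) := by module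
  conv_lhs => rw [hv, map_add]
  rw [Submodule.projection_apply_of_mem_left, (Submodule.projection_apply_eq_zero_iff h).2,
    add_zero]
  · rw [mem_negSpace_iff hT hc]
    simp only [map_smul, map_sub, hT, smul_sub, smul_smul]
    rw [← neg_sub, ← sub_eq_zero]
    match_scalars <;> field_simp <;> ring
  · rw [mem_posSpace_iff hT hc]
    simp only [map_smul, map_add, hT, smul_add, smul_smul]
    rw [add_comm]
    congr 2 <;> field_simp

theorem negProj_apply {T : Module.End ℂ V} {c : ℂ} (hT : ∀ v, T (T v) = c ^ 2 • v)
    (hc : 0 < c.re) (v : V) : negProj T v = (2⁻¹ : ℂ) • (v - c⁻¹ • T v) := by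
  have h := isCompl_posSpace_negSpace hT hc
  have h1 := posProj_apply hT hc v
  rw [posProj, dif_pos h] at h1
  have h2 := Submodule.projection_add_projection_eq_self h v
  rw [negProj, dif_pos h.symm]
  rw [h1] at h2
  rw [← sub_eq_of_eq_add' h2.symm]
  module

end Spectral

/-! ### The Pauli matrices -/

theorem pauliSymbol_eq (ξ : Fin 3 → ℂ) : pauliSymbol ξ =
    !![ξ 0, ξ 1 + Complex.I * ξ 2; ξ 1 - Complex.I * ξ 2, -ξ 0] := by
  ext i j
  fin_cases i <;> fin_cases j <;>
    simp [pauliSymbol, pauliMatrix, Fin.sum_univ_three, Matrix.sum_apply] <;> ring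

theorem pauliSymbol_mul_add (ξ η : Fin 3 → ℂ) :
    pauliSymbol ξ * pauliSymbol η + pauliSymbol η * pauliSymbol ξ =
      (2 * ∑ j, ξ j * η j) • (1 : Matrix (Fin 2) (Fin 2) ℂ) := by
  ext i j
  fin_cases i <;> fin_cases j <;>
    simp [pauliSymbol_eq, Fin.sum_univ_three] <;> ring_nf <;> simp [Complex.I_sq]

theorem pauliSymbol_mul_self (ξ : Fin 3 → ℂ) :
    pauliSymbol ξ * pauliSymbol ξ = (∑ j, ξ j ^ 2) • (1 : Matrix (Fin 2) (Fin 2) ℂ) := by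
  have h := pauliSymbol_mul_add ξ ξ
  rw [← two_smul ℂ, mul_smul] at h
  simpa only [sq] using smul_right_injective _ (two_ne_zero' ℂ) h

theorem toLin'_pauliSymbol_apply_apply {ξ : Fin 3 → ℂ} {c : ℂ} (h : ∑ j, ξ j ^ 2 = c ^ 2)
    (v : Spinor) :
    Matrix.toLin' (pauliSymbol ξ) (Matrix.toLin' (pauliSymbol ξ) v) = c ^ 2 • v := by
  rw [Matrix.toLin'_apply, Matrix.toLin'_apply, Matrix.mulVec_mulVec, pauliSymbol_mul_self, h,
    Matrix.smul_mulVec, Matrix.one_mulVec]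

/-- The trace is 0 and the determinant is -ξ · ξ. The multiset of roots also records multiplicities,
as the simplicity claim in (i) requires. -/
theorem roots_charpoly_pauliSymbol {ξ : Fin 3 → ℂ} {c : ℂ} (h : ∑ j, ξ j ^ 2 = c ^ 2) :
    (pauliSymbol ξ).charpoly.roots = {c, -c} := by
  have : (pauliSymbol ξ).charpoly =
      (Polynomial.X - Polynomial.C c) * (Polynomial.X - Polynomial.C (-c)) := by
    rw [Matrix.charpoly_fin_two]
    have h1 : (pauliSymbol ξ).trace = 0 := by simp [pauliSymbol_eq, Matrix.trace_fin_two]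
    have h2 : (pauliSymbol ξ).det = -c ^ 2 := by
      rw [← h, pauliSymbol_eq, Matrix.det_fin_two_of, Fin.sum_univ_three]
      linear_combination (ξ 2 ^ 2) * Complex.I_sq
    rw [h1, h2]
    simp only [map_zero, map_neg, map_pow]
    ring
  rw [this, Polynomial.roots_mul, Polynomial.roots_X_sub_C, Polynomial.roots_X_sub_C]
  · rfl
  · exact mul_ne_zero (Polynomial.X_sub_C_ne_zero _) (Polynomial.X_sub_C_ne_zero _)

theorem pauliSymbol_smul (c : ℂ) (ξ : Fin 3 → ℂ) : pauliSymbol (c • ξ) = c • pauliSymbol ξ := by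
  simp [pauliSymbol, Finset.smul_sum, smul_smul]

theorem pauliSymbol_add (ξ η : Fin 3 → ℂ) :
    pauliSymbol (ξ + η) = pauliSymbol ξ + pauliSymbol η := by
  simp [pauliSymbol, Finset.sum_add_distrib, add_smul]

/-- Distinct Pauli matrices anticommute and each has square 1. For c j k = s_j ∂_j n_k the two terms
are the stretched divergence and the stretched curl of n. -/
theorem sum_pauliSymbol_mul (c : Fin 3 → Fin 3 → ℂ) :
    ∑ j, pauliMatrix j * pauliSymbol (c j) = (∑ j, c j j) • (1 : Matrix (Fin 2) (Fin 2) ℂ) +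
      (2⁻¹ : ℂ) • ∑ j, pauliMatrix j * pauliSymbol (fun k => c j k - c k j) := by
  ext a b
  fin_cases a <;> fin_cases b <;>
    simp [pauliSymbol_eq, pauliMatrix, Fin.sum_univ_three] <;> ring_nf <;> simp [Complex.I_sq]

theorem sum_smul_pauliMatrix (ξ : Fin 3 → ℂ) : ∑ j, ξ j • pauliMatrix j = pauliSymbol ξ := rfl

/-- A curl of the form f ∧ n turns into a commutator with A(n), which vanishes when placed between 1
+ A(n) and a fixed vector of A(n). -/
theorem sum_pauliMatrix_mul_wedge (f n : Fin 3 → ℂ) :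
    ∑ j, pauliMatrix j * pauliSymbol (fun k => f j * n k - f k * n j) =
      pauliSymbol f * pauliSymbol n - pauliSymbol n * pauliSymbol f := by
  have : ∀ j, pauliSymbol (fun k => f j * n k - f k * n j) =
      f j • pauliSymbol n - n j • pauliSymbol f := by
    intro j
    rw [← pauliSymbol_smul, sub_eq_add_neg, ← neg_smul, ← pauliSymbol_smul, ← pauliSymbol_add]
    congr 1
    funext k
    simp only [Pi.add_apply, Pi.smul_apply, smul_eq_mul]
    ring
  simp only [this, mul_sub, mul_smul_comm, Finset.sum_sub_distrib]
  simp only [← smul_mul_assoc, ← Finset.sum_mul, sum_smul_pauliMatrix]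

theorem pauliMatrix_mul_pauliSymbol_add (j : Fin 3) (ξ : Fin 3 → ℂ) :
    pauliMatrix j * pauliSymbol ξ + pauliSymbol ξ * pauliMatrix j =
      (2 * ξ j) • (1 : Matrix (Fin 2) (Fin 2) ℂ) := by
  have h := pauliSymbol_mul_add (Pi.single j 1) ξ
  simpa [pauliSymbol, Pi.single_apply, Finset.sum_ite_eq] using h

/-- As Σ_k ν_k (ν_k x_j - ν_j x_k) = x_j - ν_j (ν · x), the tangential combinations recover a
gradient up to its normal part. They are all that the boundary condition controls. -/
theorem sum_tangential_smul (B : Fin 3 → Matrix (Fin 2) (Fin 2) ℂ) (s : Fin 3 → ℂ)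
    {ν : Fin 3 → ℂ} (hν : ∑ j, ν j ^ 2 = 1) (x : Fin 3 → Spinor) :
    ∑ j, ∑ k, (s j * ν k) • (B j).mulVec (ν k • x j - ν j • x k) =
      ∑ j, s j • (B j).mulVec (x j) -
        (∑ j, (ν j * s j) • B j).mulVec (∑ k, ν k • x k) := by
  rw [← one_smul ℂ (∑ j, s j • (B j).mulVec (x j)), ← hν]
  simp only [Fin.sum_univ_three, Matrix.mulVec_sub, Matrix.mulVec_smul, Matrix.mulVec_add,
    Matrix.add_mulVec, Matrix.smul_mulVec]
  module

/-- The algebraic core of the transverse identity. Here `n` is the complexified unit normal, `dn j`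
its derivative in the direction `j`, and `d j` the derivative of a spinor field with value `g`
which satisfies `A(n) g = g` along the surface. -/
theorem transverse_algebra {n ν s f : Fin 3 → ℂ} {dn : Fin 3 → Fin 3 → ℂ} {lam : ℂ}
    {g : Spinor} {d : Fin 3 → Spinor}
    (hn : ∑ j, n j ^ 2 = 1) (hν : ∑ j, ν j ^ 2 = 1) (hlam : ∀ j, ν j * s j = lam * n j)
    (hdn : ∀ j, ∑ k, n k * dn j k = 0)
    (hcurl : ∀ j k, s j * dn j k - s k * dn k j = f j * n k - f k * n j)
    (hg : (pauliSymbol n).mulVec g = g)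
    (hd : ∀ j k, (1 - pauliSymbol n).mulVec (ν k • d j - ν j • d k) =
      (ν k • pauliSymbol (dn j) - ν j • pauliSymbol (dn k)).mulVec g) :
    (1 + pauliSymbol n).mulVec (∑ j, (pauliMatrix j).mulVec (s j • d j)) =
      (1 + pauliSymbol n).mulVec (∑ j, (n j * s j) • d j +
        ((1 / 2) * ∑ j, s j * dn j j) • g) := by
  set N := pauliSymbol n with hN
  have hNN : N * N = 1 := by rw [hN, pauliSymbol_mul_self, hn, one_smul]
  have hPN : (1 + N) * N = 1 + N := by rw [add_mul, one_mul, hNN, add_comm]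
  have hPQ : (1 + N) * (1 - N) = 0 := by rw [mul_sub, mul_one, hPN, sub_self]
  have hPP : (1 + N) * (1 + N) = (2 : ℂ) • (1 + N) := by
    rw [mul_add, mul_one, hPN, two_smul]
  -- The scalar left over by this anticommutation produces the transverse derivative.
  have hA : ∀ j, (1 + N) * pauliMatrix j =
      pauliMatrix j * (1 - N) + (2 * n j) • (1 : Matrix (Fin 2) (Fin 2) ℂ) := by
    intro j
    rw [← pauliMatrix_mul_pauliSymbol_add j n, ← hN]
    noncomm_ring
  -- the curl term
  have hcurl' : (1 + N).mulVec ((∑ j, pauliMatrix j * pauliSymbol (fun k => s j * dn j k)).mulVec g)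
      = (∑ j, s j * dn j j) • (1 + N).mulVec g := by
    rw [sum_pauliSymbol_mul]
    simp only [hcurl]
    rw [sum_pauliMatrix_mul_wedge, ← hN, Matrix.add_mulVec _ _ g, Matrix.mulVec_add, Matrix.smul_mulVec,
      Matrix.one_mulVec g, Matrix.mulVec_smul, Matrix.smul_mulVec, Matrix.mulVec_smul,
      Matrix.sub_mulVec, ← Matrix.mulVec_mulVec, hg, Matrix.mulVec_sub,
      Matrix.mulVec_mulVec g (1 + N) (N * _), ← mul_assoc, hPN, Matrix.mulVec_mulVec, sub_self,
      smul_zero, add_zero]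
  -- the normal derivatives drop out
  have hnormal : ∀ k, (1 + N).mulVec ((pauliSymbol (dn k)).mulVec g) = 0 := by
    intro k
    have h1 := pauliSymbol_mul_add n (dn k)
    rw [hdn, mul_zero, zero_smul, ← hN] at h1
    have h2 : (1 + N).mulVec ((pauliSymbol (dn k)).mulVec g) =
        -(1 + N).mulVec ((pauliSymbol (dn k)).mulVec g) := by
      conv_lhs => rw [← hg]
      rw [Matrix.mulVec_mulVec g (pauliSymbol _) N, eq_neg_of_add_eq_zero_right h1,
        Matrix.mulVec_mulVec, mul_neg, ← mul_assoc, hPN, Matrix.neg_mulVec, ← Matrix.mulVec_mulVec]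
    exact self_eq_neg.1 h2
  have hAν : ∑ j, (ν j * s j) • pauliMatrix j = lam • N := by
    simp only [hlam, mul_smul, ← Finset.smul_sum]
    rfl
  -- The tangential sum is evaluated in two ways. Each leaves a normal part with the factor Σ ν_j
  -- s_j A_j = lam N; under 1 + N one vanishes by (1 + N)(1 - N) = 0, the other by `hnormal`.
  have key : (1 + N).mulVec (∑ j, s j • (pauliMatrix j).mulVec ((1 - N).mulVec (d j))) =
      (∑ j, s j * dn j j) • (1 + N).mulVec g := by
    have e1 : ∑ j, ∑ k, (s j * ν k) • (pauliMatrix j).mulVec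
        ((1 - N).mulVec (ν k • d j - ν j • d k)) =
        ∑ j, s j • (pauliMatrix j).mulVec ((1 - N).mulVec (d j)) -
          (lam • N).mulVec ((1 - N).mulVec (∑ k, ν k • d k)) := by
      rw [← hAν]
      simp only [Matrix.mulVec_sub (1 - N), Matrix.mulVec_smul (1 - N),
        Matrix.mulVec_sum (1 - N)]
      exact sum_tangential_smul pauliMatrix s hν _
    have e2 : ∑ j, ∑ k, (s j * ν k) • (pauliMatrix j).mulVec
        ((1 - N).mulVec (ν k • d j - ν j • d k)) =
        (∑ j, pauliMatrix j * pauliSymbol (fun k => s j * dn j k)).mulVec g -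
          (lam • N).mulVec (∑ k, ν k • (pauliSymbol (dn k)).mulVec g) := by
      have e3 : ∀ j, pauliSymbol (fun k => s j * dn j k) = s j • pauliSymbol (dn j) :=
        fun j => pauliSymbol_smul (s j) (dn j)
      rw [← hAν]
      simp only [hd, e3, Matrix.sub_mulVec, Matrix.smul_mulVec (R := ℂ) _ (pauliSymbol _)]
      rw [sum_tangential_smul pauliMatrix s hν]
      simp only [Matrix.sum_mulVec, mul_smul_comm, Matrix.smul_mulVec, Matrix.mulVec_mulVec]
    have e4 := congrArg (fun v => (1 + N).mulVec v) (e1.symm.trans e2)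
    simp only [Matrix.mulVec_sub, hcurl', Matrix.smul_mulVec, Matrix.mulVec_smul (1 + N)] at e4
    rw [Matrix.mulVec_mulVec _ (1 + N) N, Matrix.mulVec_mulVec _ (1 + N) N, hPN,
      Matrix.mulVec_mulVec _ (1 + N) (1 - N), hPQ, Matrix.zero_mulVec, smul_zero, sub_zero] at e4
    have e5 : (1 + N).mulVec (∑ k, ν k • (pauliSymbol (dn k)).mulVec g) = 0 := by
      simp only [Matrix.mulVec_sum, Matrix.mulVec_smul, hnormal, smul_zero, Finset.sum_const_zero]
    rwa [e5, smul_zero, sub_zero] at e4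
  have hdouble : ∀ v : Spinor, (1 + N).mulVec ((1 + N).mulVec v) = (2 : ℂ) • (1 + N).mulVec v := by
    intro v
    rw [Matrix.mulVec_mulVec, hPP, Matrix.smul_mulVec]
  -- Doubling the identity turns 1 + N into (1 + N)² on the left: the inner factor is moved past A_j
  -- by `hA`, the outer one feeds `key`.
  apply smul_right_injective _ (two_ne_zero' ℂ)
  simp only
  rw [← hdouble]
  have e5 : (1 + N).mulVec (∑ j, (pauliMatrix j).mulVec (s j • d j)) =
      ∑ j, s j • (pauliMatrix j).mulVec ((1 - N).mulVec (d j)) +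
        (2 : ℂ) • ∑ j, (n j * s j) • d j := by
    simp only [Matrix.mulVec_sum, Finset.smul_sum, ← Finset.sum_add_distrib, Matrix.mulVec_smul]
    refine Finset.sum_congr rfl fun j _ => ?_
    rw [Matrix.mulVec_mulVec, hA, Matrix.add_mulVec, Matrix.smul_mulVec, Matrix.one_mulVec,
      ← Matrix.mulVec_mulVec]
    module
  rw [e5, Matrix.mulVec_add, key, Matrix.mulVec_smul, Matrix.mulVec_add, Matrix.mulVec_smul]
  module

/-! ### Local defining functions -/

theorem gradient_apply (ρ : E3 → ℝ) (x : E3) (j : Fin 3) : gradient ρ x j = partialDeriv j ρ x := by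
  have h := inner_gradient_left (𝕜 := ℝ) (f := ρ) (x := x) (y := EuclideanSpace.single j (1 : ℝ))
  rw [EuclideanSpace.inner_single_right] at h
  simpa [partialDeriv] using h

theorem contDiff_gradient {ρ : E3 → ℝ} (h : ContDiff ℝ ∞ ρ) : ContDiff ℝ ∞ (gradient ρ) :=
  (InnerProductSpace.toDual ℝ E3).symm.contDiff.comp (h.fderiv_right (m := ∞) (by simp))

theorem contDiff_partialDeriv {ρ : E3 → ℝ} (h : ContDiff ℝ ∞ ρ) (j : Fin 3) :
    ContDiff ℝ ∞ (partialDeriv j ρ) :=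
  (h.fderiv_right (m := ∞) (by simp)).clm_apply contDiff_const

theorem two_le_infty : (2 : WithTop ℕ∞) ≤ ∞ :=
  WithTop.coe_le_coe.2 le_top

/-- Second partial derivatives commute. -/
theorem partialDeriv_partialDeriv_comm {ρ : E3 → ℝ} (h : ContDiff ℝ ∞ ρ) (j k : Fin 3) (x : E3) :
    partialDeriv j (partialDeriv k ρ) x = partialDeriv k (partialDeriv j ρ) x := by
  have hd : DifferentiableAt ℝ (fderiv ℝ ρ) x :=
    (h.fderiv_right (m := ∞) (by simp)).differentiable (by simp) x
  have h1 : ∀ i l, partialDeriv i (partialDeriv l ρ) x =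
      fderiv ℝ (fderiv ℝ ρ) x (EuclideanSpace.single i 1) (EuclideanSpace.single l 1) := by
    intro i l
    have h2 := (hd.hasFDerivAt.clm_apply
      (hasFDerivAt_const (EuclideanSpace.single l (1 : ℝ) : E3) x)).fderiv
    rw [partialDeriv]
    change fderiv ℝ (fun y => fderiv ℝ ρ y (EuclideanSpace.single l 1)) x _ = _
    rw [h2]
    simp
  rw [h1, h1]
  exact (h.contDiffAt.isSymmSndFDerivAt (by simpa using two_le_infty)).eq _ _

/-- The normalized gradient. -/
def unitGradient (ρ : E3 → ℝ) (x : E3) : E3 := ‖gradient ρ x‖⁻¹ • gradient ρ x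

theorem norm_unitGradient {ρ : E3 → ℝ} {x : E3} (h : gradient ρ x ≠ 0) : ‖unitGradient ρ x‖ = 1 := by
  rw [unitGradient, norm_smul, norm_inv, norm_norm, inv_mul_cancel₀ (norm_ne_zero_iff.2 h)]

theorem sum_unitGradient_sq {ρ : E3 → ℝ} {x : E3} (h : gradient ρ x ≠ 0) :
    ∑ j, unitGradient ρ x j ^ 2 = 1 := by
  have := norm_unitGradient h
  rw [EuclideanSpace.norm_eq, Real.sqrt_eq_one] at this
  simpa using this

theorem contDiffAt_unitGradient {ρ : E3 → ℝ} (hρ : ContDiff ℝ ∞ ρ) {x : E3}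
    (h : gradient ρ x ≠ 0) : ContDiffAt ℝ ∞ (unitGradient ρ) x := by
  have h1 := (contDiff_gradient hρ).contDiffAt (x := x)
  exact ((h1.norm ℝ h).inv (norm_ne_zero_iff.2 h)).smul h1

theorem eventually_pos_add_smul {f : E3 → ℝ} {p v : E3} (hf : DifferentiableAt ℝ f p)
    (h0 : f p = 0) (hv : 0 < fderiv ℝ f p v) : ∀ᶠ t in 𝓝[>] (0 : ℝ), 0 < f (p + t • v) := by
  have h1 : HasDerivAt (fun t : ℝ => f (p + t • v)) (fderiv ℝ f p v) 0 := by
    have h2 : HasDerivAt (fun t : ℝ => p + t • v) v 0 := by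
      simpa using ((hasDerivAt_id (0 : ℝ)).smul_const v).const_add p
    have h3 : HasFDerivAt f (fderiv ℝ f p) (p + (0 : ℝ) • v) := by
      simpa using hf.hasFDerivAt
    exact h3.comp_hasDerivAt (0 : ℝ) h2
  have h4 := (hasDerivAt_iff_tendsto_slope.1 h1).eventually (lt_mem_nhds hv)
  have h5 : ∀ᶠ t in 𝓝[>] (0 : ℝ), 0 < slope (fun t : ℝ => f (p + t • v)) 0 t :=
    h4.filter_mono (nhdsWithin_mono _ fun t (ht : 0 < t) => ht.ne')
  filter_upwards [h5, self_mem_nhdsWithin] with t ht (ht0 : 0 < t)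
  rw [slope_def_field] at ht
  simp only [zero_smul, add_zero, h0, sub_zero] at ht
  exact (div_pos_iff_of_pos_right ht0).1 ht

/-! ### Geometry of the boundary near one of its points -/

namespace IsLocalDefiningFunction

variable {Ω : Set E3} {p : E3} {ρ : E3 → ℝ}

theorem eventually (h : IsLocalDefiningFunction Ω p ρ) :
    ∀ᶠ q in 𝓝 p, IsLocalDefiningFunction Ω q ρ := by
  filter_upwards [h.locally_eq.eventually_nhds,
    (contDiff_gradient h.smooth).continuous.continuousAt.eventually_ne h.gradient_ne] with q h1 h2
  exact ⟨h.smooth, h2, h1⟩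

theorem eventually_neg (h : IsLocalDefiningFunction Ω p ρ) (h0 : ρ p = 0) {v : E3}
    (hv : fderiv ℝ ρ p v < 0) : ∀ᶠ t in 𝓝[>] (0 : ℝ), ρ (p + t • v) < 0 := by
  have hd : DifferentiableAt ℝ ρ p := h.smooth.differentiable (by simp) p
  have := eventually_pos_add_smul (f := fun x => -ρ x) (v := v) hd.fun_neg (by simp [h0])
    (by simpa [fderiv_fun_neg] using hv)
  simpa using this

theorem tendsto_add_smul (v : E3) : Tendsto (fun t : ℝ => p + t • v) (𝓝[>] 0) (𝓝 p) := by
  have h : Continuous fun t : ℝ => p + t • v := by fun_prop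
  have := h.tendsto 0
  simp only [zero_smul, add_zero] at this
  exact this.mono_left nhdsWithin_le_nhds

theorem fderiv_gradient (h : IsLocalDefiningFunction Ω p ρ) : 0 < fderiv ℝ ρ p (gradient ρ p) := by
  rw [← inner_gradient_left, real_inner_self_eq_norm_sq]
  exact pow_pos (norm_pos_iff.2 h.gradient_ne) 2

theorem mem_frontier_iff (h : IsLocalDefiningFunction Ω p ρ) : p ∈ frontier Ω ↔ ρ p = 0 := by
  have hc : Continuous ρ := h.smooth.continuous
  constructor
  · intro hp
    rcases lt_trichotomy (ρ p) 0 with h1 | h1 | h1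
    · refine absurd ?_ hp.2
      rw [mem_interior_iff_mem_nhds]
      filter_upwards [h.locally_eq, hc.continuousAt.eventually (gt_mem_nhds h1)] with q hq hq'
      exact hq.2 hq'
    · exact h1
    · have : ∃ᶠ q in 𝓝 p, q ∈ Ω := mem_closure_iff_frequently.1 hp.1
      obtain ⟨q, hq, hq', hq''⟩ :=
        (this.and_eventually (h.locally_eq.and (hc.continuousAt.eventually (lt_mem_nhds h1)))).exists
      exact absurd (hq'.1 hq) (not_lt.2 hq''.le)
  · intro h0
    refine ⟨?_, fun hi => ?_⟩
    · have hneg := h.eventually_neg h0 (v := -gradient ρ p) (by simpa using h.fderiv_gradient)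
      rw [mem_closure_iff_frequently]
      refine (tendsto_add_smul (-gradient ρ p)).frequently (Filter.Eventually.frequently ?_)
      filter_upwards [hneg, (tendsto_add_smul (-gradient ρ p)).eventually h.locally_eq] with t h1 h2
      exact h2.2 h1
    · exact lt_irrefl _ (h0 ▸ h.locally_eq.self_of_nhds.1 (interior_subset hi))

theorem eventually_mem_frontier_iff (h : IsLocalDefiningFunction Ω p ρ) :
    ∀ᶠ q in 𝓝 p, (q ∈ frontier Ω ↔ ρ q = 0) :=
  h.eventually.mono fun _ hq => hq.mem_frontier_iff

/-- If the unit gradients a and b differ, then a · (b - a) < 0 < b · (b - a). Along b - a one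
defining function becomes negative and the other positive, although both describe Ω. -/
theorem unitGradient_unique {ρ' : E3 → ℝ} (h : IsLocalDefiningFunction Ω p ρ)
    (h' : IsLocalDefiningFunction Ω p ρ') (hp : p ∈ frontier Ω) :
    unitGradient ρ p = unitGradient ρ' p := by
  have hinner : ∀ (f : E3 → ℝ) (v : E3),
      fderiv ℝ f p v = ‖gradient f p‖ * inner ℝ (unitGradient f p) v := by
    intro f v
    by_cases h0 : gradient f p = 0
    · rw [← inner_gradient_left, h0]; simp
    · rw [unitGradient, inner_smul_left, ← inner_gradient_left]
      simp [h0]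
  by_contra hne
  set a := unitGradient ρ p
  set b := unitGradient ρ' p
  have ha : ‖a‖ = 1 := norm_unitGradient h.gradient_ne
  have hb : ‖b‖ = 1 := norm_unitGradient h'.gradient_ne
  have hab : inner ℝ a b < 1 := by
    exact inner_lt_one_iff_real_of_norm_eq_one ha hb |>.2 hne
  have h1 : fderiv ℝ ρ p (b - a) < 0 := by
    rw [hinner]
    refine mul_neg_of_pos_of_neg (norm_pos_iff.2 h.gradient_ne) ?_
    change inner ℝ a (b - a) < 0
    rw [inner_sub_right, real_inner_self_eq_norm_sq, ha]
    linarith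
  have h2 : fderiv ℝ ρ' p (-(b - a)) < 0 := by
    rw [hinner]
    refine mul_neg_of_pos_of_neg (norm_pos_iff.2 h'.gradient_ne) ?_
    change inner ℝ b (-(b - a)) < 0
    rw [inner_neg_right, inner_sub_right, real_inner_self_eq_norm_sq, hb, real_inner_comm]
    linarith
  -- along `b - a` the function `ρ` decreases and `ρ'` increases
  have h3 := h.eventually_neg (h.mem_frontier_iff.1 hp) h1
  have h4 := eventually_pos_add_smul (h'.smooth.differentiable (by simp) p)
    (h'.mem_frontier_iff.1 hp) (v := b - a) (by simpa using h2)
  have h5 := (tendsto_add_smul (p := p) (b - a)).eventually (h.locally_eq.and h'.locally_eq)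
  obtain ⟨t, h3, h4, h5, h6⟩ := (h3.and (h4.and h5)).exists
  exact absurd (h6.1 (h5.2 h3)) (not_lt.2 h4.le)

theorem outwardNormal_eq (h : IsLocalDefiningFunction Ω p ρ) (hp : p ∈ frontier Ω) :
    outwardNormal Ω p = unitGradient ρ p := by
  have hex : ∃ ρ, IsLocalDefiningFunction Ω p ρ := ⟨ρ, h⟩
  rw [outwardNormal, dif_pos hex]
  exact hex.choose_spec.unitGradient_unique h hp

theorem range_fderiv (h : IsLocalDefiningFunction Ω p ρ) : (fderiv ℝ ρ p).range = ⊤ := by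
  refine LinearMap.range_eq_top.2 (LinearMap.surjective ?_)
  intro h0
  have h1 := h.fderiv_gradient
  have h2 : fderiv ℝ ρ p (gradient ρ p) = 0 := congrArg (fun L => L (gradient ρ p)) h0
  exact h1.ne' h2

/-- Vectors orthogonal to the gradient are tangent to the boundary. -/
theorem mem_tangentConeAt (h : IsLocalDefiningFunction Ω p ρ) (hp : p ∈ frontier Ω) {v : E3}
    (hv : fderiv ℝ ρ p v = 0) : v ∈ tangentConeAt ℝ (frontier Ω) p := by
  have hs : HasStrictFDerivAt ρ (fderiv ℝ ρ p) p :=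
    h.smooth.contDiffAt.hasStrictFDerivAt (by simp)
  have hr := h.range_fderiv
  -- The implicit function parametrizes the level set of ρ by the kernel of dρ, and its derivative
  -- at 0 is the inclusion of that kernel. All directions are tangent at 0 in the kernel, and their
  -- images are tangent to the boundary.
  set ψ := hs.implicitFunction ρ (fderiv ℝ ρ p) hr (ρ p)
  have h0 : ψ 0 = p := hs.implicitFunction_apply_image hr
  have hψ : HasStrictFDerivAt ψ _ 0 := hs.to_implicitFunction hr
  have hc : Tendsto ψ (𝓝 0) (𝓝 p) := by
    have : Tendsto ψ (𝓝 0) (𝓝 (ψ 0)) := hψ.continuousAt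
    rwa [h0] at this
  have h1 : ∀ᶠ y in 𝓝 0, ψ y ∈ frontier Ω := by
    have h2 := (Continuous.prodMk_right (ρ p)).tendsto (0 : (fderiv ℝ ρ p).ker) |>.eventually
      (hs.map_implicitFunction_eq hr)
    filter_upwards [h2, hc.eventually h.eventually_mem_frontier_iff] with y h3 h4
    exact h4.2 (h3.trans (h.mem_frontier_iff.1 hp))
  have h2 := hψ.hasFDerivAt.hasFDerivWithinAt (s := ψ ⁻¹' frontier Ω)
  have h4 : (⟨v, hv⟩ : (fderiv ℝ ρ p).ker) ∈ tangentConeAt ℝ (ψ ⁻¹' frontier Ω) 0 :=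
    (tangentConeAt_of_mem_nhds (𝕜 := ℝ) (show ψ ⁻¹' frontier Ω ∈ 𝓝 0 from h1)).ge (mem_univ _)
  have h3 := h2.mapsTo_tangent_cone h4
  change v ∈ tangentConeAt ℝ (ψ '' (ψ ⁻¹' frontier Ω)) (ψ 0) at h3
  rw [h0] at h3
  exact tangentConeAt_mono (image_preimage_subset _ _) h3

/-- Near each of its points the boundary has finite area. -/
theorem exists_measure_lt_top (h : IsLocalDefiningFunction Ω p ρ) (hp : p ∈ frontier Ω) :
    ∃ t ∈ 𝓝 p, (Measure.euclideanHausdorffMeasure 2 : Measure E3) (frontier Ω ∩ t) < ⊤ := by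
  have hs : HasStrictFDerivAt ρ (fderiv ℝ ρ p) p :=
    h.smooth.contDiffAt.hasStrictFDerivAt (by simp)
  have hr := h.range_fderiv
  set ψ := hs.implicitFunction ρ (fderiv ℝ ρ p) hr (ρ p) with hψdef
  set Φ := hs.implicitToOpenPartialHomeomorph ρ (fderiv ℝ ρ p) hr
  -- On a bounded piece of the two-dimensional kernel the parametrization is Lipschitz, so it
  -- enlarges two-dimensional Hausdorff measure at most by a constant factor.
  obtain ⟨K, s, hs0, hlip⟩ := (hs.to_implicitFunction hr).exists_lipschitzOnWith
  set B := s ∩ Metric.ball (0 : (fderiv ℝ ρ p).ker) 1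
  have hB : B ∈ 𝓝 (0 : (fderiv ℝ ρ p).ker) := inter_mem hs0 (Metric.ball_mem_nhds _ one_pos)
  have hfin : Module.finrank ℝ (fderiv ℝ ρ p).ker = 2 := by
    have h1 := LinearMap.finrank_range_add_finrank_ker (fderiv ℝ ρ p : E3 →ₗ[ℝ] ℝ)
    have h2 : Module.finrank ℝ (LinearMap.range (fderiv ℝ ρ p : E3 →ₗ[ℝ] ℝ)) = 1 := by
      have : LinearMap.range (fderiv ℝ ρ p : E3 →ₗ[ℝ] ℝ) = ⊤ := hr
      rw [this, finrank_top, Module.finrank_self]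
    have h3 : Module.finrank ℝ E3 = 3 := by simp
    rw [h2, h3] at h1
    have h4 : Module.finrank ℝ (LinearMap.ker (fderiv ℝ ρ p : E3 →ₗ[ℝ] ℝ)) = 2 := by omega
    exact h4
  have hBfin : (Measure.hausdorffMeasure 2 : Measure (fderiv ℝ ρ p).ker) B < ⊤ := by
    have hle : (Measure.hausdorffMeasure 2 : Measure (fderiv ℝ ρ p).ker)
        (Metric.ball (0 : (fderiv ℝ ρ p).ker) 1) < ⊤ := by
      have : (Measure.hausdorffMeasure (Module.finrank ℝ (fderiv ℝ ρ p).ker) :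
          Measure (fderiv ℝ ρ p).ker) (Metric.ball (0 : (fderiv ℝ ρ p).ker) 1) < ⊤ :=
        measure_ball_lt_top
      rw [hfin] at this
      exact_mod_cast this
    exact (measure_mono inter_subset_right).trans_lt hle
  have himg : (Measure.euclideanHausdorffMeasure 2 : Measure E3) (ψ '' B) < ⊤ := by
    rw [Measure.euclideanHausdorffMeasure_def, Measure.smul_apply, ENNReal.smul_def, smul_eq_mul]
    refine ENNReal.mul_lt_top ENNReal.coe_lt_top ?_
    refine ((hlip.mono inter_subset_left).hausdorffMeasure_image_le (by norm_num)).trans_lt ?_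
    refine ENNReal.mul_lt_top ?_ (by exact_mod_cast hBfin)
    exact ENNReal.rpow_lt_top_of_nonneg (by norm_num) ENNReal.coe_ne_top
  have hΦ : Tendsto (fun x => (Φ x).2) (𝓝 p) (𝓝 0) := by
    have h1 : ContinuousAt Φ p :=
      Φ.continuousAt (hs.mem_implicitToOpenPartialHomeomorph_source hr)
    have h2 : Φ p = (ρ p, 0) := hs.implicitToOpenPartialHomeomorph_self hr
    have := (continuous_snd.tendsto (Φ p)).comp h1
    rwa [h2] at this
  have hev : ∀ᶠ x in 𝓝 p, x ∈ frontier Ω → x ∈ ψ '' B := by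
    filter_upwards [hs.eq_implicitFunction hr, hΦ.eventually hB, h.eventually_mem_frontier_iff]
      with x h1 h2 h3 hx
    refine ⟨_, h2, ?_⟩
    rw [hψdef, h.mem_frontier_iff.1 hp, ← h3.1 hx]
    exact h1
  exact ⟨_, hev, (measure_mono fun x hx => hx.2 hx.1).trans_lt himg⟩

end IsLocalDefiningFunction

/-! ### Area and unit normal of a smooth domain -/

namespace IsSmoothDomain

variable {Ω : Set E3}

theorem isCompact_frontier (h : IsSmoothDomain Ω) : IsCompact (frontier Ω) :=
  Metric.isCompact_of_isClosed_isBounded isClosed_frontier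
    (h.bounded.closure.subset frontier_subset_closure)

/-- Locally finite area on a compact boundary. It makes the L² traces integrable. -/
theorem isFiniteMeasure (h : IsSmoothDomain Ω) : IsFiniteMeasure (surfaceMeasure Ω) := by
  constructor
  rw [surfaceMeasure, Measure.restrict_apply_univ]
  refine h.isCompact_frontier.measure_lt_top_of_nhdsWithin fun p hp => ?_
  obtain ⟨ρ, hρ⟩ := h.boundary p hp
  obtain ⟨t, ht, hfin⟩ := hρ.exists_measure_lt_top hp
  exact ⟨frontier Ω ∩ t, inter_mem self_mem_nhdsWithin (mem_nhdsWithin_of_mem_nhds ht), hfin⟩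

theorem norm_outwardNormal (h : IsSmoothDomain Ω) {p : E3} (hp : p ∈ frontier Ω) :
    ‖outwardNormal Ω p‖ = 1 := by
  obtain ⟨ρ, hρ⟩ := h.boundary p hp
  rw [hρ.outwardNormal_eq hp, norm_unitGradient hρ.gradient_ne]

theorem sum_outwardNormal_sq (h : IsSmoothDomain Ω) {p : E3} (hp : p ∈ frontier Ω) :
    ∑ j, outwardNormal Ω p j ^ 2 = 1 := by
  obtain ⟨ρ, hρ⟩ := h.boundary p hp
  rw [hρ.outwardNormal_eq hp, sum_unitGradient_sq hρ.gradient_ne]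

theorem continuousOn_outwardNormal (h : IsSmoothDomain Ω) :
    ContinuousOn (outwardNormal Ω) (frontier Ω) := by
  intro p hp
  obtain ⟨ρ, hρ⟩ := h.boundary p hp
  refine ((contDiffAt_unitGradient hρ.smooth hρ.gradient_ne).continuousAt.continuousWithinAt
    (s := frontier Ω)).congr_of_eventuallyEq ?_ (hρ.outwardNormal_eq hp)
  filter_upwards [self_mem_nhdsWithin, mem_nhdsWithin_of_mem_nhds hρ.eventually] with q hq hq'
  exact hq'.outwardNormal_eq hq

end IsSmoothDomain

/-! ### Smooth functions depending holomorphically on a parameter -/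

section HolSmooth

variable {E F : Type*} [NormedAddCommGroup E] [NormedSpace ℝ E]
  [NormedAddCommGroup F] [NormedSpace ℂ F]

/-- `f` is jointly smooth on `D × U` and holomorphic in the first variable. -/
structure HolSmoothOn (D : Set ℂ) (U : Set E) (f : ℂ → E → F) : Prop where
  smooth : ContDiffOn ℝ ∞ (fun p : ℂ × E => f p.1 p.2) (D ×ˢ U)
  holo : ∀ x ∈ U, DifferentiableOn ℂ (fun τ => f τ x) D

variable {D : Set ℂ} {U : Set E} {f : ℂ → E → F}

theorem HolSmoothOn.contDiffAt (h : HolSmoothOn D U f) (hD : IsOpen D) (hU : IsOpen U) {τ : ℂ}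
    {x : E} (hτ : τ ∈ D) (hx : x ∈ U) : ContDiffAt ℝ ∞ (fun p : ℂ × E => f p.1 p.2) (τ, x) :=
  h.smooth.contDiffAt ((hD.prod hU).mem_nhds ⟨hτ, hx⟩)

theorem HolSmoothOn.contDiffOn_right (h : HolSmoothOn D U f) {τ : ℂ} (hτ : τ ∈ D) :
    ContDiffOn ℝ ∞ (f τ) U :=
  h.smooth.comp (contDiff_prodMk_right τ).contDiffOn fun _ hx => ⟨hτ, hx⟩

/-- The partial derivative with respect to the holomorphic variable. -/
theorem HolSmoothOn.deriv_eq (h : HolSmoothOn D U f) (hD : IsOpen D) (hU : IsOpen U) {τ : ℂ}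
    {x : E} (hτ : τ ∈ D) (hx : x ∈ U) (w : ℂ) :
    fderiv ℝ (fun p : ℂ × E => f p.1 p.2) (τ, x) (w, 0) = w • deriv (fun τ => f τ x) τ := by
  have h1 := ((h.contDiffAt hD hU hτ hx).differentiableAt (by simp)).hasFDerivAt
  have h2 : HasFDerivAt (fun τ' : ℂ => (τ', x)) (ContinuousLinearMap.inl ℝ ℂ E) τ :=
    hasFDerivAt_prodMk_left τ x
  have h3 := h1.comp τ h2
  have h4 := ((h.holo x hx).differentiableAt (hD.mem_nhds hτ)).hasDerivAt.hasFDerivAt.restrictScalars ℝ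
  have := congrArg (fun L : ℂ →L[ℝ] F => L w) (h3.unique h4)
  simpa using this

/-- The partial derivative with respect to the real variable. -/
theorem HolSmoothOn.fderiv_eq (h : HolSmoothOn D U f) (hD : IsOpen D) (hU : IsOpen U) {τ : ℂ}
    {x : E} (hτ : τ ∈ D) (hx : x ∈ U) (v : E) :
    fderiv ℝ (f τ) x v = fderiv ℝ (fun p : ℂ × E => f p.1 p.2) (τ, x) (0, v) := by
  have h1 := ((h.contDiffAt hD hU hτ hx).differentiableAt (by simp)).hasFDerivAt
  have h2 : HasFDerivAt (fun x' : E => (τ, x')) (ContinuousLinearMap.inr ℝ ℂ E) x :=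
    hasFDerivAt_prodMk_right τ x
  have h3 := h1.comp x h2
  have h4 : fderiv ℝ (f τ) x = _ := h3.fderiv
  rw [h4]
  simp

variable [CompleteSpace F]

/-- The complex derivative in τ is the real directional derivative along 1, hence jointly smooth. -/
theorem HolSmoothOn.deriv_left (h : HolSmoothOn D U f) (hD : IsOpen D) (hU : IsOpen U) :
    HolSmoothOn D U (fun τ x => deriv (fun τ => f τ x) τ) where
  smooth := by
    have h1 : ContDiffOn ℝ ∞ (fun p : ℂ × E =>
        fderiv ℝ (fun p : ℂ × E => f p.1 p.2) p (1, 0)) (D ×ˢ U) :=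
      (h.smooth.fderiv_of_isOpen (hD.prod hU) (by simp)).clm_apply contDiffOn_const
    refine h1.congr fun p hp => ?_
    rw [show p = (p.1, p.2) from rfl, h.deriv_eq hD hU hp.1 hp.2, one_smul]
  holo := fun x hx => (h.holo x hx).deriv hD

/-- Mixed derivatives commute. -/
theorem HolSmoothOn.fderiv_hasDerivAt (h : HolSmoothOn D U f) (hD : IsOpen D) (hU : IsOpen U)
    {τ : ℂ} {x : E} (hτ : τ ∈ D) (hx : x ∈ U) :
    HasDerivAt (fun τ => fderiv ℝ (f τ) x)
      (fderiv ℝ (fun x => deriv (fun τ => f τ x) τ) x) τ := by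
  set f' : ℂ × E → F := fun p => f p.1 p.2 with hf'
  have hc := h.contDiffAt hD hU hτ hx
  have hsymm := hc.isSymmSndFDerivAt (by simpa using two_le_infty)
  have hd : DifferentiableAt ℝ (fderiv ℝ f') (τ, x) :=
    (hc.fderiv_right (m := ∞) (by simp)).differentiableAt (by simp)
  -- real differentiability
  have h1 : HasFDerivAt (fun τ' : ℂ => (fderiv ℝ f' (τ', x)).comp (ContinuousLinearMap.inr ℝ ℂ E))
      ((ContinuousLinearMap.compL ℝ E (ℂ × E) F).flip (ContinuousLinearMap.inr ℝ ℂ E) ∘L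
        (fderiv ℝ (fderiv ℝ f') (τ, x)) ∘L ContinuousLinearMap.inl ℝ ℂ E) τ := by
    have h2 : HasFDerivAt (fun τ' : ℂ => (τ', x)) (ContinuousLinearMap.inl ℝ ℂ E) τ :=
      hasFDerivAt_prodMk_left τ x
    exact ((ContinuousLinearMap.compL ℝ E (ℂ × E) F).flip
      (ContinuousLinearMap.inr ℝ ℂ E)).hasFDerivAt.comp τ (hd.hasFDerivAt.comp τ h2)
  have h3 : HasFDerivAt (fun τ' : ℂ => fderiv ℝ (f τ') x)
      ((ContinuousLinearMap.compL ℝ E (ℂ × E) F).flip (ContinuousLinearMap.inr ℝ ℂ E) ∘L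
        (fderiv ℝ (fderiv ℝ f') (τ, x)) ∘L ContinuousLinearMap.inl ℝ ℂ E) τ := by
    refine h1.congr_of_eventuallyEq ?_
    filter_upwards [hD.mem_nhds hτ] with τ' hτ'
    ext v
    simp [h.fderiv_eq hD hU hτ' hx v, hf']
  -- the mixed derivative
  have h4 : ∀ (w : ℂ) (v : E), fderiv ℝ (fderiv ℝ f') (τ, x) (w, 0) (0, v) =
      w • fderiv ℝ (fun x => deriv (fun τ => f τ x) τ) x v := by
    intro w v
    rw [hsymm.eq]
    have h5 : HasFDerivAt (fun x' : E => (τ, x')) (ContinuousLinearMap.inr ℝ ℂ E) x :=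
      hasFDerivAt_prodMk_right τ x
    have h6 := (hd.hasFDerivAt.comp x h5).clm_apply (hasFDerivAt_const ((w, 0) : ℂ × E) x)
    have h7 : (fun x' => fderiv ℝ f' (τ, x') (w, 0)) =ᶠ[𝓝 x]
        fun x' => w • deriv (fun τ => f τ x') τ := by
      filter_upwards [hU.mem_nhds hx] with x' hx'
      exact h.deriv_eq hD hU hτ hx' w
    have h8 := (h6.congr_of_eventuallyEq (f := fun x' => fderiv ℝ f' (τ, x') (w, 0)) (by rfl)).fderiv
    rw [h7.fderiv_eq] at h8
    have h9 : DifferentiableAt ℝ (fun x => deriv (fun τ => f τ x) τ) x :=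
      (((h.deriv_left hD hU).contDiffOn_right hτ).contDiffAt (hU.mem_nhds hx)).differentiableAt (by simp)
    rw [fderiv_fun_const_smul h9] at h8
    have := congrArg (fun L : E →L[ℝ] F => L v) h8
    simpa using this.symm
  -- By `h4` the real derivative in τ is the restriction of a complex-linear map, hence a complex
  -- derivative.
  rw [hasDerivAt_iff_hasFDerivAt]
  refine hasFDerivAt_of_restrictScalars ℝ h3 ?_
  ext w v
  simp [h4]

/-- Stability of the class under differentiation in x, which drives the induction on the order of
the derivatives. -/
theorem HolSmoothOn.fderiv_right (h : HolSmoothOn D U f) (hD : IsOpen D) (hU : IsOpen U) :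
    HolSmoothOn D U (fun τ x => fderiv ℝ (f τ) x) where
  smooth := by
    have h1 : ContDiffOn ℝ ∞ (fun p : ℂ × E =>
        (fderiv ℝ (fun p : ℂ × E => f p.1 p.2) p).comp (ContinuousLinearMap.inr ℝ ℂ E))
        (D ×ˢ U) :=
      (h.smooth.fderiv_of_isOpen (hD.prod hU) (by simp)).clm_comp contDiffOn_const
    refine h1.congr fun p hp => ?_
    ext v
    simp [h.fderiv_eq hD hU hp.1 hp.2 v]
  holo := fun x hx τ hτ =>
    (h.fderiv_hasDerivAt hD hU hτ hx).differentiableAt.differentiableWithinAt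

/-- Uniform convergence of the difference quotients on compact sets. -/
theorem HolSmoothOn.tendstoUniformlyOn (h : HolSmoothOn D U f) (hD : IsOpen D) (hU : IsOpen U)
    {τ : ℂ} (hτ : τ ∈ D) {K : Set E} (hKU : K ⊆ U) (hK : IsCompact K) :
    TendstoUniformlyOn (fun (τ' : ℂ) x => (τ' - τ)⁻¹ • (f τ' x - f τ x))
      (fun x => deriv (fun τ => f τ x) τ) (𝓝[≠] τ) K := by
  rw [Metric.tendstoUniformlyOn_iff]
  intro ε hε
  have hcont : ContinuousOn (fun p : ℂ × E => deriv (fun τ => f τ p.2) p.1) (D ×ˢ U) :=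
    (h.deriv_left hD hU).smooth.continuousOn
  -- uniform closeness of the derivative
  have hunif : ∀ᶠ τ' in 𝓝 τ, ∀ x ∈ K,
      ‖deriv (fun τ => f τ x) τ' - deriv (fun τ => f τ x) τ‖ < ε / 2 := by
    refine hK.eventually_forall_of_forall_eventually fun x hx => ?_
    have hat : ContinuousAt (fun p : ℂ × E => deriv (fun τ => f τ p.2) p.1) (τ, x) :=
      hcont.continuousAt ((hD.prod hU).mem_nhds ⟨hτ, hKU hx⟩)
    have h2 : ContinuousAt (fun p : ℂ × E => deriv (fun τ => f τ p.2) τ) (τ, x) := by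
      have : ContinuousAt (fun p : ℂ × E => (τ, p.2)) (τ, x) := by fun_prop
      exact ContinuousAt.comp (f := fun p : ℂ × E => (τ, p.2))
        (g := fun p : ℂ × E => deriv (fun τ => f τ p.2) p.1) hat this
    have h3 := (hat.sub h2).norm
    have h4 : ‖deriv (fun τ => f τ x) τ - deriv (fun τ => f τ x) τ‖ < ε / 2 := by
      simpa using hε
    exact h3.eventually (gt_mem_nhds h4)
  obtain ⟨r, hr, hball⟩ := Metric.eventually_nhds_iff_ball.1 (hunif.and (hD.mem_nhds hτ))
  filter_upwards [self_mem_nhdsWithin, mem_nhdsWithin_of_mem_nhds (Metric.ball_mem_nhds τ hr)]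
    with τ' hne hτ' x hx
  have hne' : τ' - τ ≠ 0 := sub_ne_zero.2 hne
  -- Mean value inequality for t ↦ f(t, x) - t ∂_τ f(τ, x), whose derivative is smaller than ε/2 on
  -- the ball, uniformly for x in K.
  have hmv : ‖(f τ' x - τ' • deriv (fun τ => f τ x) τ) -
      (f τ x - τ • deriv (fun τ => f τ x) τ)‖ ≤ ε / 2 * ‖τ' - τ‖ := by
    refine Convex.norm_image_sub_le_of_norm_hasDerivWithin_le
      (f := fun t => f t x - t • deriv (fun τ => f τ x) τ)
      (f' := fun t => deriv (fun τ => f τ x) t - deriv (fun τ => f τ x) τ)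
      (s := Metric.ball τ r) (fun t ht => ?_) (fun t ht => ((hball t ht).1 x hx).le)
      (convex_ball τ r) (Metric.mem_ball_self hr) hτ'
    have h1 := ((h.holo x (hKU hx)).differentiableAt (hD.mem_nhds (hball t ht).2)).hasDerivAt
    have h2 := (hasDerivAt_id t).smul_const (deriv (fun τ => f τ x) τ)
    rw [one_smul] at h2
    exact (h1.sub h2).hasDerivWithinAt
  rw [dist_comm, dist_eq_norm]
  have heq : (τ' - τ)⁻¹ • (f τ' x - f τ x) - deriv (fun τ => f τ x) τ =
      (τ' - τ)⁻¹ • ((f τ' x - τ' • deriv (fun τ => f τ x) τ) -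
      (f τ x - τ • deriv (fun τ => f τ x) τ)) := by
    rw [eq_inv_smul_iff₀ hne', smul_sub, smul_inv_smul₀ hne']
    module
  rw [heq, norm_smul, norm_inv]
  have hpos : 0 < ‖τ' - τ‖ := norm_pos_iff.2 hne'
  calc ‖τ' - τ‖⁻¹ * _ ≤ ‖τ' - τ‖⁻¹ * (ε / 2 * ‖τ' - τ‖) := by gcongr
    _ = ε / 2 := by field_simp
    _ < ε := by linarith

end HolSmooth

/-! ### Convergence with all derivatives, and passage to surfaces -/

section HolSmoothSurface

universe u

/-- The difference quotients converge with all derivatives, uniformly on compact sets. -/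
theorem HolSmoothOn.tendstoUniformlyOn_iteratedFDeriv {E : Type u} [NormedAddCommGroup E]
    [NormedSpace ℝ E] {D : Set ℂ} {U : Set E} (hD : IsOpen D) (hU : IsOpen U) {τ : ℂ} (hτ : τ ∈ D)
    {K : Set E} (hKU : K ⊆ U) (hK : IsCompact K) (k : ℕ) :
    ∀ {F : Type u} [NormedAddCommGroup F] [NormedSpace ℂ F] [CompleteSpace F] {f : ℂ → E → F},
    HolSmoothOn D U f →
    TendstoUniformlyOn (fun (τ' : ℂ) => iteratedFDeriv ℝ k
        (fun x => (τ' - τ)⁻¹ • (f τ' x - f τ x)))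
      (iteratedFDeriv ℝ k (fun x => deriv (fun τ => f τ x) τ)) (𝓝[≠] τ) K := by
  -- Order k + 1 for f is order k for its x-derivative, whose values lie in E →L[ℝ] F. The induction
  -- therefore runs over all target spaces at once, in the universe of E.
  induction k with
  | zero =>
    intro F _ _ _ f h
    have h1 := h.tendstoUniformlyOn hD hU hτ hKU hK
    have h2 := (continuousMultilinearCurryFin0 ℝ E F).symm.isometry.uniformContinuous
      |>.comp_tendstoUniformlyOn h1
    simp only [iteratedFDeriv_zero_eq_comp]
    exact h2
  | succ k ih =>
    intro F _ _ _ f h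
    have h1 := ih (h.fderiv_right hD hU)
    have h2 := (continuousMultilinearCurryRightEquiv' ℝ k E F).symm.isometry.uniformContinuous
      |>.comp_tendstoUniformlyOn h1
    refine (h2.congr ?_).congr_right ?_
    · filter_upwards [mem_nhdsWithin_of_mem_nhds (hD.mem_nhds hτ)] with τ' hτ' x hx
      rw [iteratedFDeriv_succ_eq_comp_right]
      simp only [Function.comp_apply]
      congr 1
      refine (Filter.EventuallyEq.iteratedFDeriv ℝ ?_ k).eq_of_nhds.symm
      filter_upwards [hU.mem_nhds (hKU hx)] with y hy
      have d1 : ∀ {t}, t ∈ D → DifferentiableAt ℝ (f t) y := fun ht =>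
        ((h.contDiffOn_right ht).contDiffAt (hU.mem_nhds hy)).differentiableAt (by simp)
      rw [fderiv_fun_const_smul (f := fun x => f τ' x - f τ x) ((d1 hτ').fun_sub (d1 hτ)), fderiv_fun_sub (d1 hτ') (d1 hτ)]
    · intro x hx
      rw [iteratedFDeriv_succ_eq_comp_right]
      simp only [Function.comp_apply]
      congr 1
      refine (Filter.EventuallyEq.iteratedFDeriv ℝ ?_ k).eq_of_nhds
      filter_upwards [hU.mem_nhds (hKU hx)] with y hy
      exact (h.fderiv_hasDerivAt hD hU hτ hy).deriv

/-- A family of functions on `S` which is locally the restriction of smooth functions depending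
holomorphically on the parameter is holomorphic with values in `C^∞(S)`. -/
theorem holomorphicIntoSmooth_of_local {F : Type} [NormedAddCommGroup F] [NormedSpace ℂ F]
    [CompleteSpace F]
    {D : Set ℂ} (hD : IsOpen D) {S : Set E3} {f : ℂ → E3 → F}
    (h : ∀ p ∈ S, ∃ U, IsOpen U ∧ p ∈ U ∧ ∃ G : ℂ → E3 → F, HolSmoothOn D U G ∧
      ∀ τ ∈ D, ∀ x ∈ S ∩ U, f τ x = G τ x) :
    HolomorphicIntoSmooth D S f := by
  have key : ∀ W φ, IsLocalParam S W φ → HolSmoothOn D W (fun τ α => f τ (φ α)) := by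
    intro W φ hφ
    constructor
    · rintro ⟨τ, α⟩ ⟨hτ, hα⟩
      obtain ⟨U, hU, hpU, G, hG, hfG⟩ := h (φ α) (hφ.mapsTo hα)
      have hφα : ContDiffAt ℝ ∞ φ α := hφ.smooth.contDiffAt (hφ.isOpen.mem_nhds hα)
      refine ContDiffAt.contDiffWithinAt ?_
      have h1 : ContDiffAt ℝ ∞ (fun p : ℂ × E2 => (p.1, φ p.2)) (τ, α) :=
        contDiffAt_fst.prodMk (ContDiffAt.comp (τ, α) (f := Prod.snd) hφα contDiffAt_snd)
      have h2 := ContDiffAt.comp (τ, α) (f := fun p : ℂ × E2 => (p.1, φ p.2))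
        (hG.contDiffAt hD hU hτ hpU) h1
      refine h2.congr_of_eventuallyEq ?_
      have h3 : ∀ᶠ p : ℂ × E2 in 𝓝 (τ, α), p ∈ D ×ˢ (W ∩ φ ⁻¹' U) := by
        refine prod_mem_nhds (hD.mem_nhds hτ) (inter_mem (hφ.isOpen.mem_nhds hα) ?_)
        exact hφα.continuousAt.preimage_mem_nhds (hU.mem_nhds hpU)
      filter_upwards [h3] with p hp
      exact hfG p.1 hp.1 _ ⟨hφ.mapsTo hp.2.1, hp.2.2⟩
    · intro α hα
      obtain ⟨U, hU, hpU, G, hG, hfG⟩ := h (φ α) (hφ.mapsTo hα)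
      exact (hG.holo _ hpU).congr fun τ hτ => hfG τ hτ _ ⟨hφ.mapsTo hα, hpU⟩
  intro τ hτ
  refine ⟨fun W φ hφ => (key W φ hφ).contDiffOn_right hτ,
    fun x => deriv (fun τ => f τ x) τ,
    fun W φ hφ => ((key W φ hφ).deriv_left hD hφ.isOpen).contDiffOn_right hτ, ?_⟩
  intro W φ hφ K hKW hK k
  exact HolSmoothOn.tendstoUniformlyOn_iteratedFDeriv hD hφ.isOpen hτ hKW hK k (key W φ hφ)

end HolSmoothSurface

/-! ### The complexified unit normal -/

/-- The parameter `τ` is admissible when the stretched conormal of a unit vector never has its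
complex square on the branch cut of the square root. -/
structure Admissible (σ : Fin 3 → ℝ → ℝ) (τ : ℂ) : Prop where
  add_ne_zero : ∀ j t, τ + (σ j t : ℂ) ≠ 0
  mem_slitPlane : ∀ (n : Fin 3 → ℝ) (x : E3), ∑ j, n j ^ 2 = 1 →
    ∑ j, (n j : ℂ) ^ 2 * stretchFactor σ τ x j ^ 2 ∈ Complex.slitPlane

/-- `∑ νⱼ²τ²/(τ+σⱼ)²` for the normalized gradient `ν` of `ρ`. -/
def conormalSq (σ : Fin 3 → ℝ → ℝ) (ρ : E3 → ℝ) (τ : ℂ) (x : E3) : ℂ :=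
  ∑ j, (unitGradient ρ x j : ℂ) ^ 2 * stretchFactor σ τ x j ^ 2

/-- The complexified unit normal `ν̃/√(ν̃ · ν̃)` for the normalized gradient `ν` of `ρ`. -/
def extNormal (σ : Fin 3 → ℝ → ℝ) (ρ : E3 → ℝ) (τ : ℂ) (x : E3) (j : Fin 3) : ℂ :=
  conormalSq σ ρ τ x ^ (-(1 / 2) : ℂ) * ((unitGradient ρ x j : ℂ) * stretchFactor σ τ x j)

/-- The partial derivative `∂ⱼ` of the component `k` of the complexified unit normal. -/
def extNormalDeriv (σ : Fin 3 → ℝ → ℝ) (ρ : E3 → ℝ) (τ : ℂ) (x : E3) (j k : Fin 3) : ℂ :=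
  fderiv ℝ (extNormal σ ρ τ) x (EuclideanSpace.single j 1) k

/-- Half of the stretched divergence of the complexified unit normal. -/
def extCurvature (σ : Fin 3 → ℝ → ℝ) (ρ : E3 → ℝ) (τ : ℂ) (x : E3) : ℂ :=
  (1 / 2) * ∑ j, stretchFactor σ τ x j * extNormalDeriv σ ρ τ x j j

section ExtNormal

variable {σ : Fin 3 → ℝ → ℝ} {ρ : E3 → ℝ} {τ : ℂ} {x : E3}

theorem contDiffAt_stretchFactor (hσ : ∀ j, ContDiff ℝ ∞ (σ j)) (hτ : Admissible σ τ) (j : Fin 3) :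
    ContDiffAt ℝ ∞ (fun p : ℂ × E3 => stretchFactor σ p.1 p.2 j) (τ, x) := by
  have h1 : ContDiff ℝ ∞ (fun p : ℂ × E3 => ((σ j (p.2 j) : ℝ) : ℂ)) :=
    Complex.ofRealCLM.contDiff.comp ((hσ j).comp
      ((EuclideanSpace.proj (𝕜 := ℝ) j).contDiff.comp contDiff_snd))
  have h2 : ContDiff ℝ ∞ (fun p : ℂ × E3 => p.1) := contDiff_fst
  simp only [stretchFactor, div_eq_mul_inv]
  exact h2.contDiffAt.mul ((h2.add h1).contDiffAt.inv (hτ.add_ne_zero j _))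

theorem differentiableAt_stretchFactor (hτ : Admissible σ τ) (j : Fin 3) :
    DifferentiableAt ℂ (fun τ => stretchFactor σ τ x j) τ := by
  unfold stretchFactor
  exact differentiableAt_id.div (differentiableAt_id.add_const _) (hτ.add_ne_zero j _)

theorem contDiffAt_ofReal_unitGradient (hρ : ContDiff ℝ ∞ ρ) (hx : gradient ρ x ≠ 0) (j : Fin 3) :
    ContDiffAt ℝ ∞ (fun x => (unitGradient ρ x j : ℂ)) x :=
  Complex.ofRealCLM.contDiff.contDiffAt.comp x
    ((EuclideanSpace.proj (𝕜 := ℝ) j).contDiff.contDiffAt.comp x (contDiffAt_unitGradient hρ hx))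

theorem conormalSq_mem_slitPlane (hτ : Admissible σ τ) (hx : gradient ρ x ≠ 0) :
    conormalSq σ ρ τ x ∈ Complex.slitPlane :=
  hτ.mem_slitPlane _ x (sum_unitGradient_sq hx)

theorem contDiffAt_conormalSq_cpow (hσ : ∀ j, ContDiff ℝ ∞ (σ j)) (hτ : Admissible σ τ)
    (hρ : ContDiff ℝ ∞ ρ) (hx : gradient ρ x ≠ 0) :
    ContDiffAt ℝ ∞ (fun p : ℂ × E3 => conormalSq σ ρ p.1 p.2 ^ (-(1 / 2) : ℂ)) (τ, x) := by
  have h1 : ContDiffAt ℝ ∞ (fun p : ℂ × E3 => conormalSq σ ρ p.1 p.2) (τ, x) := by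
    unfold conormalSq
    refine ContDiffAt.sum fun j _ => ContDiffAt.mul ?_ ((contDiffAt_stretchFactor hσ hτ j).pow 2)
    exact (ContDiffAt.comp (τ, x) (f := Prod.snd) (contDiffAt_ofReal_unitGradient hρ hx j)
      contDiffAt_snd).pow 2
  have h2 : AnalyticAt ℂ (fun z : ℂ => z ^ (-(1 / 2) : ℂ)) (conormalSq σ ρ τ x) :=
    analyticAt_id.cpow analyticAt_const (conormalSq_mem_slitPlane hτ hx)
  exact ContDiffAt.comp (τ, x) (g := fun z : ℂ => z ^ (-(1 / 2) : ℂ))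
    (h2.contDiffAt.restrict_scalars ℝ) h1

theorem contDiffAt_extNormal (hσ : ∀ j, ContDiff ℝ ∞ (σ j)) (hτ : Admissible σ τ)
    (hρ : ContDiff ℝ ∞ ρ) (hx : gradient ρ x ≠ 0) :
    ContDiffAt ℝ ∞ (fun p : ℂ × E3 => extNormal σ ρ p.1 p.2) (τ, x) := by
  refine contDiffAt_pi.2 fun j => ?_
  refine (contDiffAt_conormalSq_cpow hσ hτ hρ hx).mul
    (ContDiffAt.mul ?_ (contDiffAt_stretchFactor hσ hτ j))
  exact ContDiffAt.comp (τ, x) (f := Prod.snd) (contDiffAt_ofReal_unitGradient hρ hx j)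
    contDiffAt_snd

theorem contDiffAt_extNormal_right (hσ : ∀ j, ContDiff ℝ ∞ (σ j)) (hτ : Admissible σ τ)
    (hρ : ContDiff ℝ ∞ ρ) (hx : gradient ρ x ≠ 0) : ContDiffAt ℝ ∞ (extNormal σ ρ τ) x :=
  ContDiffAt.comp x (f := fun x => (τ, x)) (contDiffAt_extNormal hσ hτ hρ hx)
    (contDiff_prodMk_right τ).contDiffAt

theorem differentiableAt_extNormal (hτ : Admissible σ τ) (hx : gradient ρ x ≠ 0) :
    DifferentiableAt ℂ (fun τ => extNormal σ ρ τ x) τ := by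
  refine differentiableAt_pi.2 fun j => ?_
  refine DifferentiableAt.mul ?_ ((differentiableAt_stretchFactor hτ j).const_mul _)
  refine DifferentiableAt.cpow ?_ (differentiableAt_const _) (conormalSq_mem_slitPlane hτ hx)
  unfold conormalSq
  exact DifferentiableAt.fun_sum fun j _ =>
    ((differentiableAt_stretchFactor hτ j).pow 2).const_mul _

/-- The normalization is by the bilinear square, not by the Hermitian norm: this keeps n holomorphic
in τ and gives A(n)² = 1. -/
theorem sum_extNormal_sq (hτ : Admissible σ τ) (hx : gradient ρ x ≠ 0) :
    ∑ j, extNormal σ ρ τ x j ^ 2 = 1 := by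
  have h0 : conormalSq σ ρ τ x ≠ 0 := Complex.slitPlane_ne_zero (conormalSq_mem_slitPlane hτ hx)
  have h1 : (conormalSq σ ρ τ x ^ (-(1 / 2) : ℂ)) ^ 2 = (conormalSq σ ρ τ x)⁻¹ := by
    rw [← Complex.cpow_nat_mul, ← Complex.cpow_neg_one]
    norm_num
  simp only [extNormal, mul_pow, h1]
  rw [← Finset.mul_sum]
  exact inv_mul_cancel₀ h0

theorem sum_extNormal_mul_extNormalDeriv (hσ : ∀ j, ContDiff ℝ ∞ (σ j)) (hτ : Admissible σ τ)
    (hρ : ContDiff ℝ ∞ ρ) (hx : gradient ρ x ≠ 0) (j : Fin 3) :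
    ∑ k, extNormal σ ρ τ x k * extNormalDeriv σ ρ τ x j k = 0 := by
  have hd := ((contDiffAt_extNormal_right hσ hτ hρ hx).differentiableAt (by simp)).hasFDerivAt
  have h1 : HasFDerivAt (fun y => ∑ k, extNormal σ ρ τ y k ^ 2)
      (∑ k, (2 * extNormal σ ρ τ x k) •
        (ContinuousLinearMap.proj (R := ℝ) (φ := fun _ : Fin 3 => ℂ) k ∘L
          fderiv ℝ (extNormal σ ρ τ) x)) x := by
    refine HasFDerivAt.fun_sum fun k _ => ?_
    have h2 := ((hasFDerivAt_pi'.1 hd) k).pow 2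
    simpa using h2
  have h2 : (fun y => ∑ k, extNormal σ ρ τ y k ^ 2) =ᶠ[𝓝 x] fun _ => (1 : ℂ) := by
    filter_upwards [(contDiff_gradient hρ).continuous.continuousAt.eventually_ne hx] with y hy
    exact sum_extNormal_sq hτ hy
  have h3 := h1.unique ((hasFDerivAt_const (1 : ℂ) x).congr_of_eventuallyEq h2)
  have h4 := congrArg (fun L : E3 →L[ℝ] ℂ => L (EuclideanSpace.single j 1)) h3
  simp only [_root_.sum_apply, _root_.smul_apply,
    ContinuousLinearMap.comp_apply, ContinuousLinearMap.proj_apply, smul_eq_mul,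
    _root_.zero_apply, mul_assoc, ← Finset.mul_sum] at h4
  exact (mul_eq_zero.1 h4).resolve_left two_ne_zero

/-- The stretched gradient structure of the complexified normal: its stretched curl is a wedge
product with the normal. -/
theorem exists_curl_extNormal (hσ : ∀ j, ContDiff ℝ ∞ (σ j)) (hτ : Admissible σ τ)
    (hρ : ContDiff ℝ ∞ ρ) (hx : gradient ρ x ≠ 0) :
    ∃ f : Fin 3 → ℂ, ∀ j k, stretchFactor σ τ x j * extNormalDeriv σ ρ τ x j k -
      stretchFactor σ τ x k * extNormalDeriv σ ρ τ x k j =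
        f j * extNormal σ ρ τ x k - f k * extNormal σ ρ τ x j := by
  -- With this h one has n_k = h s_k ∂_kρ. Since s_k depends on x_k alone and second derivatives of
  -- ρ commute, for j ≠ k the part of s_j ∂_j n_k that is not symmetric comes from ∂_j h. This
  -- dictates f_j = s_j ∂_j h / h.
  set h : E3 → ℂ := fun y => conormalSq σ ρ τ y ^ (-(1 / 2) : ℂ) * ((‖gradient ρ y‖⁻¹ : ℝ) : ℂ)
    with hh
  have hext : ∀ y k, extNormal σ ρ τ y k =
      h y * (stretchFactor σ τ y k * ((partialDeriv k ρ y : ℝ) : ℂ)) := by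
    intro y k
    simp only [extNormal, hh, unitGradient, PiLp.smul_apply, smul_eq_mul, gradient_apply]
    push_cast
    ring
  have h0 : h x ≠ 0 := by
    refine mul_ne_zero ?_ ?_
    · rw [Complex.cpow_def_of_ne_zero
        (Complex.slitPlane_ne_zero (conormalSq_mem_slitPlane hτ hx))]
      exact Complex.exp_ne_zero _
    · exact_mod_cast inv_ne_zero (norm_ne_zero_iff.2 hx)
  have hdh : DifferentiableAt ℝ h x := by
    have h1 : ContDiffAt ℝ ∞ (fun y => conormalSq σ ρ τ y ^ (-(1 / 2) : ℂ)) x :=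
      ContDiffAt.comp x (f := fun x => (τ, x)) (contDiffAt_conormalSq_cpow hσ hτ hρ hx)
        (contDiff_prodMk_right τ).contDiffAt
    have h2 : ContDiffAt ℝ ∞ (fun y => ((‖gradient ρ y‖⁻¹ : ℝ) : ℂ)) x :=
      Complex.ofRealCLM.contDiff.contDiffAt.comp x
        (((contDiff_gradient hρ).contDiffAt.norm ℝ hx).inv (norm_ne_zero_iff.2 hx))
    exact (h1.mul h2).differentiableAt (by simp)
  have hds : ∀ k, HasFDerivAt (fun y => stretchFactor σ τ y k)
      (fderiv ℝ (fun t : ℝ => τ / (τ + (σ k t : ℂ))) (x k) ∘L EuclideanSpace.proj (𝕜 := ℝ) k) x := by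
    intro k
    have h1 : DifferentiableAt ℝ (fun t : ℝ => τ / (τ + (σ k t : ℂ))) (x k) := by
      have h2 : DifferentiableAt ℝ (fun t : ℝ => ((σ k t : ℝ) : ℂ)) (x k) :=
        (Complex.ofRealCLM.contDiff.comp (hσ k)).differentiable (by simp) _
      simp only [div_eq_mul_inv]
      exact ((h2.const_add τ).inv (hτ.add_ne_zero k _)).const_mul τ
    exact h1.hasFDerivAt.comp x (EuclideanSpace.proj (𝕜 := ℝ) k).hasFDerivAt
  have hdρ : ∀ k, HasFDerivAt (fun y => ((partialDeriv k ρ y : ℝ) : ℂ))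
      (Complex.ofRealCLM ∘L fderiv ℝ (partialDeriv k ρ) x) x := fun k =>
    Complex.ofRealCLM.hasFDerivAt.comp x
      ((contDiff_partialDeriv hρ k).differentiable (by simp) x).hasFDerivAt
  have hsymm : ∀ j k, fderiv ℝ (partialDeriv k ρ) x (EuclideanSpace.single j 1) =
      fderiv ℝ (partialDeriv j ρ) x (EuclideanSpace.single k 1) :=
    fun j k => partialDeriv_partialDeriv_comm hρ j k x
  have hderiv : ∀ j k, extNormalDeriv σ ρ τ x j k =
      fderiv ℝ h x (EuclideanSpace.single j 1) *
        (stretchFactor σ τ x k * ((partialDeriv k ρ x : ℝ) : ℂ)) +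
      h x * (stretchFactor σ τ x k *
        ((fderiv ℝ (partialDeriv k ρ) x (EuclideanSpace.single j 1) : ℝ) : ℂ) +
        (partialDeriv k ρ x : ℂ) *
        fderiv ℝ (fun t : ℝ => τ / (τ + (σ k t : ℂ))) (x k)
          ((EuclideanSpace.single j (1 : ℝ) : E3) k)) := by
    intro j k
    have hd := ((contDiffAt_extNormal_right hσ hτ hρ hx).differentiableAt (by simp)).hasFDerivAt
    have h1 := (hasFDerivAt_pi'.1 hd) k
    have h2 := hdh.hasFDerivAt.mul ((hds k).mul (hdρ k))
    have h3 : (fun y => extNormal σ ρ τ y k) = fun y => h y * (stretchFactor σ τ y k *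
      ((partialDeriv k ρ y : ℝ) : ℂ)) := funext fun y => hext y k
    rw [h3] at h1
    have h4 := congrArg (fun L : E3 →L[ℝ] ℂ => L (EuclideanSpace.single j 1)) (h1.unique h2)
    simp only [ContinuousLinearMap.comp_apply, ContinuousLinearMap.proj_apply,
      _root_.add_apply, _root_.smul_apply, smul_eq_mul,
      Complex.ofRealCLM_apply, Pi.mul_apply] at h4
    rw [extNormalDeriv, h4, show EuclideanSpace.proj (𝕜 := ℝ) k
      (EuclideanSpace.single j (1 : ℝ) : E3) = (EuclideanSpace.single j (1 : ℝ) : E3) k from rfl]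
    ring
  refine ⟨fun j => stretchFactor σ τ x j * fderiv ℝ h x (EuclideanSpace.single j 1) / h x,
    fun j k => ?_⟩
  by_cases hjk : j = k
  · subst hjk; ring
  rw [hderiv, hderiv, hext, hext, hsymm j k]
  have e1 : (EuclideanSpace.single j (1 : ℝ) : E3) k = 0 := by simp [Ne.symm hjk]
  have e2 : (EuclideanSpace.single k (1 : ℝ) : E3) j = 0 := by simp [hjk]
  rw [e1, e2, map_zero, map_zero]
  field_simp
  ring

theorem extNormal_eq_of_unitGradient_eq {ρ' : E3 → ℝ} (h : unitGradient ρ x = unitGradient ρ' x) :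
    extNormal σ ρ τ x = extNormal σ ρ' τ x := by
  funext j
  simp only [extNormal, conormalSq, h]

/-- The complexified curvature does not depend on the local defining function. -/
theorem extCurvature_unique {Ω : Set E3} {ρ' : E3 → ℝ} (hσ : ∀ j, ContDiff ℝ ∞ (σ j))
    (hτ : Admissible σ τ) (h : IsLocalDefiningFunction Ω x ρ) (h' : IsLocalDefiningFunction Ω x ρ')
    (hx : x ∈ frontier Ω) : extCurvature σ ρ τ x = extCurvature σ ρ' τ x := by
  have hN : extNormal σ ρ τ x = extNormal σ ρ' τ x :=
    extNormal_eq_of_unitGradient_eq (h.unitGradient_unique h' hx)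
  set d : E3 → Fin 3 → ℂ := fun y => extNormal σ ρ τ y - extNormal σ ρ' τ y with hd
  have hd1 := ((contDiffAt_extNormal_right hσ hτ h.smooth h.gradient_ne).differentiableAt
    (by simp)).hasFDerivAt
  have hd2 := ((contDiffAt_extNormal_right hσ hτ h'.smooth h'.gradient_ne).differentiableAt
    (by simp)).hasFDerivAt
  have hdd := hd1.sub hd2
  set T := fderiv ℝ (extNormal σ ρ τ) x - fderiv ℝ (extNormal σ ρ' τ) x with hT
  have hzero : HasFDerivWithinAt d (0 : E3 →L[ℝ] Fin 3 → ℂ) (frontier Ω) x := by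
    refine (hasFDerivWithinAt_const (0 : Fin 3 → ℂ) x (frontier Ω)).congr_of_eventuallyEq ?_
      (by simp [hd, hN])
    filter_upwards [self_mem_nhdsWithin, mem_nhdsWithin_of_mem_nhds h.eventually,
      mem_nhdsWithin_of_mem_nhds h'.eventually] with y hy h1 h2
    simp only [hd]
    rw [extNormal_eq_of_unitGradient_eq (h1.unitGradient_unique h2 hy), sub_self]
  -- Both complexified normals agree on the boundary, so their derivatives agree on tangent vectors,
  -- and T v = (ν · v) T ν.
  have htan : ∀ v, fderiv ℝ ρ x v = 0 → T v = 0 := fun v hv =>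
    (hdd.hasFDerivWithinAt (s := frontier Ω)).unique_on hzero (h.mem_tangentConeAt hx hv)
  set ν := unitGradient ρ x with hν
  have hν1 : ∑ j, ν j ^ 2 = 1 := sum_unitGradient_sq h.gradient_ne
  -- the difference of the derivatives has rank one
  have hrank : ∀ j, T (EuclideanSpace.single j 1) = ν j • T ν := by
    intro j
    rw [← sub_eq_zero, ← map_smul, ← map_sub]
    apply htan
    rw [← inner_gradient_left]
    have hg : gradient ρ x = ‖gradient ρ x‖ • ν := by
      rw [hν, unitGradient, smul_inv_smul₀ (norm_ne_zero_iff.2 h.gradient_ne)]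
    rw [hg, inner_smul_left, inner_sub_right, inner_smul_right, real_inner_self_eq_norm_sq,
      norm_unitGradient h.gradient_ne, EuclideanSpace.inner_single_right]
    simp
  have hTk : ∀ j k, extNormalDeriv σ ρ τ x j k - extNormalDeriv σ ρ' τ x j k = ν j * T ν k := by
    intro j k
    have := congrFun (hrank j) k
    simpa [hT, extNormalDeriv] using this
  -- Differentiating n · n = 1 for both functions makes T ν orthogonal to n. The difference of the
  -- divergences is Σ s_j ν_j (T ν)_j, a multiple of n · T ν.
  have horth : ∑ k, extNormal σ ρ τ x k * T ν k = 0 := by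
    have h1 : ∀ j, (ν j : ℂ) * ∑ k, extNormal σ ρ τ x k * T ν k = 0 := by
      intro j
      have e1 := sum_extNormal_mul_extNormalDeriv hσ hτ h.smooth h.gradient_ne j
      have e2 := sum_extNormal_mul_extNormalDeriv hσ hτ h'.smooth h'.gradient_ne j
      rw [← hN] at e2
      rw [Finset.mul_sum]
      calc _ = ∑ k, (extNormal σ ρ τ x k * extNormalDeriv σ ρ τ x j k -
            extNormal σ ρ τ x k * extNormalDeriv σ ρ' τ x j k) :=
          Finset.sum_congr rfl fun k _ => by rw [← mul_sub, hTk]; ring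
        _ = 0 := by rw [Finset.sum_sub_distrib, e1, e2, sub_self]
    have h2 : ∑ j, (ν j : ℂ) * ((ν j : ℂ) * ∑ k, extNormal σ ρ τ x k * T ν k) = 0 :=
      Finset.sum_eq_zero fun j _ => by rw [h1, mul_zero]
    simp only [← mul_assoc, ← sq] at h2
    rw [← Finset.sum_mul] at h2
    have h3 : ∑ j, (ν j : ℂ) ^ 2 = 1 := by exact_mod_cast hν1
    rwa [h3, one_mul] at h2
  have h0 : conormalSq σ ρ τ x ^ (-(1 / 2) : ℂ) ≠ 0 := by
    rw [Complex.cpow_def_of_ne_zero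
      (Complex.slitPlane_ne_zero (conormalSq_mem_slitPlane hτ h.gradient_ne))]
    exact Complex.exp_ne_zero _
  rw [extCurvature, extCurvature, ← sub_eq_zero, ← mul_sub, ← Finset.sum_sub_distrib]
  have : ∑ j, (stretchFactor σ τ x j * extNormalDeriv σ ρ τ x j j -
      stretchFactor σ τ x j * extNormalDeriv σ ρ' τ x j j) = 0 := by
    refine mul_left_cancel₀ h0 ?_
    rw [Finset.mul_sum, mul_zero, ← horth]
    refine Finset.sum_congr rfl fun j _ => ?_
    rw [← mul_sub, hTk, extNormal]
    ring
  rw [this, mul_zero]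

/-- Evaluation of a derivative on a vector, followed by a coordinate. -/
def evalCoord (v : E3) (j : Fin 3) : (E3 →L[ℝ] Fin 3 → ℂ) →L[ℂ] ℂ where
  toFun L := L v j
  map_add' _ _ := rfl
  map_smul' _ _ := rfl
  cont := by fun_prop

variable {D : Set ℂ} {U : Set E3}

theorem holSmoothOn_extNormal (hσ : ∀ j, ContDiff ℝ ∞ (σ j)) (hD : ∀ τ ∈ D, Admissible σ τ)
    (hρ : ContDiff ℝ ∞ ρ) (hU : ∀ x ∈ U, gradient ρ x ≠ 0) :
    HolSmoothOn D U (extNormal σ ρ) where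
  smooth := fun p hp =>
    (contDiffAt_extNormal hσ (hD p.1 hp.1) hρ (hU p.2 hp.2)).contDiffWithinAt
  holo := fun x hx τ hτ =>
    (differentiableAt_extNormal (hD τ hτ) (hU x hx)).differentiableWithinAt

theorem holSmoothOn_extCurvature (hσ : ∀ j, ContDiff ℝ ∞ (σ j)) (hDo : IsOpen D) (hUo : IsOpen U)
    (hD : ∀ τ ∈ D, Admissible σ τ) (hρ : ContDiff ℝ ∞ ρ) (hU : ∀ x ∈ U, gradient ρ x ≠ 0) :
    HolSmoothOn D U (extCurvature σ ρ) where
  smooth := by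
    have h := ((holSmoothOn_extNormal hσ hD hρ hU).fderiv_right hDo hUo).smooth
    refine contDiffOn_const.mul (ContDiffOn.sum fun j _ => ContDiffOn.mul ?_ ?_)
    · exact fun p hp => (contDiffAt_stretchFactor hσ (hD p.1 hp.1) j).contDiffWithinAt
    · exact contDiffOn_pi.1 (h.clm_apply contDiffOn_const) j
  holo := by
    intro x hx
    have h := ((holSmoothOn_extNormal hσ hD hρ hU).fderiv_right hDo hUo).holo x hx
    refine (DifferentiableOn.fun_sum fun j _ => DifferentiableOn.mul ?_ ?_).const_mul _
    · exact fun τ hτ => (differentiableAt_stretchFactor (hD τ hτ) j).differentiableWithinAt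
    · have hL : Differentiable ℂ (evalCoord (EuclideanSpace.single j 1) j) :=
        (evalCoord _ _).differentiable
      exact hL.comp_differentiableOn h

end ExtNormal

/-! ### Admissible parameters and the spectrum of `A(ν̃)` -/

section Spectrum

variable {σ : Fin 3 → ℝ → ℝ}

/-- For large `|τ|` the stretched conormal of a unit vector is almost a unit vector. -/
theorem exists_radius (hσ_smooth : ∀ j, ContDiff ℝ ∞ (σ j))
    (hσ_supp : ∀ j, HasCompactSupport (σ j)) :
    ∃ R : ℝ, 1 < R ∧ ∀ τ : ℂ, R < ‖τ‖ → (∀ j t, τ + (σ j t : ℂ) ≠ 0) ∧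
      ∀ (n : Fin 3 → ℝ) (x : E3), ∑ j, n j ^ 2 = 1 →
        ‖∑ j, (n j : ℂ) ^ 2 * stretchFactor σ τ x j ^ 2 - 1‖ < 1 / 2 := by
  have hb : ∀ j, ∃ C, ∀ t, ‖σ j t‖ ≤ C := fun j =>
    (hσ_supp j).exists_bound_of_continuous (hσ_smooth j).continuous
  choose C hC using hb
  have hC0 : ∀ j, 0 ≤ C j := fun j => (norm_nonneg _).trans (hC j 0)
  set M := ∑ j, C j
  have hM0 : 0 ≤ M := Finset.sum_nonneg fun j _ => hC0 j
  have hM : ∀ j t, ‖((σ j t : ℝ) : ℂ)‖ ≤ M := fun j t => by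
    rw [Complex.norm_real]
    exact (hC j t).trans (Finset.single_le_sum (fun i _ => hC0 i) (Finset.mem_univ j))
  -- From |τ| > 9M + 2 follows |τ + σ_j| ≥ 8M + 2, so |s_j - 1| ≤ M/(8M + 2) ≤ 1/8 and |s_j² - 1| ≤
  -- (1/8)(17/8) = 17/64 < 1/2.
  refine ⟨9 * M + 2, by linarith, fun τ hτ => ?_⟩
  have hlow : ∀ j t, 8 * M + 2 ≤ ‖τ + (σ j t : ℂ)‖ := fun j t => by
    have h1 := norm_sub_norm_le τ (-(σ j t : ℂ))
    rw [norm_neg, sub_neg_eq_add] at h1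
    linarith [hM j t]
  have hne : ∀ j t, τ + (σ j t : ℂ) ≠ 0 := fun j t h0 => by
    have := hlow j t
    rw [h0, norm_zero] at this
    linarith
  refine ⟨hne, fun n x hn => ?_⟩
  have hs : ∀ j, ‖stretchFactor σ τ x j ^ 2 - 1‖ ≤ 17 / 64 := by
    intro j
    have h1 : ‖stretchFactor σ τ x j - 1‖ ≤ 1 / 8 := by
      have h2 : stretchFactor σ τ x j - 1 = -(σ j (x j) : ℂ) / (τ + (σ j (x j) : ℂ)) := by
        rw [stretchFactor, div_sub_one (hne j _)]
        congr 1
        ring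
      rw [h2, norm_div, norm_neg, div_le_iff₀ (by linarith [hlow j (x j)])]
      linarith [hlow j (x j), hM j (x j)]
    have h3 : stretchFactor σ τ x j ^ 2 - 1 =
        (stretchFactor σ τ x j - 1) * ((stretchFactor σ τ x j - 1) + 2) := by ring
    rw [h3, norm_mul]
    have h4 : ‖(stretchFactor σ τ x j - 1) + 2‖ ≤ 1 / 8 + 2 := by
      refine (norm_add_le _ _).trans (add_le_add h1 ?_)
      simp
    calc _ ≤ (1 / 8 : ℝ) * (1 / 8 + 2) := by gcongr
      _ = 17 / 64 := by norm_num
  have hsum : ∑ j, (n j : ℂ) ^ 2 * stretchFactor σ τ x j ^ 2 - 1 =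
      ∑ j, (n j : ℂ) ^ 2 * (stretchFactor σ τ x j ^ 2 - 1) := by
    have : (1 : ℂ) = ∑ j, (n j : ℂ) ^ 2 := by exact_mod_cast hn.symm
    simp only [mul_sub, mul_one, Finset.sum_sub_distrib, ← this]
  rw [hsum]
  calc _ ≤ ∑ j, ‖(n j : ℂ) ^ 2 * (stretchFactor σ τ x j ^ 2 - 1)‖ := norm_sum_le _ _
    _ ≤ ∑ j, n j ^ 2 * (17 / 64) := by
      refine Finset.sum_le_sum fun j _ => ?_
      rw [norm_mul, norm_pow, Complex.norm_real, Real.norm_eq_abs, sq_abs]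
      exact mul_le_mul_of_nonneg_left (hs j) (sq_nonneg _)
    _ = 17 / 64 := by rw [← Finset.sum_mul, hn, one_mul]
    _ < 1 / 2 := by norm_num

theorem mem_slitPlane_of_norm_sub_one_lt {w : ℂ} (h : ‖w - 1‖ < 1 / 2) : w ∈ Complex.slitPlane := by
  left
  have h1 := (Complex.abs_re_le_norm (w - 1)).trans_lt h
  rw [Complex.sub_re, Complex.one_re, abs_lt] at h1
  linarith [h1.1]

/-- For real τ > 0 the factors s_j are positive, so the square of the conormal is a positive real
and no largeness is needed. -/
theorem admissible_of_pos (hσ_nonneg : ∀ j s, 0 ≤ σ j s) {τ : ℝ} (hτ : 0 < τ) :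
    Admissible σ τ where
  add_ne_zero := fun j t => by
    have : 0 < τ + σ j t := by linarith [hσ_nonneg j t]
    exact_mod_cast this.ne'
  mem_slitPlane := fun n x hn => by
    have h1 : ∑ j, (n j : ℂ) ^ 2 * stretchFactor σ τ x j ^ 2 =
        ((∑ j, n j ^ 2 * (τ / (τ + σ j (x j))) ^ 2 : ℝ) : ℂ) := by
      simp only [stretchFactor]
      push_cast
      rfl
    rw [h1, Complex.ofReal_mem_slitPlane]
    have hpos : ∀ j, 0 < (τ / (τ + σ j (x j))) ^ 2 := fun j =>
      pow_pos (div_pos hτ (by linarith [hσ_nonneg j (x j)])) 2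
    have hnn : ∀ j ∈ Finset.univ, 0 ≤ n j ^ 2 * (τ / (τ + σ j (x j))) ^ 2 := fun j _ =>
      mul_nonneg (sq_nonneg _) (hpos j).le
    refine (Finset.sum_nonneg hnn).lt_of_ne fun h0 => ?_
    have h2 := (Finset.sum_eq_zero_iff_of_nonneg hnn).1 h0.symm
    have h3 : ∑ j, n j ^ 2 = 0 := Finset.sum_eq_zero fun j hj =>
      (mul_eq_zero.1 (h2 j hj)).resolve_right (hpos j).ne'
    linarith

theorem re_cpow_half_pos {w : ℂ} (hw : w ∈ Complex.slitPlane) : 0 < (w ^ (1 / 2 : ℂ)).re := by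
  rw [one_div, Complex.cpow_inv_two_re]
  refine Real.sqrt_pos.2 (half_pos ?_)
  rcases hw with h | h
  · linarith [norm_nonneg w]
  · have h1 : |w.re| < ‖w‖ := Complex.abs_re_lt_norm.2 h
    linarith [neg_abs_le w.re]

theorem cpow_half_sq (w : ℂ) : (w ^ (1 / 2 : ℂ)) ^ 2 = w := by
  rw [← Complex.cpow_nat_mul]
  norm_num

/-- For c = √w one has (c - 1)(c + 1) = w - 1, and Re c > 0 gives |c + 1| ≥ 1. -/
theorem norm_cpow_half_sub_one_lt {w : ℂ} (h : ‖w - 1‖ < 1 / 2) : ‖w ^ (1 / 2 : ℂ) - 1‖ < 1 := by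
  set c := w ^ (1 / 2 : ℂ)
  have hre : 0 < c.re := re_cpow_half_pos (mem_slitPlane_of_norm_sub_one_lt h)
  have h1 : (c - 1) * (c + 1) = w - 1 := by linear_combination cpow_half_sq w
  have h2 : 1 ≤ ‖c + 1‖ := by
    refine le_trans ?_ (Complex.re_le_norm _)
    simp only [Complex.add_re, Complex.one_re]
    linarith
  calc ‖c - 1‖ ≤ ‖c - 1‖ * ‖c + 1‖ := le_mul_of_one_le_right (norm_nonneg _) h2
    _ = ‖w - 1‖ := by rw [← norm_mul, h1]
    _ < 1 := by linarith

/-! ### Spectral projections in terms of the complexified normal -/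

variable {Ω : Set E3} {τ : ℂ} {x : E3} {ρ : E3 → ℝ}

theorem nuTilde_eq (hτ : Admissible σ τ) (h : IsLocalDefiningFunction Ω x ρ)
    (hx : x ∈ frontier Ω) :
    nuTilde σ Ω τ x = conormalSq σ ρ τ x ^ (1 / 2 : ℂ) • extNormal σ ρ τ x := by
  funext j
  have h0 := Complex.slitPlane_ne_zero (conormalSq_mem_slitPlane hτ h.gradient_ne)
  rw [Pi.smul_apply, smul_eq_mul, extNormal, ← mul_assoc, ← Complex.cpow_add _ _ h0,
    add_neg_cancel, Complex.cpow_zero, one_mul, nuTilde, h.outwardNormal_eq hx]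

theorem sum_nuTilde_sq (h : IsLocalDefiningFunction Ω x ρ) (hx : x ∈ frontier Ω) :
    ∑ j, nuTilde σ Ω τ x j ^ 2 = (conormalSq σ ρ τ x ^ (1 / 2 : ℂ)) ^ 2 := by
  rw [cpow_half_sq, conormalSq, ← h.outwardNormal_eq hx]
  simp only [nuTilde, mul_pow]

theorem normalEnd_normalEnd (h : IsLocalDefiningFunction Ω x ρ) (hx : x ∈ frontier Ω)
    (v : Spinor) : normalEnd σ Ω τ x (normalEnd σ Ω τ x v) =
      (conormalSq σ ρ τ x ^ (1 / 2 : ℂ)) ^ 2 • v :=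
  toLin'_pauliSymbol_apply_apply (sum_nuTilde_sq h hx) v

theorem normalEnd_apply (hτ : Admissible σ τ) (h : IsLocalDefiningFunction Ω x ρ)
    (hx : x ∈ frontier Ω) (v : Spinor) : normalEnd σ Ω τ x v =
      conormalSq σ ρ τ x ^ (1 / 2 : ℂ) • (pauliSymbol (extNormal σ ρ τ x)).mulVec v := by
  rw [normalEnd, normalMatrix, nuTilde_eq hτ h hx, pauliSymbol_smul, Matrix.toLin'_apply,
    Matrix.smul_mulVec]

theorem cpow_half_ne_zero (hτ : Admissible σ τ) (h : IsLocalDefiningFunction Ω x ρ) :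
    conormalSq σ ρ τ x ^ (1 / 2 : ℂ) ≠ 0 := fun h0 => by
  have := re_cpow_half_pos (conormalSq_mem_slitPlane hτ h.gradient_ne)
  rw [h0, Complex.zero_re] at this
  exact lt_irrefl _ this

theorem posProj_normalEnd_apply (hτ : Admissible σ τ) (h : IsLocalDefiningFunction Ω x ρ)
    (hx : x ∈ frontier Ω) (v : Spinor) : posProj (normalEnd σ Ω τ x) v =
      (2⁻¹ : ℂ) • (1 + pauliSymbol (extNormal σ ρ τ x)).mulVec v := by
  rw [posProj_apply (normalEnd_normalEnd h hx)
    (re_cpow_half_pos (conormalSq_mem_slitPlane hτ h.gradient_ne))]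
  rw [normalEnd_apply hτ h hx, inv_smul_smul₀ (cpow_half_ne_zero hτ h), Matrix.add_mulVec,
    Matrix.one_mulVec]

theorem negProj_normalEnd_apply (hτ : Admissible σ τ) (h : IsLocalDefiningFunction Ω x ρ)
    (hx : x ∈ frontier Ω) (v : Spinor) : negProj (normalEnd σ Ω τ x) v =
      (2⁻¹ : ℂ) • (1 - pauliSymbol (extNormal σ ρ τ x)).mulVec v := by
  rw [negProj_apply (normalEnd_normalEnd h hx)
    (re_cpow_half_pos (conormalSq_mem_slitPlane hτ h.gradient_ne))]
  rw [normalEnd_apply hτ h hx, inv_smul_smul₀ (cpow_half_ne_zero hτ h), Matrix.sub_mulVec,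
    Matrix.one_mulVec]

/-- Since Re √w > 0, the eigenvalue √w of A(ν̃) corresponds to the eigenvalue 1 of A(n). The
boundary condition becomes an equation with smooth coefficients. -/
theorem mem_posSpace_normalEnd_iff (hτ : Admissible σ τ) (h : IsLocalDefiningFunction Ω x ρ)
    (hx : x ∈ frontier Ω) {v : Spinor} : v ∈ posSpace (normalEnd σ Ω τ x) ↔
      (pauliSymbol (extNormal σ ρ τ x)).mulVec v = v := by
  rw [mem_posSpace_iff (normalEnd_normalEnd h hx)
      (re_cpow_half_pos (conormalSq_mem_slitPlane hτ h.gradient_ne)), normalEnd_apply hτ h hx]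
  exact (smul_right_injective _ (cpow_half_ne_zero hτ h)).eq_iff

/-- The Pauli symbol as a continuous linear map. -/
def pauliCLM : (Fin 3 → ℂ) →L[ℂ] Spinor →L[ℂ] Spinor :=
  LinearMap.toContinuousLinearMap
    { toFun := fun ξ => LinearMap.toContinuousLinearMap (Matrix.toLin' (pauliSymbol ξ))
      map_add' := fun ξ η => by rw [pauliSymbol_add, map_add, map_add]
      map_smul' := fun c ξ => by rw [pauliSymbol_smul, map_smul, map_smul, RingHom.id_apply] }

theorem pauliCLM_apply (ξ : Fin 3 → ℂ) (v : Spinor) :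
    pauliCLM ξ v = (pauliSymbol ξ).mulVec v := rfl

theorem posProj_normalEnd_eq (hτ : Admissible σ τ) (h : IsLocalDefiningFunction Ω x ρ)
    (hx : x ∈ frontier Ω) : LinearMap.toContinuousLinearMap (posProj (normalEnd σ Ω τ x)) =
      (2⁻¹ : ℂ) • (1 + pauliCLM (extNormal σ ρ τ x)) := by
  refine ContinuousLinearMap.ext fun v => ?_
  change posProj (normalEnd σ Ω τ x) v = (2⁻¹ : ℂ) • (v + pauliCLM (extNormal σ ρ τ x) v)
  rw [posProj_normalEnd_apply hτ h hx, pauliCLM_apply, Matrix.add_mulVec, Matrix.one_mulVec]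

theorem negProj_normalEnd_eq (hτ : Admissible σ τ) (h : IsLocalDefiningFunction Ω x ρ)
    (hx : x ∈ frontier Ω) : LinearMap.toContinuousLinearMap (negProj (normalEnd σ Ω τ x)) =
      (2⁻¹ : ℂ) • (1 - pauliCLM (extNormal σ ρ τ x)) := by
  refine ContinuousLinearMap.ext fun v => ?_
  change negProj (normalEnd σ Ω τ x) v = (2⁻¹ : ℂ) • (v - pauliCLM (extNormal σ ρ τ x) v)
  rw [negProj_normalEnd_apply hτ h hx, pauliCLM_apply, Matrix.sub_mulVec, Matrix.one_mulVec]

theorem HolSmoothOn.clm_comp {E F G : Type*} [NormedAddCommGroup E] [NormedSpace ℝ E]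
    [NormedAddCommGroup F] [NormedSpace ℂ F] [NormedAddCommGroup G] [NormedSpace ℂ G]
    {D : Set ℂ} {U : Set E} {f : ℂ → E → F} (h : HolSmoothOn D U f) (L : F →L[ℂ] G) :
    HolSmoothOn D U (fun τ x => L (f τ x)) where
  smooth := (L.restrictScalars ℝ).contDiff.comp_contDiffOn h.smooth
  holo := fun x hx => L.differentiable.comp_differentiableOn (h.holo x hx)

theorem HolSmoothOn.const_add_smul {E F : Type*} [NormedAddCommGroup E] [NormedSpace ℝ E]
    [NormedAddCommGroup F] [NormedSpace ℂ F] {D : Set ℂ} {U : Set E} {f : ℂ → E → F}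
    (h : HolSmoothOn D U f) (a : F) (c : ℂ) : HolSmoothOn D U (fun τ x => a + c • f τ x) where
  smooth := contDiffOn_const.add (h.smooth.const_smul c)
  holo := fun x hx => ((h.holo x hx).const_smul c).const_add a

variable {D : Set ℂ}

/-- The open set of the points at which `ρ` is a local defining function of `Ω`. -/
theorem exists_isOpen_isLocalDefiningFunction (h : IsLocalDefiningFunction Ω x ρ) :
    ∃ U, IsOpen U ∧ x ∈ U ∧ ∀ y ∈ U, IsLocalDefiningFunction Ω y ρ := by
  obtain ⟨U, hU, hUo, hxU⟩ := eventually_nhds_iff.1 h.eventually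
  exact ⟨U, hUo, hxU, hU⟩

/-- Both projections and the normal itself are affine in the complexified normal, so one statement
covers the three cases. -/
theorem holomorphicIntoSmooth_of_extNormal (hσ : ∀ j, ContDiff ℝ ∞ (σ j)) (hΩ : IsSmoothDomain Ω)
    (hDo : IsOpen D) (hD : ∀ τ ∈ D, Admissible σ τ) {F : Type} [NormedAddCommGroup F]
    [NormedSpace ℂ F] [CompleteSpace F] {f : ℂ → E3 → F} (L : (Fin 3 → ℂ) →L[ℂ] F) (a : F) (c : ℂ)
    (hf : ∀ τ ∈ D, ∀ x ∈ frontier Ω, ∀ ρ, IsLocalDefiningFunction Ω x ρ →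
      f τ x = a + c • L (extNormal σ ρ τ x)) :
    HolomorphicIntoSmooth D (frontier Ω) f ∧
      ∀ x ∈ frontier Ω, AnalyticOnNhd ℂ (fun τ => f τ x) D := by
  have key : ∀ x ∈ frontier Ω, ∃ U, IsOpen U ∧ x ∈ U ∧ ∃ G : ℂ → E3 → F, HolSmoothOn D U G ∧
      ∀ τ ∈ D, ∀ y ∈ frontier Ω ∩ U, f τ y = G τ y := by
    intro x hx
    obtain ⟨ρ, hρ⟩ := hΩ.boundary x hx
    obtain ⟨U, hUo, hxU, hU⟩ := exists_isOpen_isLocalDefiningFunction hρ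
    exact ⟨U, hUo, hxU, _, ((holSmoothOn_extNormal hσ hD hρ.smooth
      fun y hy => (hU y hy).gradient_ne).clm_comp L).const_add_smul a c,
      fun τ hτ y hy => hf τ hτ y hy.1 ρ (hU y hy.2)⟩
  refine ⟨holomorphicIntoSmooth_of_local hDo key, fun x hx => ?_⟩
  obtain ⟨U, -, hxU, G, hG, hfG⟩ := key x hx
  exact ((hG.holo x hxU).congr fun τ hτ => hfG τ hτ x ⟨hx, hxU⟩).analyticOnNhd hDo

theorem holomorphic_posProj (hσ : ∀ j, ContDiff ℝ ∞ (σ j)) (hΩ : IsSmoothDomain Ω)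
    (hDo : IsOpen D) (hD : ∀ τ ∈ D, Admissible σ τ) :
    HolomorphicIntoSmooth D (frontier Ω)
      (fun τ x => LinearMap.toContinuousLinearMap (posProj (normalEnd σ Ω τ x))) ∧
    ∀ x ∈ frontier Ω, AnalyticOnNhd ℂ
      (fun τ => LinearMap.toContinuousLinearMap (posProj (normalEnd σ Ω τ x))) D := by
  refine holomorphicIntoSmooth_of_extNormal hσ hΩ hDo hD pauliCLM ((2⁻¹ : ℂ) • 1) 2⁻¹
    fun τ hτ x hx ρ hρ => ?_
  rw [posProj_normalEnd_eq (hD τ hτ) hρ hx, smul_add]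

theorem holomorphic_negProj (hσ : ∀ j, ContDiff ℝ ∞ (σ j)) (hΩ : IsSmoothDomain Ω)
    (hDo : IsOpen D) (hD : ∀ τ ∈ D, Admissible σ τ) :
    HolomorphicIntoSmooth D (frontier Ω)
      (fun τ x => LinearMap.toContinuousLinearMap (negProj (normalEnd σ Ω τ x))) ∧
    ∀ x ∈ frontier Ω, AnalyticOnNhd ℂ
      (fun τ => LinearMap.toContinuousLinearMap (negProj (normalEnd σ Ω τ x))) D := by
  refine holomorphicIntoSmooth_of_extNormal hσ hΩ hDo hD pauliCLM ((2⁻¹ : ℂ) • 1) (-2⁻¹)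
    fun τ hτ x hx ρ hρ => ?_
  rw [negProj_normalEnd_eq (hD τ hτ) hρ hx, smul_sub, neg_smul, sub_eq_add_neg]

end Spectrum

/-! ### Mean curvature -/

theorem inner_unitGradient_fderiv {ρ : E3 → ℝ} (hρ : ContDiff ℝ ∞ ρ) {x : E3}
    (hx : gradient ρ x ≠ 0) (v : E3) :
    inner ℝ (unitGradient ρ x) (fderiv ℝ (unitGradient ρ) x v) = 0 := by
  have hd := ((contDiffAt_unitGradient hρ hx).differentiableAt (by simp)).hasFDerivAt
  have h1 := hd.norm_sq
  have h2 : (fun y => ‖unitGradient ρ y‖ ^ 2) =ᶠ[𝓝 x] fun _ => (1 : ℝ) := by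
    filter_upwards [(contDiff_gradient hρ).continuous.continuousAt.eventually_ne hx] with y hy
    rw [norm_unitGradient hy, one_pow]
  have h3 := h1.unique ((hasFDerivAt_const (1 : ℝ) x).congr_of_eventuallyEq h2)
  have h4 := congrArg (fun L : E3 →L[ℝ] ℝ => L v) h3
  simpa using h4

/-- The mean curvature is half of the divergence of the normalized gradient of a defining
function. -/
theorem IsLocalDefiningFunction.meanCurvature_eq {Ω : Set E3} {p : E3} {ρ : E3 → ℝ}
    (h : IsLocalDefiningFunction Ω p ρ) (hp : p ∈ frontier Ω) :
    meanCurvature Ω p =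
      (1 / 2) * ∑ j, fderiv ℝ (unitGradient ρ) p (EuclideanSpace.single j 1) j := by
  set ν := unitGradient ρ p with hν
  set B := fderiv ℝ (unitGradient ρ) p with hB
  have hν1 : ‖ν‖ = 1 := norm_unitGradient h.gradient_ne
  have hd : HasFDerivAt (unitGradient ρ) B p :=
    ((contDiffAt_unitGradient h.smooth h.gradient_ne).differentiableAt (by simp)).hasFDerivAt
  have hw : HasFDerivWithinAt (outwardNormal Ω) B (frontier Ω) p := by
    refine (hd.hasFDerivWithinAt (s := frontier Ω)).congr_of_eventuallyEq ?_
      (h.outwardNormal_eq hp)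
    filter_upwards [self_mem_nhdsWithin, mem_nhdsWithin_of_mem_nhds h.eventually] with q hq hq'
    exact hq'.outwardNormal_eq hq
  -- A derivative within the boundary is unique on the tangent cone, which contains the tangent
  -- plane.
  have htan : ∀ v ∈ tangentPlane Ω p, fderivWithin ℝ (outwardNormal Ω) (frontier Ω) p v = B v := by
    intro v hv
    refine hw.differentiableWithinAt.hasFDerivWithinAt.unique_on hw ?_
    refine h.mem_tangentConeAt hp ?_
    rw [tangentPlane, Submodule.mem_orthogonal_singleton_iff_inner_right, h.outwardNormal_eq hp,
      unitGradient, inner_smul_left, inner_gradient_left] at hv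
    exact (mul_eq_zero.1 hv).resolve_left
      (by simpa using h.gradient_ne)
  have hproj : ∀ v : E3, (tangentPlane Ω p).starProjection v = v - inner ℝ ν v • ν := by
    intro v
    rw [tangentPlane, h.outwardNormal_eq hp, Submodule.starProjection_orthogonal_val,
      Submodule.starProjection_unit_singleton ℝ hν1]
  have hW : weingarten Ω p =
      ((tangentPlane Ω p).orthogonalProjectionOnto : E3 →ₗ[ℝ] tangentPlane Ω p) ∘ₗ
        ((B : E3 →ₗ[ℝ] E3) ∘ₗ (tangentPlane Ω p).subtype) := by
    refine LinearMap.ext fun v => ?_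
    change (tangentPlane Ω p).orthogonalProjectionOnto
      (fderivWithin ℝ (outwardNormal Ω) (frontier Ω) p v) = _
    rw [htan v v.2]
    rfl
  -- By cyclicity the trace over the tangent plane is that of B(1 - ν ⊗ ν) over the whole space,
  -- namely tr B - ν · B ν. The last term vanishes because |ν| = 1 near p.
  rw [meanCurvature, hW, LinearMap.trace_comp_comm',
    LinearMap.trace_eq_sum_inner _ (EuclideanSpace.basisFun (Fin 3) ℝ)]
  congr 1
  have hterm : ∀ j, inner ℝ (EuclideanSpace.basisFun (Fin 3) ℝ j)
      ((((B : E3 →ₗ[ℝ] E3) ∘ₗ (tangentPlane Ω p).subtype) ∘ₗ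
        ((tangentPlane Ω p).orthogonalProjectionOnto : E3 →ₗ[ℝ] tangentPlane Ω p))
          (EuclideanSpace.basisFun (Fin 3) ℝ j)) =
      B (EuclideanSpace.single j 1) j - ν j * B ν j := by
    intro j
    have h1 : (((B : E3 →ₗ[ℝ] E3) ∘ₗ (tangentPlane Ω p).subtype) ∘ₗ
        ((tangentPlane Ω p).orthogonalProjectionOnto : E3 →ₗ[ℝ] tangentPlane Ω p))
          (EuclideanSpace.basisFun (Fin 3) ℝ j) =
        B ((tangentPlane Ω p).starProjection (EuclideanSpace.single j 1)) := by
      rw [EuclideanSpace.basisFun_apply]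
      rfl
    rw [h1, hproj, EuclideanSpace.basisFun_apply, map_sub, map_smul,
      EuclideanSpace.inner_single_left, EuclideanSpace.inner_single_right]
    simp
  simp only [hterm]
  rw [Finset.sum_sub_distrib, sub_eq_self]
  have h2 := inner_unitGradient_fderiv h.smooth h.gradient_ne ν
  rw [← hν, ← hB, PiLp.inner_apply] at h2
  simpa [mul_comm] using h2

/-! ### Stretching -/

section Stretch

variable {σ : Fin 3 → ℝ → ℝ} {τ : ℝ}

theorem hasDerivAt_stretch_coord (hσ : ∀ j, ContDiff ℝ ∞ (σ j)) (τ : ℝ) (j : Fin 3) (t : ℝ) :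
    HasDerivAt (fun t => ∫ s in (0 : ℝ)..t, (τ + σ j s) / τ) ((τ + σ j t) / τ) t := by
  have hc : Continuous fun s => (τ + σ j s) / τ :=
    (continuous_const.add (hσ j).continuous).div_const τ
  exact intervalIntegral.integral_hasDerivAt_right (hc.intervalIntegrable _ _)
    (hc.stronglyMeasurableAtFilter _ _) hc.continuousAt

theorem one_le_stretch_rate (hσ_nonneg : ∀ j s, 0 ≤ σ j s) (hτ : 0 < τ) (j : Fin 3) (t : ℝ) :
    1 ≤ (τ + σ j t) / τ := by
  rw [one_le_div hτ]
  linarith [hσ_nonneg j t]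

theorem exists_stretch_coord_homeomorph (hσ : ∀ j, ContDiff ℝ ∞ (σ j))
    (hσ_nonneg : ∀ j s, 0 ≤ σ j s) (hτ : 0 < τ) (j : Fin 3) :
    ∃ e : ℝ ≃ₜ ℝ, (∀ t, e t = ∫ s in (0 : ℝ)..t, (τ + σ j s) / τ) ∧
      ContDiff ℝ ∞ e ∧ ContDiff ℝ ∞ e.symm := by
  set g : ℝ → ℝ := fun t => ∫ s in (0 : ℝ)..t, (τ + σ j s) / τ with hg
  have hd : ∀ t, HasDerivAt g ((τ + σ j t) / τ) t := hasDerivAt_stretch_coord hσ τ j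
  have hpos : ∀ t, 0 < (τ + σ j t) / τ := fun t =>
    one_pos.trans_le (one_le_stretch_rate hσ_nonneg hτ j t)
  have hmono : StrictMono g := strictMono_of_deriv_pos fun t => by rw [(hd t).deriv]; exact hpos t
  have hcont : Continuous g := continuous_iff_continuousAt.2 fun t => (hd t).continuousAt
  -- The rate is at least 1, so g outgrows the identity at both ends; this gives surjectivity.
  have hmono' : Monotone fun t => g t - t := by
    refine monotone_of_deriv_nonneg (fun t => ((hd t).sub (hasDerivAt_id t)).differentiableAt)
      fun t => ?_
    have := ((hd t).sub (hasDerivAt_id t)).deriv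
    have h2 : deriv (fun t => g t - t) t = (τ + σ j t) / τ - 1 := this
    rw [h2, sub_nonneg]
    exact one_le_stretch_rate hσ_nonneg hτ j t
  have h0 : g 0 = 0 := by simp [hg]
  have hsurj : Function.Surjective g := by
    refine hcont.surjective ?_ ?_
    · refine tendsto_atTop_mono' _ ?_ tendsto_id
      filter_upwards [eventually_ge_atTop 0] with t ht
      have := hmono' ht
      simp only [h0, id] at this ⊢
      linarith
    · refine tendsto_atBot_mono' _ ?_ tendsto_id
      filter_upwards [eventually_le_atBot 0] with t ht
      have := hmono' ht
      simp only [h0, id] at this ⊢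
      linarith
  set e : ℝ ≃ₜ ℝ := (hmono.orderIsoOfSurjective g hsurj).toHomeomorph
  have he : ∀ t, e t = g t := fun t => rfl
  have hsm : ContDiff ℝ ∞ g := by
    rw [contDiff_infty_iff_deriv]
    refine ⟨fun t => (hd t).differentiableAt, ?_⟩
    have : deriv g = fun t => (τ + σ j t) / τ := funext fun t => (hd t).deriv
    rw [this]
    exact (contDiff_const.add (hσ j)).div_const τ
  exact ⟨e, he, hsm, e.contDiff_symm_deriv (fun t => (hpos t).ne') hd hsm⟩

/-- The stretching is a diffeomorphism of the whole space. -/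
theorem exists_stretch_homeomorph (hσ : ∀ j, ContDiff ℝ ∞ (σ j))
    (hσ_nonneg : ∀ j s, 0 ≤ σ j s) (hτ : 0 < τ) :
    ∃ e : E3 ≃ₜ E3, (∀ x, e x = stretch σ τ x) ∧ ContDiff ℝ ∞ e ∧ ContDiff ℝ ∞ e.symm := by
  choose e he hsm hsm' using exists_stretch_coord_homeomorph hσ hσ_nonneg hτ
  have h1 : ContDiff ℝ ∞ fun x : E3 => (WithLp.toLp 2 fun j => e j (x j) : E3) :=
    contDiff_euclidean.2 fun j => (hsm j).comp (EuclideanSpace.proj (𝕜 := ℝ) j).contDiff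
  have h2 : ContDiff ℝ ∞ fun x : E3 => (WithLp.toLp 2 fun j => (e j).symm (x j) : E3) :=
    contDiff_euclidean.2 fun j => (hsm' j).comp (EuclideanSpace.proj (𝕜 := ℝ) j).contDiff
  refine ⟨{ toFun := fun x => WithLp.toLp 2 fun j => e j (x j)
            invFun := fun x => WithLp.toLp 2 fun j => (e j).symm (x j)
            left_inv := fun x => by ext j; simp
            right_inv := fun x => by ext j; simp
            continuous_toFun := h1.continuous
            continuous_invFun := h2.continuous }, fun x => ?_, h1, h2⟩
  ext j
  exact he j (x j)

/-- The Jacobian of the stretching is diagonal. For τ > 0 and σ non-negative, ∂̃_j is thus the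
derivative in the stretched coordinate. -/
theorem fderiv_comp_stretch {F : Type*} [NormedAddCommGroup F] [NormedSpace ℝ F]
    (hσ : ∀ j, ContDiff ℝ ∞ (σ j)) {f : E3 → F} {x : E3}
    (hf : DifferentiableAt ℝ f (stretch σ τ x)) (j : Fin 3) :
    fderiv ℝ (fun y => f (stretch σ τ y)) x (EuclideanSpace.single j 1) =
      ((τ + σ j (x j)) / τ) • fderiv ℝ f (stretch σ τ x) (EuclideanSpace.single j 1) := by
  have h1 : HasFDerivAt (stretch σ τ) ((PiLp.continuousLinearEquiv 2 ℝ fun _ : Fin 3 => ℝ).symm ∘L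
      ContinuousLinearMap.pi fun k => ((τ + σ k (x k)) / τ) •
        (EuclideanSpace.proj (𝕜 := ℝ) k : E3 →L[ℝ] ℝ)) x := by
    refine (PiLp.continuousLinearEquiv 2 ℝ fun _ : Fin 3 => ℝ).symm.hasFDerivAt.comp x ?_
    refine hasFDerivAt_pi.2 fun k => ?_
    exact (hasDerivAt_stretch_coord hσ τ k (x k)).comp_hasFDerivAt x
      (EuclideanSpace.proj (𝕜 := ℝ) k : E3 →L[ℝ] ℝ).hasFDerivAt
  have h2 := (hf.hasFDerivAt.comp x h1).fderiv
  change fderiv ℝ (f ∘ stretch σ τ) x _ = _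
  rw [h2, ContinuousLinearMap.comp_apply, ← map_smul]
  congr 1
  ext k
  by_cases hk : k = j
  · subst hk; simp
  · simp [hk]

variable {Ω : Set E3} {x : E3} {ρ : E3 → ℝ}

theorem sqrt_inv_eq_cpow {w : ℝ} (hw : 0 < w) : (((√w)⁻¹ : ℝ) : ℂ) = (w : ℂ) ^ (-(1 / 2) : ℂ) := by
  rw [Real.sqrt_eq_rpow, ← Real.rpow_neg hw.le, Complex.ofReal_cpow hw.le]
  norm_num

/-- The data of the stretched domain at the image of a boundary point. -/
theorem exists_stretched_definingFunction (hσ : ∀ j, ContDiff ℝ ∞ (σ j))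
    (hσ_nonneg : ∀ j s, 0 ≤ σ j s) (hτ : 0 < τ) (h : IsLocalDefiningFunction Ω x ρ)
    (hx : x ∈ frontier Ω) :
    ∃ ρ', IsLocalDefiningFunction (stretchedDomain σ τ Ω) (stretch σ τ x) ρ' ∧
      stretch σ τ x ∈ frontier (stretchedDomain σ τ Ω) ∧
      ∀ᶠ y in 𝓝 x, ∀ j, (unitGradient ρ' (stretch σ τ y) j : ℂ) = extNormal σ ρ τ y j := by
  obtain ⟨e, he, hsm, hsm'⟩ := exists_stretch_homeomorph hσ hσ_nonneg hτ
  have hefun : (e : E3 → E3) = stretch σ τ := funext he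
  have hadm := admissible_of_pos hσ_nonneg hτ
  -- The gradient of ρ' at X(y) has the components s_j ∂_jρ(y) and the length |∇ρ(y)| √w. The
  -- resulting formula for the normal holds for all y near x, so it can be differentiated to obtain
  -- the curvature.
  set ρ' : E3 → ℝ := fun y => ρ (e.symm y) with hρ'
  have hρ'sm : ContDiff ℝ ∞ ρ' := h.smooth.comp hsm'
  have hρρ' : (fun y => ρ' (stretch σ τ y)) = ρ := by
    funext y
    simp only [hρ', ← he, e.symm_apply_apply]
  have hpos : ∀ j (y : E3), 0 < τ / (τ + σ j (y j)) := fun j y =>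
    div_pos hτ (by linarith [hσ_nonneg j (y j)])
  have hpd : ∀ y j, partialDeriv j ρ' (stretch σ τ y) =
      τ / (τ + σ j (y j)) * partialDeriv j ρ y := by
    intro y j
    have h1 := fderiv_comp_stretch hσ (hρ'sm.differentiable (by simp) (stretch σ τ y)) j
    rw [hρρ', smul_eq_mul] at h1
    have h2 : τ + σ j (y j) ≠ 0 := by linarith [hσ_nonneg j (y j)]
    rw [partialDeriv, partialDeriv, h1]
    field_simp
  have hunit : ∀ y, gradient ρ y ≠ 0 → gradient ρ' (stretch σ τ y) ≠ 0 ∧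
      ∀ j, (unitGradient ρ' (stretch σ τ y) j : ℂ) = extNormal σ ρ τ y j := by
    intro y hy
    set w : ℝ := ∑ j, unitGradient ρ y j ^ 2 * (τ / (τ + σ j (y j))) ^ 2 with hw
    have hwc : conormalSq σ ρ τ y = (w : ℂ) := by
      simp only [conormalSq, stretchFactor, hw]
      push_cast
      rfl
    have hwpos : 0 < w := by
      have := conormalSq_mem_slitPlane hadm hy
      rwa [hwc, Complex.ofReal_mem_slitPlane] at this
    have hg : 0 < ‖gradient ρ y‖ := norm_pos_iff.2 hy
    have hnorm : ‖gradient ρ' (stretch σ τ y)‖ = ‖gradient ρ y‖ * √w := by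
      rw [EuclideanSpace.norm_eq]
      have : ∑ j, ‖gradient ρ' (stretch σ τ y) j‖ ^ 2 = ‖gradient ρ y‖ ^ 2 * w := by
        rw [hw, Finset.mul_sum]
        refine Finset.sum_congr rfl fun j _ => ?_
        rw [Real.norm_eq_abs, sq_abs, gradient_apply, hpd, unitGradient, PiLp.smul_apply,
          gradient_apply, smul_eq_mul]
        field_simp
      rw [this, Real.sqrt_mul (sq_nonneg _), Real.sqrt_sq hg.le]
    have hg' : 0 < ‖gradient ρ' (stretch σ τ y)‖ := by
      rw [hnorm]
      exact mul_pos hg (Real.sqrt_pos.2 hwpos)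
    refine ⟨norm_pos_iff.1 hg', fun j => ?_⟩
    rw [extNormal, hwc, ← sqrt_inv_eq_cpow hwpos, unitGradient, unitGradient, hnorm,
      PiLp.smul_apply, PiLp.smul_apply, gradient_apply, gradient_apply, hpd, stretchFactor]
    push_cast
    simp only [smul_eq_mul]
    push_cast
    ring
  have hdom : stretchedDomain σ τ Ω = e '' Ω := by rw [stretchedDomain, hefun]
  refine ⟨ρ', ⟨hρ'sm, (hunit x h.gradient_ne).1, ?_⟩, ?_, ?_⟩
  · rw [hdom, ← he]
    have h1 : Tendsto e.symm (𝓝 (e x)) (𝓝 x) := by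
      simpa using e.symm.continuous.tendsto (e x)
    filter_upwards [h1.eventually h.locally_eq] with q hq
    rw [← hq]
    constructor
    · rintro ⟨y, hy, rfl⟩
      simpa using hy
    · exact fun hq' => ⟨e.symm q, hq', e.apply_symm_apply q⟩
  · rw [hdom, ← he, ← e.image_frontier]
    exact mem_image_of_mem e hx
  · filter_upwards [(contDiff_gradient h.smooth).continuous.continuousAt.eventually_ne
      h.gradient_ne] with y hy
    exact (hunit y hy).2

theorem outwardNormal_stretchedDomain (hσ : ∀ j, ContDiff ℝ ∞ (σ j))
    (hσ_nonneg : ∀ j s, 0 ≤ σ j s) (hτ : 0 < τ) (h : IsLocalDefiningFunction Ω x ρ)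
    (hx : x ∈ frontier Ω) (j : Fin 3) :
    (outwardNormal (stretchedDomain σ τ Ω) (stretch σ τ x) j : ℂ) = extNormal σ ρ τ x j := by
  obtain ⟨ρ', h', hx', heq⟩ := exists_stretched_definingFunction hσ hσ_nonneg hτ h hx
  rw [h'.outwardNormal_eq hx', heq.self_of_nhds]

/-- The factors s_j in the complexified curvature cancel those of the chain rule, leaving half of
the Euclidean divergence of the unit normal in the stretched space. -/
theorem meanCurvature_stretchedDomain (hσ : ∀ j, ContDiff ℝ ∞ (σ j))
    (hσ_nonneg : ∀ j s, 0 ≤ σ j s) (hτ : 0 < τ) (h : IsLocalDefiningFunction Ω x ρ)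
    (hx : x ∈ frontier Ω) :
    (meanCurvature (stretchedDomain σ τ Ω) (stretch σ τ x) : ℂ) = extCurvature σ ρ τ x := by
  obtain ⟨ρ', h', hx', heq⟩ := exists_stretched_definingFunction hσ hσ_nonneg hτ h hx
  rw [h'.meanCurvature_eq hx', extCurvature]
  push_cast
  congr 1
  refine Finset.sum_congr rfl fun j _ => ?_
  have hd : DifferentiableAt ℝ (unitGradient ρ') (stretch σ τ x) :=
    (contDiffAt_unitGradient h'.smooth h'.gradient_ne).differentiableAt (by simp)
  have hstr : DifferentiableAt ℝ (stretch σ τ) x := by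
    obtain ⟨e, he, hsm, -⟩ := exists_stretch_homeomorph hσ hσ_nonneg hτ
    rw [← funext he]
    exact hsm.differentiable (by simp) x
  have hadm := admissible_of_pos hσ_nonneg hτ
  have hdN := ((contDiffAt_extNormal_right hσ hadm h.smooth h.gradient_ne).differentiableAt
    (by simp)).hasFDerivAt
  have h1 : HasFDerivAt (fun y => ((unitGradient ρ' (stretch σ τ y) j : ℝ) : ℂ))
      (Complex.ofRealCLM ∘L (EuclideanSpace.proj (𝕜 := ℝ) j : E3 →L[ℝ] ℝ) ∘L
        fderiv ℝ (fun y => unitGradient ρ' (stretch σ τ y)) x) x :=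
    Complex.ofRealCLM.hasFDerivAt.comp x
      ((EuclideanSpace.proj (𝕜 := ℝ) j : E3 →L[ℝ] ℝ).hasFDerivAt.comp x
        (hd.comp x hstr).hasFDerivAt)
  have h2 := h1.unique (((hasFDerivAt_pi'.1 hdN) j).congr_of_eventuallyEq
    (heq.mono fun y hy => hy j))
  have h3 := congrArg (fun L : E3 →L[ℝ] ℂ => L (EuclideanSpace.single j 1)) h2
  have h4 : extNormalDeriv σ ρ τ x j j = ((fderiv ℝ (fun y => unitGradient ρ' (stretch σ τ y)) x
      (EuclideanSpace.single j 1) j : ℝ) : ℂ) := h3.symm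
  rw [h4, fderiv_comp_stretch hσ hd, PiLp.smul_apply, smul_eq_mul, stretchFactor]
  have h5 : (τ : ℂ) + (σ j (x j) : ℂ) ≠ 0 := hadm.add_ne_zero j _
  have h6 : (τ : ℂ) ≠ 0 := by exact_mod_cast hτ.ne'
  push_cast
  field_simp

end Stretch

/-! ### Traces -/

section Traces

variable {Ω : Set E3}

theorem ae_mem_frontier (Ω : Set E3) : ∀ᵐ x ∂(surfaceMeasure Ω), x ∈ frontier Ω :=
  ae_restrict_mem isClosed_frontier.measurableSet

theorem aestronglyMeasurable_outwardNormal (hΩ : IsSmoothDomain Ω) (k : Fin 3) :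
    AEStronglyMeasurable (fun x => outwardNormal Ω x k) (surfaceMeasure Ω) := by
  have h : ContinuousOn (fun x => outwardNormal Ω x k) (frontier Ω) :=
    (EuclideanSpace.proj (𝕜 := ℝ) k : E3 →L[ℝ] ℝ).continuous.comp_continuousOn
      hΩ.continuousOn_outwardNormal
  exact h.aestronglyMeasurable isClosed_frontier.measurableSet

theorem ae_norm_outwardNormal_le (hΩ : IsSmoothDomain Ω) (k : Fin 3) :
    ∀ᵐ x ∂(surfaceMeasure Ω), ‖outwardNormal Ω x k‖ ≤ 1 := by
  filter_upwards [ae_mem_frontier Ω] with x hx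
  rw [← hΩ.norm_outwardNormal hx]
  exact PiLp.norm_apply_le _ k

theorem HasTrace.integrable (hΩ : IsSmoothDomain Ω) {w : L2 Ω} {dw : Fin 3 → L2 Ω}
    {g : E3 → Spinor} (h : HasTrace Ω w dw g) : Integrable g (surfaceMeasure Ω) :=
  have := hΩ.isFiniteMeasure
  h.1.integrable (by norm_num)

theorem integrable_normal_smul (hΩ : IsSmoothDomain Ω) (k : Fin 3) {g : E3 → Spinor}
    (hg : Integrable g (surfaceMeasure Ω)) :
    Integrable (fun x => outwardNormal Ω x k • g x) (surfaceMeasure Ω) :=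
  hg.bdd_smul 1 (aestronglyMeasurable_outwardNormal hΩ k) (ae_norm_outwardNormal_le hΩ k)

theorem integrable_testFunction_smul {μ : Measure E3} {φ : E3 → ℝ} (hφ : Continuous φ)
    (hc : HasCompactSupport φ) {g : E3 → Spinor} (hg : Integrable g μ) :
    Integrable (fun x => φ x • g x) μ := by
  obtain ⟨C, hC⟩ := hc.exists_bound_of_continuous hφ
  exact hg.bdd_smul C hφ.aestronglyMeasurable (Eventually.of_forall hC)

theorem integrable_testMap_apply {μ : Measure E3} {Ψ : E3 → Spinor →L[ℂ] Spinor}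
    (hΨ : Continuous Ψ) (hc : HasCompactSupport Ψ) {g : E3 → Spinor} (hg : Integrable g μ) :
    Integrable (fun x => Ψ x (g x)) μ := by
  obtain ⟨C, hC⟩ := hc.exists_bound_of_continuous hΨ
  refine (hg.norm.const_mul C).mono' ?_ (Eventually.of_forall fun x => ?_)
  · exact (ContinuousLinearMap.apply ℂ Spinor).flip.aestronglyMeasurable_comp₂
      hΨ.aestronglyMeasurable hg.aestronglyMeasurable
  · exact (Ψ x).le_of_opNorm_le (hC x) _

/-- Paired with a test function φ, each side is the pairing of u with a mixed second derivative of
φ, and these commute. -/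
theorem sobDD_comm (hΩ : IsOpen Ω) (u : H2 Ω) (j k : Fin 3) :
    sobDD u j k =ᵐ[volume.restrict Ω] sobDD u k j := by
  have hweak : ∀ i l, ∀ φ : E3 → ℝ, ContDiff ℝ ∞ φ → HasCompactSupport φ → tsupport φ ⊆ Ω →
      ∫ x in Ω, φ x • sobDD u i l x = ∫ x in Ω, partialDeriv i (partialDeriv l φ) x • sobVal u x := by
    intro i l φ hφ hc hs
    have h1 := u.2.2 i l φ hφ hc hs
    have h2 := u.2.1 i (partialDeriv l φ) (contDiff_partialDeriv hφ l)
      (hasCompactSupport_partialDeriv hc l) ((tsupport_fderiv_apply_subset ℝ _).trans hs)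
    change ∫ x in Ω, partialDeriv l φ x • sobD u i x = -∫ x in Ω, φ x • sobDD u i l x at h1
    change ∫ x in Ω, partialDeriv i (partialDeriv l φ) x • sobVal u x =
      -∫ x in Ω, partialDeriv l φ x • sobD u i x at h2
    rw [h2, h1, neg_neg]
  have hloc : ∀ i l, LocallyIntegrable (sobDD u i l) (volume.restrict Ω) := fun i l =>
    (Lp.memLp (sobDD u i l)).locallyIntegrable (by norm_num)
  have h := hΩ.ae_eq_zero_of_integral_contDiff_smul_eq_zero (μ := volume.restrict Ω)
    (((hloc j k).sub (hloc k j)).locallyIntegrableOn Ω) (fun φ hφ hc hs => by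
      simp only [Pi.sub_apply, smul_sub]
      rw [integral_sub (integrable_smul_L2 _ hφ.continuous hc)
        (integrable_smul_L2 _ hφ.continuous hc), hweak j k φ hφ hc hs, hweak k j φ hφ hc hs,
        sub_eq_zero]
      simp only [partialDeriv_partialDeriv_comm hφ j k])
  filter_upwards [h, ae_restrict_mem hΩ.measurableSet] with x h1 h2
  exact sub_eq_zero.1 (h1 h2)

variable {u : H2 Ω} {g : E3 → Spinor} {dg : Fin 3 → E3 → Spinor}

/-- Integration by parts along the boundary. -/
theorem integral_tangential (hΩ : IsSmoothDomain Ω)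
    (hg : HasTrace Ω (sobVal u) (sobD u) g) (hdg : ∀ j, HasTrace Ω (sobD u j) (sobDD u j) (dg j))
    {φ : E3 → ℝ} (hφ : ContDiff ℝ ∞ φ) (hc : HasCompactSupport φ) (j k : Fin 3) :
    ∫ x, φ x • (outwardNormal Ω x k • dg j x - outwardNormal Ω x j • dg k x) ∂(surfaceMeasure Ω) =
      ∫ x, (partialDeriv k φ x • outwardNormal Ω x j • g x -
        partialDeriv j φ x • outwardNormal Ω x k • g x) ∂(surfaceMeasure Ω) := by
  -- Gauss' formula is used for ∂_j u and ∂_k u against φ, and for u against ∂_kφ and ∂_jφ. The two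
  -- differences of volume integrals coincide since second derivatives of u and of φ commute.
  have hA := (hdg j).2 φ hφ hc k
  have hB := (hdg k).2 φ hφ hc j
  have hC := hg.2 _ (contDiff_partialDeriv hφ k) (hasCompactSupport_partialDeriv hc k) j
  have hD := hg.2 _ (contDiff_partialDeriv hφ j) (hasCompactSupport_partialDeriv hc j) k
  simp only [mul_smul] at hA hB hC hD
  have i1 : ∀ i (v : L2 Ω), Integrable (fun x => partialDeriv i φ x • v x) (volume.restrict Ω) :=
    fun i v => integrable_smul_L2 v (continuous_partialDeriv hφ i)
      (hasCompactSupport_partialDeriv hc i)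
  have i2 : ∀ i l (v : L2 Ω), Integrable (fun x => partialDeriv i (partialDeriv l φ) x • v x)
      (volume.restrict Ω) :=
    fun i l v => integrable_smul_L2 v (continuous_partialDeriv (contDiff_partialDeriv hφ l) i)
      (hasCompactSupport_partialDeriv (hasCompactSupport_partialDeriv hc l) i)
  have i0 : ∀ v : L2 Ω, Integrable (fun x => φ x • v x) (volume.restrict Ω) :=
    fun v => integrable_smul_L2 v hφ.continuous hc
  have hn : ∀ i {f : E3 → Spinor}, Integrable f (surfaceMeasure Ω) →
      Integrable (fun x => outwardNormal Ω x i • f x) (surfaceMeasure Ω) :=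
    fun i f hf => integrable_normal_smul hΩ i hf
  simp only [smul_sub]
  rw [integral_sub (integrable_testFunction_smul hφ.continuous hc (hn k ((hdg j).integrable hΩ)))
    (integrable_testFunction_smul hφ.continuous hc (hn j ((hdg k).integrable hΩ))),
    integral_sub (integrable_testFunction_smul (continuous_partialDeriv hφ k)
      (hasCompactSupport_partialDeriv hc k) (hn j (hg.integrable hΩ)))
    (integrable_testFunction_smul (continuous_partialDeriv hφ j)
      (hasCompactSupport_partialDeriv hc j) (hn k (hg.integrable hΩ))), ← hA, ← hB, ← hC, ← hD,
    ← integral_sub ((i1 k _).fun_add (i0 _)) ((i1 j _).fun_add (i0 _)),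
    ← integral_sub ((i2 j k _).fun_add (i1 k _)) ((i2 k j _).fun_add (i1 j _))]
  refine integral_congr_ae ?_
  filter_upwards [sobDD_comm hΩ.isOpen u j k] with x hx
  rw [hx, partialDeriv_partialDeriv_comm hφ j k]
  abel

/-- Integration by parts along the boundary, for test functions with values in the endomorphisms
of the spinor space. -/
theorem integral_tangential_clm (hΩ : IsSmoothDomain Ω)
    (hg : HasTrace Ω (sobVal u) (sobD u) g) (hdg : ∀ j, HasTrace Ω (sobD u j) (sobDD u j) (dg j))
    {Ψ : E3 → Spinor →L[ℂ] Spinor} (hΨ : ContDiff ℝ ∞ Ψ) (hc : HasCompactSupport Ψ) (j k : Fin 3) :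
    ∫ x, Ψ x (outwardNormal Ω x k • dg j x - outwardNormal Ω x j • dg k x) ∂(surfaceMeasure Ω) =
      ∫ x, (fderiv ℝ Ψ x (EuclideanSpace.single k 1) (outwardNormal Ω x j • g x) -
        fderiv ℝ Ψ x (EuclideanSpace.single j 1) (outwardNormal Ω x k • g x))
          ∂(surfaceMeasure Ω) := by
  have hfin : FiniteDimensional ℝ (Spinor →L[ℂ] Spinor) :=
    FiniteDimensional.complexToReal (Spinor →L[ℂ] Spinor)
  -- The coordinates of Ψ in a real basis are real test functions, and the basis operators are
  -- constant and commute with the integral.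
  set b := Module.finBasis ℝ (Spinor →L[ℂ] Spinor)
  set c : ∀ i, (Spinor →L[ℂ] Spinor) →L[ℝ] ℝ := fun i =>
    LinearMap.toContinuousLinearMap (b.coord i) with hcdef
  have hexp : ∀ (T : Spinor →L[ℂ] Spinor) (v : Spinor), T v = ∑ i, b i (c i T • v) := by
    intro T v
    conv_lhs => rw [← b.sum_repr T]
    rw [_root_.sum_apply]
    exact Finset.sum_congr rfl fun i _ => ((b i).map_smul_of_tower (b.repr T i) v).symm
  have hψ : ∀ i, ContDiff ℝ ∞ (fun x => c i (Ψ x)) := fun i => (c i).contDiff.comp hΨ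
  have hψc : ∀ i, HasCompactSupport (fun x => c i (Ψ x)) := fun i =>
    hc.comp_left (map_zero (c i))
  have hpd : ∀ i l x, partialDeriv l (fun x => c i (Ψ x)) x =
      c i (fderiv ℝ Ψ x (EuclideanSpace.single l 1)) := by
    intro i l x
    change fderiv ℝ (c i ∘ Ψ) x _ = _
    rw [((c i).hasFDerivAt.comp x
      (hΨ.differentiable (by simp) x).hasFDerivAt).fderiv]
    rfl
  have hn : ∀ i {f : E3 → Spinor}, Integrable f (surfaceMeasure Ω) →
      Integrable (fun x => outwardNormal Ω x i • f x) (surfaceMeasure Ω) :=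
    fun i f hf => integrable_normal_smul hΩ i hf
  have hI1 : Integrable (fun x => outwardNormal Ω x k • dg j x - outwardNormal Ω x j • dg k x)
      (surfaceMeasure Ω) :=
    (hn k ((hdg j).integrable hΩ)).sub (hn j ((hdg k).integrable hΩ))
  have e1 : ∫ x, Ψ x (outwardNormal Ω x k • dg j x - outwardNormal Ω x j • dg k x)
      ∂(surfaceMeasure Ω) = ∑ i, b i (∫ x, c i (Ψ x) • (outwardNormal Ω x k • dg j x -
        outwardNormal Ω x j • dg k x) ∂(surfaceMeasure Ω)) := by
    simp only [hexp (Ψ _) _]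
    rw [integral_finsetSum _ fun i _ => (b i).integrable_comp
      (integrable_testFunction_smul (hψ i).continuous (hψc i) hI1)]
    exact Finset.sum_congr rfl fun i _ => (b i).integral_comp_comm
      (integrable_testFunction_smul (hψ i).continuous (hψc i) hI1)
  have hI2 : ∀ i, Integrable (fun x =>
      partialDeriv k (fun x => c i (Ψ x)) x • outwardNormal Ω x j • g x -
      partialDeriv j (fun x => c i (Ψ x)) x • outwardNormal Ω x k • g x) (surfaceMeasure Ω) :=
    fun i => (integrable_testFunction_smul (continuous_partialDeriv (hψ i) k)
      (hasCompactSupport_partialDeriv (hψc i) k) (hn j (hg.integrable hΩ))).sub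
      (integrable_testFunction_smul (continuous_partialDeriv (hψ i) j)
      (hasCompactSupport_partialDeriv (hψc i) j) (hn k (hg.integrable hΩ)))
  rw [e1]
  simp only [integral_tangential hΩ hg hdg (hψ _) (hψc _) j k]
  rw [← Finset.sum_congr rfl fun i _ => (b i).integral_comp_comm (hI2 i),
    ← integral_finsetSum _ fun i _ => (b i).integrable_comp (hI2 i)]
  refine integral_congr_ae (Eventually.of_forall fun x => ?_)
  simp only [hpd, map_sub, Finset.sum_sub_distrib, ← hexp]

theorem contDiff_smul_testMap {φ : E3 → ℝ} {Ψ : E3 → Spinor →L[ℂ] Spinor} (hφ : ContDiff ℝ ∞ φ)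
    (hΨ : ContDiff ℝ ∞ Ψ) : ContDiff ℝ ∞ (fun x => φ x • Ψ x) :=
  hφ.smul hΨ

theorem hasCompactSupport_smul_testMap {φ : E3 → ℝ} (Ψ : E3 → Spinor →L[ℂ] Spinor)
    (hφ : HasCompactSupport φ) : HasCompactSupport (fun x => φ x • Ψ x) := by
  refine hφ.mono' fun x hx => subset_tsupport φ fun h0 => hx ?_
  simp only [h0]
  exact zero_smul ℝ (Ψ x)

theorem fderiv_smul_testMap_apply {φ : E3 → ℝ} {Ψ : E3 → Spinor →L[ℂ] Spinor}
    (hφ : ContDiff ℝ ∞ φ) (hΨ : ContDiff ℝ ∞ Ψ) (x : E3) (l : Fin 3) (v : Spinor) :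
    fderiv ℝ (fun x => φ x • Ψ x) x (EuclideanSpace.single l 1) v =
      φ x • fderiv ℝ Ψ x (EuclideanSpace.single l 1) v + partialDeriv l φ x • Ψ x v := by
  rw [fderiv_fun_smul (hφ.differentiable (by simp) x) (hΨ.differentiable (by simp) x)]
  rfl

/-- If a smooth family of endomorphisms annihilates the trace of `u`, the product rule holds for
the tangential derivatives. -/
theorem tangential_product_rule (hΩ : IsSmoothDomain Ω)
    (hg : HasTrace Ω (sobVal u) (sobD u) g) (hdg : ∀ j, HasTrace Ω (sobD u j) (sobDD u j) (dg j))
    {Ψ : E3 → Spinor →L[ℂ] Spinor} (hΨ : ContDiff ℝ ∞ Ψ) (hc : HasCompactSupport Ψ)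
    (hΨg : ∀ᵐ x ∂(surfaceMeasure Ω), Ψ x (g x) = 0) (j k : Fin 3) :
    ∀ᵐ x ∂(surfaceMeasure Ω),
      Ψ x (outwardNormal Ω x k • dg j x - outwardNormal Ω x j • dg k x) =
        fderiv ℝ Ψ x (EuclideanSpace.single k 1) (outwardNormal Ω x j • g x) -
        fderiv ℝ Ψ x (EuclideanSpace.single j 1) (outwardNormal Ω x k • g x) := by
  have := hΩ.isFiniteMeasure
  have hn : ∀ i {f : E3 → Spinor}, Integrable f (surfaceMeasure Ω) →
      Integrable (fun x => outwardNormal Ω x i • f x) (surfaceMeasure Ω) :=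
    fun i f hf => integrable_normal_smul hΩ i hf
  have hdΨ : ∀ l, Continuous fun x => fderiv ℝ Ψ x (EuclideanSpace.single l 1) := fun l =>
    (hΨ.continuous_fderiv (by simp)).clm_apply continuous_const
  have hdΨc : ∀ l, HasCompactSupport fun x => fderiv ℝ Ψ x (EuclideanSpace.single l 1) := fun l =>
    hc.fderiv_apply ℝ _
  have hI1 : Integrable (fun x => outwardNormal Ω x k • dg j x - outwardNormal Ω x j • dg k x)
      (surfaceMeasure Ω) :=
    (hn k ((hdg j).integrable hΩ)).sub (hn j ((hdg k).integrable hΩ))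
  have I1 := integrable_testMap_apply hΨ.continuous hc hI1
  have I2 : Integrable (fun x =>
      fderiv ℝ Ψ x (EuclideanSpace.single k 1) (outwardNormal Ω x j • g x) -
        fderiv ℝ Ψ x (EuclideanSpace.single j 1) (outwardNormal Ω x k • g x))
      (surfaceMeasure Ω) := (integrable_testMap_apply (hdΨ k) (hdΨc k) (hn j (hg.integrable hΩ))).sub
    (integrable_testMap_apply (hdΨ j) (hdΨc j) (hn k (hg.integrable hΩ)))
  -- Testing with φ means replacing Ψ by φ Ψ. The additional terms contain ∂φ times Ψ applied to
  -- multiples of g, which is zero.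
  refine ae_eq_of_integral_contDiff_smul_eq I1.locallyIntegrable I2.locallyIntegrable
    fun φ hφ hφc => ?_
  have h1 := integral_tangential_clm hΩ hg hdg (contDiff_smul_testMap hφ hΨ)
    (hasCompactSupport_smul_testMap Ψ hφc) j k
  refine h1.trans (integral_congr_ae ?_)
  filter_upwards [hΨg] with x hx
  have h3 : ∀ l, Ψ x (outwardNormal Ω x l • g x) = 0 := fun l => by
    rw [ContinuousLinearMap.map_smul_of_tower, hx, smul_zero]
  have h4 : ∀ l i, (fderiv ℝ (fun x => φ x • Ψ x) x (EuclideanSpace.single l 1))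
      (outwardNormal Ω x i • g x) =
      φ x • fderiv ℝ Ψ x (EuclideanSpace.single l 1) (outwardNormal Ω x i • g x) := by
    intro l i
    rw [fderiv_smul_testMap_apply hφ hΨ, h3, smul_zero, add_zero]
  rw [h4, h4, smul_sub]

/-- Gauss' formula determines every ν_k g almost everywhere, and g = Σ ν_k (ν_k g). -/
theorem HasTrace.ae_unique (hΩ : IsSmoothDomain Ω) {w : L2 Ω} {dw : Fin 3 → L2 Ω}
    {g g' : E3 → Spinor} (h : HasTrace Ω w dw g) (h' : HasTrace Ω w dw g') :
    g =ᵐ[surfaceMeasure Ω] g' := by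
  have := hΩ.isFiniteMeasure
  have hk : ∀ k, ∀ᵐ x ∂(surfaceMeasure Ω), outwardNormal Ω x k • g x = outwardNormal Ω x k • g' x := by
    intro k
    have I := integrable_normal_smul hΩ k (h.integrable hΩ)
    have I' := integrable_normal_smul hΩ k (h'.integrable hΩ)
    refine ae_eq_of_integral_contDiff_smul_eq I.locallyIntegrable I'.locallyIntegrable
      fun φ hφ hc => ?_
    simp only [← mul_smul]
    rw [← h.2 φ hφ hc k, ← h'.2 φ hφ hc k]
  filter_upwards [hk 0, hk 1, hk 2, ae_mem_frontier Ω] with x h0 h1 h2 hx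
  have hs : ∀ v : Spinor, ∑ k, outwardNormal Ω x k • outwardNormal Ω x k • v = v := fun v => by
    simp only [smul_smul, ← sq]
    rw [← Finset.sum_smul, hΩ.sum_outwardNormal_sq hx, one_smul]
  rw [← hs (g x), ← hs (g' x)]
  simp only [Fin.sum_univ_three, h0, h1, h2]

end Traces

/-! ### The transverse identity -/

section Transverse

variable {σ : Fin 3 → ℝ → ℝ} {Ω : Set E3} {τ : ℂ}

theorem transverse_pointwise (hσ : ∀ j, ContDiff ℝ ∞ (σ j)) (hτ : Admissible σ τ) {x : E3}
    {ρ : E3 → ℝ} (h : IsLocalDefiningFunction Ω x ρ) (hx : x ∈ frontier Ω) {g : Spinor}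
    {d : Fin 3 → Spinor} (hg : (pauliSymbol (extNormal σ ρ τ x)).mulVec g = g)
    (hd : ∀ j k, (1 - pauliSymbol (extNormal σ ρ τ x)).mulVec
        (outwardNormal Ω x k • d j - outwardNormal Ω x j • d k) =
      (pauliSymbol (extNormalDeriv σ ρ τ x j)).mulVec (outwardNormal Ω x k • g) -
        (pauliSymbol (extNormalDeriv σ ρ τ x k)).mulVec (outwardNormal Ω x j • g)) :
    posProj (normalEnd σ Ω τ x) (∑ j, (pauliMatrix j).mulVec (stretchFactor σ τ x j • d j)) =
      posProj (normalEnd σ Ω τ x) (transverseDeriv σ Ω τ x d + extCurvature σ ρ τ x • g) := by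
  obtain ⟨f, hf⟩ := exists_curl_extNormal hσ hτ h.smooth h.gradient_ne
  have hν : ∑ j, (outwardNormal Ω x j : ℂ) ^ 2 = 1 := by
    rw [h.outwardNormal_eq hx]
    exact_mod_cast sum_unitGradient_sq h.gradient_ne
  have hlam : ∀ j, (outwardNormal Ω x j : ℂ) * stretchFactor σ τ x j =
      conormalSq σ ρ τ x ^ (1 / 2 : ℂ) * extNormal σ ρ τ x j :=
    fun j => congrFun (nuTilde_eq hτ h hx) j
  have halg := transverse_algebra (sum_extNormal_sq hτ h.gradient_ne) hν hlam
    (sum_extNormal_mul_extNormalDeriv hσ hτ h.smooth h.gradient_ne) hf hg (d := d) (fun j k => by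
      simp only [Complex.coe_smul, Matrix.sub_mulVec, Matrix.smul_mulVec] at hd ⊢
      rw [hd, Matrix.mulVec_smul, Matrix.mulVec_smul])
  -- Since n_j = w^(-1/2) ν_j s_j, the operator V is Σ n_j s_j ∂_j.
  have htrans : transverseDeriv σ Ω τ x d = ∑ j, (extNormal σ ρ τ x j * stretchFactor σ τ x j) • d j := by
    rw [transverseDeriv, h.outwardNormal_eq hx, Finset.smul_sum]
    refine Finset.sum_congr rfl fun j _ => ?_
    rw [smul_smul, extNormal, conormalSq]
    congr 1
    ring
  rw [posProj_normalEnd_apply hτ h hx, posProj_normalEnd_apply hτ h hx, halg, htrans, extCurvature]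

/-- Localization of a smooth function by a cutoff. -/
theorem exists_cutoff {Y : Type*} [NormedAddCommGroup Y] [NormedSpace ℝ Y] {M : E3 → Y} {U : Set E3}
    (hU : IsOpen U) (hM : ∀ x ∈ U, ContDiffAt ℝ ∞ M x) {p : E3} (hp : p ∈ U) :
    ∃ Ψ : E3 → Y, ContDiff ℝ ∞ Ψ ∧ HasCompactSupport Ψ ∧
      (∃ V ∈ 𝓝 p, V ⊆ U ∧ ∀ x ∈ V, Ψ =ᶠ[𝓝 x] M) ∧ ∀ x, ∃ c : ℝ, (x ∉ U → c = 0) ∧ Ψ x = c • M x := by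
  obtain ⟨r, hr, hrU⟩ := Metric.isOpen_iff.1 hU p hp
  set χ : ContDiffBump p := ⟨r / 3, r / 2, by positivity, by linarith⟩ with hχ
  have hχU : tsupport χ ⊆ U := by
    rw [χ.tsupport_eq]
    exact (Metric.closedBall_subset_ball (by simp only [hχ]; linarith)).trans hrU
  refine ⟨fun x => χ x • M x, ?_, χ.hasCompactSupport.smul_right,
    ⟨Metric.ball p (r / 3), Metric.ball_mem_nhds _ (by positivity),
      (Metric.ball_subset_ball (by linarith)).trans hrU, fun x hx => ?_⟩,
    fun x => ⟨χ x, fun hx => image_eq_zero_of_notMem_tsupport fun h => hx (hχU h), rfl⟩⟩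
  · rw [contDiff_iff_contDiffAt]
    intro x
    by_cases hx : x ∈ tsupport χ
    · exact χ.contDiff.contDiffAt.smul (hM x (hχU hx))
    · refine contDiffAt_const (c := 0) |>.congr_of_eventuallyEq ?_
      filter_upwards [notMem_tsupport_iff_eventuallyEq.1 hx] with y hy
      simp [hy]
  · filter_upwards [Metric.isOpen_ball.mem_nhds hx] with y hy
    rw [χ.one_of_mem_closedBall (Metric.ball_subset_closedBall hy), one_smul]

/-- A property that holds almost everywhere near each boundary point holds almost everywhere on
the boundary. -/
theorem ae_surfaceMeasure_of_locally {P : E3 → Prop}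
    (h : ∀ p ∈ frontier Ω, ∃ U ∈ 𝓝 p, ∀ᵐ x ∂(surfaceMeasure Ω), x ∈ U → P x) :
    ∀ᵐ x ∂(surfaceMeasure Ω), P x := by
  have hnull : (surfaceMeasure Ω) (frontier Ω ∩ {x | ¬ P x}) = 0 := by
    refine measure_null_of_locally_null _ fun p hp => ?_
    obtain ⟨U, hU, hUP⟩ := h p hp.1
    refine ⟨(frontier Ω ∩ {x | ¬ P x}) ∩ U,
      inter_mem self_mem_nhdsWithin (mem_nhdsWithin_of_mem_nhds hU), ?_⟩
    refine measure_mono_null (fun x hx => ?_) (ae_iff.1 hUP)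
    exact fun hcon => hx.1.2 (hcon hx.2)
  filter_upwards [measure_eq_zero_iff_ae_notMem.1 hnull, ae_mem_frontier Ω] with x h1 h2
  by_contra hcon
  exact h1 ⟨h2, hcon⟩

/-- The transverse identity near a boundary point. -/
theorem transverseIdentity_locally (hσ : ∀ j, ContDiff ℝ ∞ (σ j)) (hΩ : IsSmoothDomain Ω)
    (hτ : Admissible σ τ) {H : E3 → ℂ}
    (hH : ∀ x ∈ frontier Ω, ∀ ρ, IsLocalDefiningFunction Ω x ρ → H x = extCurvature σ ρ τ x)
    {u : H2 Ω} {g : E3 → Spinor} {dg : Fin 3 → E3 → Spinor}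
    (hg : HasTrace Ω (sobVal u) (sobD u) g)
    (hdg : ∀ j, HasTrace Ω (sobD u j) (sobDD u j) (dg j))
    (hgpos : ∀ᵐ x ∂(surfaceMeasure Ω), g x ∈ posSpace (normalEnd σ Ω τ x))
    {p : E3} (hp : p ∈ frontier Ω) :
    ∃ U ∈ 𝓝 p, ∀ᵐ x ∂(surfaceMeasure Ω), x ∈ U →
      posProj (normalEnd σ Ω τ x)
          (∑ j, (pauliMatrix j).mulVec (stretchFactor σ τ x j • dg j x)) =
        posProj (normalEnd σ Ω τ x)
          (transverseDeriv σ Ω τ x (fun j => dg j x) + H x • g x) := by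
  obtain ⟨ρ, hρ⟩ := hΩ.boundary p hp
  obtain ⟨U, hUo, hpU, hU⟩ := exists_isOpen_isLocalDefiningFunction hρ
  -- On the boundary inside U, the operator M = 1 - N annihilates g, but it is smooth only near p.
  -- The cutoff version Ψ is a multiple of M and zero off U, so it annihilates g on the whole
  -- boundary; near p it has the same derivatives as M.
  set M : E3 → Spinor →L[ℂ] Spinor := fun x => 1 - pauliCLM (extNormal σ ρ τ x) with hM
  have hMd : ∀ x ∈ U, ContDiffAt ℝ ∞ M x := fun x hx =>
    contDiffAt_const.sub ((pauliCLM.restrictScalars ℝ).contDiff.contDiffAt.comp x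
      (contDiffAt_extNormal_right hσ hτ (hU x hx).smooth (hU x hx).gradient_ne))
  obtain ⟨Ψ, hΨ, hΨc, ⟨V, hVp, hVU, hΨM⟩, hΨs⟩ := exists_cutoff hUo hMd hpU
  have hΨg : ∀ᵐ x ∂(surfaceMeasure Ω), Ψ x (g x) = 0 := by
    filter_upwards [hgpos, ae_mem_frontier Ω] with x h1 h2
    obtain ⟨c, hc, hΨx⟩ := hΨs x
    rw [hΨx]
    change c • (g x - (pauliSymbol (extNormal σ ρ τ x)).mulVec (g x)) = 0
    by_cases hx : x ∈ U
    · rw [(mem_posSpace_normalEnd_iff hτ (hU x hx) h2).1 h1, sub_self, smul_zero]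
    · rw [hc hx, zero_smul]
  refine ⟨V, hVp, ?_⟩
  have hprod := fun j k => tangential_product_rule hΩ hg hdg hΨ hΨc hΨg j k
  simp only [← ae_all_iff] at hprod
  filter_upwards [hprod, hgpos, ae_mem_frontier Ω] with x h1 h2 hx hxV
  have hxU : x ∈ U := hVU hxV
  have hdM : ∀ v, fderiv ℝ Ψ x v = -pauliCLM (fderiv ℝ (extNormal σ ρ τ) x v) := by
    intro v
    have hd := ((contDiffAt_extNormal_right hσ hτ (hU x hxU).smooth
      (hU x hxU).gradient_ne).differentiableAt (by simp)).hasFDerivAt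
    have h3 : HasFDerivAt M (-((pauliCLM.restrictScalars ℝ) ∘L
        fderiv ℝ (extNormal σ ρ τ) x)) x :=
      ((pauliCLM.restrictScalars ℝ).hasFDerivAt.comp x hd).const_sub 1
    rw [(hΨM x hxV).fderiv_eq, h3.fderiv]
    rfl
  rw [hH x hx ρ (hU x hxU)]
  refine transverse_pointwise hσ hτ (hU x hxU) hx
    ((mem_posSpace_normalEnd_iff hτ (hU x hxU) hx).1 h2) fun j k => ?_
  have h4 := h1 j k
  rw [hdM, hdM, (hΨM x hxV).self_of_nhds] at h4
  have h5 : ∀ v, M x v = (1 - pauliSymbol (extNormal σ ρ τ x)).mulVec v := fun v => by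
    rw [Matrix.sub_mulVec, Matrix.one_mulVec]
    rfl
  rw [h5] at h4
  rw [h4, _root_.neg_apply, _root_.neg_apply, neg_sub_neg]
  rfl

/-- The transverse identity, for real and complex parameters alike. -/
theorem transverseIdentity (hσ : ∀ j, ContDiff ℝ ∞ (σ j)) (hΩ : IsSmoothDomain Ω)
    (hτ : Admissible σ τ) {H : E3 → ℂ}
    (hH : ∀ x ∈ frontier Ω, ∀ ρ, IsLocalDefiningFunction Ω x ρ → H x = extCurvature σ ρ τ x)
    {u : H2 Ω} (hu : BoundaryCondition σ Ω τ u) : TransverseIdentity σ Ω τ H u := by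
  intro g dg hg hdg
  obtain ⟨g', hg', hpos⟩ := hu
  -- The boundary condition provides some trace, the identity concerns an arbitrary one; uniqueness
  -- of traces reconciles them.
  have hgpos : ∀ᵐ x ∂(surfaceMeasure Ω), g x ∈ posSpace (normalEnd σ Ω τ x) := by
    filter_upwards [hg.ae_unique hΩ hg', hpos] with x h1 h2
    rwa [h1]
  exact ae_surfaceMeasure_of_locally fun p hp =>
    transverseIdentity_locally hσ hΩ hτ hH hg hdg hgpos hp

end Transverse

/-! ### The extended normal and curvature on the boundary -/

section Boundary

variable {σ : Fin 3 → ℝ → ℝ} {Ω : Set E3} {τ : ℂ} {x : E3} {D : Set ℂ}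

/-- The complexified unit normal of the stretched domain. -/
def boundaryNormal (σ : Fin 3 → ℝ → ℝ) (Ω : Set E3) (τ : ℂ) (x : E3) (j : Fin 3) : ℂ :=
  (∑ j, (outwardNormal Ω x j : ℂ) ^ 2 * stretchFactor σ τ x j ^ 2) ^ (-(1 / 2) : ℂ) *
    nuTilde σ Ω τ x j

open Classical in
/-- The complexified mean curvature of the stretched domain. -/
def boundaryCurvature (σ : Fin 3 → ℝ → ℝ) (Ω : Set E3) (τ : ℂ) (x : E3) : ℂ :=
  if h : ∃ ρ, IsLocalDefiningFunction Ω x ρ then extCurvature σ h.choose τ x else 0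

theorem boundaryNormal_eq {ρ : E3 → ℝ} (h : IsLocalDefiningFunction Ω x ρ) (hx : x ∈ frontier Ω) :
    boundaryNormal σ Ω τ x = extNormal σ ρ τ x := by
  funext j
  rw [boundaryNormal, nuTilde, extNormal, conormalSq, h.outwardNormal_eq hx]

theorem boundaryCurvature_eq (hσ : ∀ j, ContDiff ℝ ∞ (σ j)) (hτ : Admissible σ τ) {ρ : E3 → ℝ}
    (h : IsLocalDefiningFunction Ω x ρ) (hx : x ∈ frontier Ω) :
    boundaryCurvature σ Ω τ x = extCurvature σ ρ τ x := by
  have hex : ∃ ρ, IsLocalDefiningFunction Ω x ρ := ⟨ρ, h⟩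
  rw [boundaryCurvature, dif_pos hex]
  exact extCurvature_unique hσ hτ hex.choose_spec h hx

theorem holomorphic_boundaryNormal (hσ : ∀ j, ContDiff ℝ ∞ (σ j)) (hΩ : IsSmoothDomain Ω)
    (hDo : IsOpen D) (hD : ∀ τ ∈ D, Admissible σ τ) :
    HolomorphicIntoSmooth D (frontier Ω) (boundaryNormal σ Ω) := by
  refine (holomorphicIntoSmooth_of_extNormal hσ hΩ hDo hD (ContinuousLinearMap.id ℂ _) 0 1
    fun τ _ x hx ρ hρ => ?_).1
  rw [boundaryNormal_eq hρ hx, one_smul, zero_add, ContinuousLinearMap.id_apply]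

theorem holomorphic_boundaryCurvature (hσ : ∀ j, ContDiff ℝ ∞ (σ j)) (hΩ : IsSmoothDomain Ω)
    (hDo : IsOpen D) (hD : ∀ τ ∈ D, Admissible σ τ) :
    HolomorphicIntoSmooth D (frontier Ω) (boundaryCurvature σ Ω) := by
  refine holomorphicIntoSmooth_of_local hDo fun x hx => ?_
  obtain ⟨ρ, hρ⟩ := hΩ.boundary x hx
  obtain ⟨U, hUo, hxU, hU⟩ := exists_isOpen_isLocalDefiningFunction hρ
  exact ⟨U, hUo, hxU, _, holSmoothOn_extCurvature hσ hDo hUo hD hρ.smooth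
    fun y hy => (hU y hy).gradient_ne,
    fun τ hτ y hy => boundaryCurvature_eq hσ (hD τ hτ) (hU y hy.2) hy.1⟩

theorem exists_roots_charpoly_normalMatrix (hΩ : IsSmoothDomain Ω)
    (hτ : ∀ (n : Fin 3 → ℝ) (x : E3), ∑ j, n j ^ 2 = 1 →
      ‖∑ j, (n j : ℂ) ^ 2 * stretchFactor σ τ x j ^ 2 - 1‖ < 1 / 2) (hx : x ∈ frontier Ω) :
    ∃ z₁ ∈ Metric.ball (1 : ℂ) 1, ∃ z₂ ∈ Metric.ball (-1 : ℂ) 1,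
      (normalMatrix σ Ω τ x).charpoly.roots = {z₁, z₂} := by
  obtain ⟨ρ, hρ⟩ := hΩ.boundary x hx
  have h := norm_cpow_half_sub_one_lt (hτ _ x (sum_unitGradient_sq hρ.gradient_ne))
  refine ⟨conormalSq σ ρ τ x ^ (1 / 2 : ℂ), mem_ball_iff_norm.2 h,
    -conormalSq σ ρ τ x ^ (1 / 2 : ℂ), ?_, roots_charpoly_pauliSymbol (sum_nuTilde_sq hρ hx)⟩
  rw [mem_ball_iff_norm, ← norm_neg, neg_sub_neg, neg_sub]
  exact h

end Boundary

end StretchedPauli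

end

/-! ### The main theorem -/

open StretchedPauli in
theorem mainTheorem8 (L : Fin 3 → ℝ) (hL : ∀ j, 0 < L j) (σ : Fin 3 → ℝ → ℝ)
    (hσ_smooth : ∀ j, ContDiff ℝ ∞ (σ j)) (hσ_supp : ∀ j, HasCompactSupport (σ j))
    (hσ_nonneg : ∀ j s, 0 ≤ σ j s) :
    ∃ m R₁ R₂ R₃ : ℝ, 0 < m ∧ 1 < R₁ ∧ R₁ ≤ R₂ ∧ R₂ ≤ R₃ ∧
      ∀ δ : ℝ, 0 < δ → δ < 1 → ∀ Ω : Set E3, IsSmoothedBox L δ Ω →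
        -- the transverse identity for real `τ > m`
        (∀ τ : ℝ, m < τ → ∀ u : H2 Ω, BoundaryCondition σ Ω τ u →
          TransverseIdentity σ Ω τ
            (fun x => (meanCurvature (stretchedDomain σ τ Ω) (stretch σ τ x) : ℂ)) u) ∧
        -- i. the spectrum of `A(ν̃)`, and holomorphy of its spectral projections
        (∀ τ : ℂ, R₁ < ‖τ‖ → ∀ x ∈ frontier Ω,
          ∃ z₁ ∈ Metric.ball (1 : ℂ) 1, ∃ z₂ ∈ Metric.ball (-1 : ℂ) 1,
            (normalMatrix σ Ω τ x).charpoly.roots = {z₁, z₂}) ∧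
        (∀ x ∈ frontier Ω,
          AnalyticOnNhd ℂ
            (fun τ => LinearMap.toContinuousLinearMap (posProj (normalEnd σ Ω τ x)))
            {τ | R₁ < ‖τ‖} ∧
          AnalyticOnNhd ℂ
            (fun τ => LinearMap.toContinuousLinearMap (negProj (normalEnd σ Ω τ x)))
            {τ | R₁ < ‖τ‖}) ∧
        HolomorphicIntoSmooth {τ | R₁ < ‖τ‖} (frontier Ω)
          (fun τ x => LinearMap.toContinuousLinearMap (posProj (normalEnd σ Ω τ x))) ∧
        HolomorphicIntoSmooth {τ | R₁ < ‖τ‖} (frontier Ω)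
          (fun τ x => LinearMap.toContinuousLinearMap (negProj (normalEnd σ Ω τ x))) ∧
        -- ii. the unit normal of the stretched domain
        (∃ N : ℂ → E3 → (Fin 3 → ℂ),
          HolomorphicIntoSmooth {τ | R₂ < ‖τ‖} (frontier Ω) N ∧
          ∀ τ : ℝ, m < τ → R₂ < τ → ∀ x ∈ frontier Ω, ∀ j,
            N τ x j = (outwardNormal (stretchedDomain σ τ Ω) (stretch σ τ x) j : ℂ)) ∧
        -- iii. the mean curvature of the stretched domain
        ∃ H : ℂ → E3 → ℂ,
          HolomorphicIntoSmooth {τ | R₃ < ‖τ‖} (frontier Ω) H ∧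
          (∀ τ : ℝ, m < τ → R₃ < τ → ∀ x ∈ frontier Ω,
            H τ x = (meanCurvature (stretchedDomain σ τ Ω) (stretch σ τ x) : ℂ)) ∧
          -- iv. the transverse identity for complex `τ`
          ∀ O : Set ℂ, IsOpen O → IsConnected O → O ⊆ {τ | R₃ < ‖τ‖} → (∃ t : ℝ, (t : ℂ) ∈ O) →
            ∀ u : ℂ → H2 Ω, DifferentiableOn ℂ u O →
              (∀ τ ∈ O, BoundaryCondition σ Ω τ (u τ)) →
              ∀ τ ∈ O, TransverseIdentity σ Ω τ (H τ) (u τ) := by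
  obtain ⟨R, hR1, hR⟩ := exists_radius hσ_smooth hσ_supp
  have hadm : ∀ τ ∈ {τ : ℂ | R < ‖τ‖}, Admissible σ τ := fun τ hτ =>
    ⟨(hR τ hτ).1, fun n x hn => mem_slitPlane_of_norm_sub_one_lt ((hR τ hτ).2 n x hn)⟩
  have hD : IsOpen {τ : ℂ | R < ‖τ‖} := isOpen_lt continuous_const continuous_norm
  -- Any positive m would do, since all real τ > 0 are admissible. A single radius serves for the
  -- spectrum, the normal and the curvature.
  refine ⟨1, R, R, R, one_pos, hR1, le_rfl, le_rfl, fun δ _ _ Ω hΩδ => ?_⟩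
  have hΩ := hΩδ.smoothDomain
  have hpos := holomorphic_posProj hσ_smooth hΩ hD hadm
  have hneg := holomorphic_negProj hσ_smooth hΩ hD hadm
  have hmem : ∀ τ : ℝ, R < τ → (τ : ℂ) ∈ {τ : ℂ | R < ‖τ‖} := fun τ hτ => by
    change R < ‖(τ : ℂ)‖
    rw [Complex.norm_real]
    exact hτ.trans_le (le_abs_self τ)
  refine ⟨fun τ hτ u hu => ?_,
    fun τ hτ x hx => exists_roots_charpoly_normalMatrix hΩ (hR τ hτ).2 hx,
    fun x hx => ⟨hpos.2 x hx, hneg.2 x hx⟩, hpos.1, hneg.1,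
    ⟨boundaryNormal σ Ω, holomorphic_boundaryNormal hσ_smooth hΩ hD hadm,
      fun τ hτ _ x hx j => ?_⟩,
    boundaryCurvature σ Ω, holomorphic_boundaryCurvature hσ_smooth hΩ hD hadm,
    fun τ hτ hτR x hx => ?_, fun O _ _ hO _ u _ hu τ hτ => ?_⟩
  · have hτ0 : 0 < τ := one_pos.trans hτ
    exact transverseIdentity hσ_smooth hΩ (admissible_of_pos hσ_nonneg hτ0)
      (fun x hx ρ hρ => meanCurvature_stretchedDomain hσ_smooth hσ_nonneg hτ0 hρ hx) hu
  · obtain ⟨ρ, hρ⟩ := hΩ.boundary x hx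
    rw [boundaryNormal_eq hρ hx,
      outwardNormal_stretchedDomain hσ_smooth hσ_nonneg (one_pos.trans hτ) hρ hx]
  · obtain ⟨ρ, hρ⟩ := hΩ.boundary x hx
    rw [boundaryCurvature_eq hσ_smooth (hadm τ (hmem τ hτR)) hρ hx,
      meanCurvature_stretchedDomain hσ_smooth hσ_nonneg (one_pos.trans hτ) hρ hx]
  -- The pointwise argument applies at each complex τ by itself, with the extended curvature in
  -- place of the geometric one.
  · exact transverseIdentity hσ_smooth hΩ (hadm τ (hO hτ))
      (fun x hx ρ hρ => boundaryCurvature_eq hσ_smooth (hadm τ (hO hτ)) hρ hx) (hu τ hτ)
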